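/- Let $n\ge 1$ be an integer, let $\nu$ be Lebesgue measure on $\mathbb C^n$, $\langle z,w\rangle=\sum_j z_j\overline{w_j}$, $|z|^2=\langle z,z\rangle$, and $\mathcal H=L^2(\mathbb C^n,e^{-|w|^2}d\nu(w))$. Let $\widetilde\Delta$ be the magnetic Laplacian, i.e. the closure in $\mathcal H$ of the operator $$-\sum_{j=1}^n\frac{\partial^2}{\partial z_j\partial\overline z_j}+\sum_{j=1}^n\overline z_j\frac{\partial}{\partial\overline z_j}$$ with domain $C_c^\infty(\mathbb C^n)$ (a self-adjoint operator). For $m\in\mathbb Z_+=\{0,1,2,\dots\}$ let $K_m(z,w)=\pi^{-n}e^{\langle z,w\rangle}L_m^{(n-1)}(|z-w|^2)$, where $L_m^{(\alpha)}(x)=\sum_{i=0}^m(-1)^i\binom{m+\alpha}{m-i}\frac{x^i}{i!}$, and let $$\mathfrak B_m[\varphi](z)=\int_{\mathbb C^n}e^{\langle z,w\rangle}\frac{|K_m(z,w)|^2}{K_m(z,z)K_m(w,w)}\,\varphi(w)\,e^{-|w|^2}d\nu(w)$$ be the phase-deformed magnetic Berezin transform. Theorem. For every $n\ge1$ and $m\in\mathbb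 Z_+$, the integral defining $\mathfrak B_m[\varphi](z)$ converges absolutely for all $\varphi\in\mathcal H$ and $z\in\mathbb C^n$, $\mathfrak B_m$ is a bounded operator on $\mathcal H$, and in the sense of the Borel functional calculus of the self-adjoint operator $\widetilde\Delta$ $$\mathfrak B_m=g(\widetilde\Delta),$$ where $g(\lambda)=0$ for $\lambda<0$ and, for $\lambda\ge0$, $$g(\lambda)=\pi^n\,2^{2m-n}\Big(\frac{m!}{(n)_m}\Big)^2\sum_{j=0}^{2m}\frac{(-1)^j\,2^{-2j}}{(2m-j)!}\;c_j\;\frac{\Gamma(j+n+\lambda)}{\Gamma(n+\lambda)}\,e^{-\lambda\log 2}.$$ Here $(a)_k=a(a+1)\cdots(a+k-1)$ and $$c_j=\frac{1}{\Gamma(j-m+1)^2}\;{}_3F_2\Big(\tfrac{j-2m}2,\tfrac{j-2m+1}2,j+n;\,j-m+1,j-m+1;\,1\Big),$$ read for $j<m$ as the regularized hypergeometric value, i.e. for all $0\le j\le 2m$ as the terminating sum $$c_j=\sum_{k\ge0}\frac{\big(\frac{j-2m}2\big)_k\big(\frac{j-2m+1}2\big)_k(j+n)_k}{k!\,\Gamma(j-m+1+k)^2},\qquad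 \tfrac1{\Gamma(-i)}=0\ \text{ for } i=0,1,2,\dots$$ -/

import Mathlib

open MeasureTheory
open scoped ContDiff

noncomputable section

/-! ### Spectral calculus of unbounded self-adjoint operators -/

namespace SpectralCalculus

variable {H : Type*} [NormedAddCommGroup H] [InnerProductSpace ℂ H] [CompleteSpace H]

/-- A resolution of the identity (projection-valued measure) on the Borel sets of `ℝ`: each Borel
set is sent to an orthogonal projection, `ℝ` is sent to the identity, and the assignment is
countably additive in the strong operator topology. -/
structure ResolutionOfIdentity (H : Type*) [NormedAddCommGroup H] [InnerProductSpace ℂ H]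
    [CompleteSpace H] where
  /-- The projection attached to a Borel set (values on other sets are irrelevant). -/
  proj : Set ℝ → (H →L[ℂ] H)
  isStarProjection : ∀ S, MeasurableSet S → IsStarProjection (proj S)
  proj_univ : proj Set.univ = 1
  hasSum_iUnion : ∀ S : ℕ → Set ℝ, (∀ i, MeasurableSet (S i)) →
    Pairwise (Function.onFun Disjoint S) →
    ∀ x : H, HasSum (fun i => proj (S i) x) (proj (⋃ i, S i) x)

namespace ResolutionOfIdentity

variable (E : ResolutionOfIdentity H)

theorem proj_empty (x : H) : E.proj ∅ x = 0 := by
  have h := E.hasSum_iUnion (fun _ => ∅) (fun _ => MeasurableSet.empty)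
    (fun _ _ _ => disjoint_bot_left) x
  have h2 := h.summable.tendsto_atTop_zero
  exact tendsto_nhds_unique tendsto_const_nhds h2

theorem inner_proj_self {S : Set ℝ} (hS : MeasurableSet S) (x : H) :
    inner ℂ x (E.proj S x) = ((‖E.proj S x‖ ^ 2 : ℝ) : ℂ) := by
  have h := E.isStarProjection S hS
  have h1 : E.proj S (E.proj S x) = E.proj S x := by
    have := congrArg (fun T : H →L[ℂ] H => T x) h.isIdempotentElem.eq
    simpa using this
  have h2 : inner ℂ x (E.proj S (E.proj S x)) = inner ℂ (E.proj S x) (E.proj S x) := by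
    rw [← ContinuousLinearMap.adjoint_inner_left, ← ContinuousLinearMap.star_eq_adjoint,
      h.isSelfAdjoint.star_eq]
  rw [h1] at h2
  rw [h2, inner_self_eq_norm_sq_to_K]
  norm_cast

/-- The scalar spectral measure `S ↦ ⟨x, E(S) x⟩ = ‖E(S) x‖²` of a vector `x`. -/
def scalarMeasure (x : H) : Measure ℝ :=
  Measure.ofMeasurable (fun S _ => ENNReal.ofReal (‖E.proj S x‖ ^ 2))
    (by simp [E.proj_empty x])
    (by
      intro S hS hd
      have h := (E.hasSum_iUnion S hS hd x).mapL (innerSL ℂ x)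
      have h' : HasSum (fun i => ‖E.proj (S i) x‖ ^ 2) (‖E.proj (⋃ i, S i) x‖ ^ 2) := by
        rw [← Complex.hasSum_ofReal]
        simp only [innerSL_apply_apply] at h
        rw [E.inner_proj_self (MeasurableSet.iUnion hS)] at h
        simpa only [E.inner_proj_self (hS _)] using h
      rw [← h'.tsum_eq, ENNReal.ofReal_tsum_of_nonneg (fun i => sq_nonneg _) h'.summable])

/-- `T = ∫ g dE` as a (possibly unbounded) operator: the domain of `T` consists of the vectors `x`
with `∫ |g|² d⟨x, E x⟩ < ∞`, and `⟨x, T x⟩ = ∫ g d⟨x, E x⟩` there. By polarization and the density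
of this domain, these two conditions determine `T`. -/
def IsIntegral (g : ℝ → ℂ) (T : H →ₗ.[ℂ] H) : Prop :=
  (∀ x : H, x ∈ T.domain ↔ MemLp g 2 (E.scalarMeasure x)) ∧
  ∀ x : T.domain, inner ℂ (x : H) (T x) = ∫ t, g t ∂(E.scalarMeasure (x : H))

end ResolutionOfIdentity

/-- `T = g(A)` in the Borel functional calculus: `A` has a spectral resolution `A = ∫ t dE(t)`
(so that `A` is self-adjoint and `E` is its unique spectral measure) and `T = ∫ g(t) dE(t)`. -/
def IsFunctionOf (A : H →ₗ.[ℂ] H) (g : ℝ → ℂ) (T : H →ₗ.[ℂ] H) : Prop :=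
  ∃ E : ResolutionOfIdentity H, E.IsIntegral (fun t => (t : ℂ)) A ∧ E.IsIntegral g T

end SpectralCalculus

/-! ### The magnetic Laplacian on `L²(ℂⁿ, e^{-|w|²} dν)` -/

namespace Magnetic

/-- The square of the Euclidean norm on `ℂⁿ`. -/
def normSq {n : ℕ} (z : Fin n → ℂ) : ℝ := ∑ j, ‖z j‖ ^ 2

/-- The Hermitian product `⟨z, w⟩ = ∑ z_j \bar w_j` on `ℂⁿ`, linear in `z`. -/
def herm {n : ℕ} (z w : Fin n → ℂ) : ℂ := ∑ j, z j * (starRingEnd ℂ) (w j)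

/-- The measure `e^{-|w|²} dν(w)` on `ℂⁿ`, with `ν` Lebesgue measure. -/
def gaussian (n : ℕ) : Measure (Fin n → ℂ) :=
  (volume : Measure (Fin n → ℂ)).withDensity (fun w => ENNReal.ofReal (Real.exp (-normSq w)))

/-- The Hilbert space `L²(ℂⁿ, e^{-|w|²} dν)`. -/
abbrev L2 (n : ℕ) : Type := Lp ℂ 2 (gaussian n)

/-- The Wirtinger derivative `∂/∂z_j = (∂/∂x_j - i ∂/∂y_j) / 2`. -/
def dz {n : ℕ} (j : Fin n) (f : (Fin n → ℂ) → ℂ) (z : Fin n → ℂ) : ℂ :=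
  (fderiv ℝ f z (Pi.single j 1) - Complex.I * fderiv ℝ f z (Pi.single j Complex.I)) / 2

/-- The Wirtinger derivative `∂/∂\bar z_j = (∂/∂x_j + i ∂/∂y_j) / 2`. -/
def dzbar {n : ℕ} (j : Fin n) (f : (Fin n → ℂ) → ℂ) (z : Fin n → ℂ) : ℂ :=
  (fderiv ℝ f z (Pi.single j 1) + Complex.I * fderiv ℝ f z (Pi.single j Complex.I)) / 2

/-- The differential expression
`- ∑ ∂²f/∂z_j∂\bar z_j + ∑ \bar z_j ∂f/∂\bar z_j`. -/
def diffOp {n : ℕ} (f : (Fin n → ℂ) → ℂ) (z : Fin n → ℂ) : ℂ :=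
  -∑ j, dz j (dzbar j f) z + ∑ j, (starRingEnd ℂ) (z j) * dzbar j f z

theorem differentiable_dzbar {n : ℕ} (j : Fin n) {f : (Fin n → ℂ) → ℂ} (hf : ContDiff ℝ ∞ f) :
    Differentiable ℝ (dzbar j f) := by
  have h : ContDiff ℝ ∞ (fderiv ℝ f) := hf.fderiv_right (m := ∞) (by simp)
  have hd : Differentiable ℝ (fderiv ℝ f) := h.differentiable (by simp)
  unfold dzbar
  fun_prop

theorem diffOp_add {n : ℕ} {f g : (Fin n → ℂ) → ℂ} (hf : ContDiff ℝ ∞ f)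
    (hg : ContDiff ℝ ∞ g) : diffOp (f + g) = diffOp f + diffOp g := by
  have hf' : Differentiable ℝ f := hf.differentiable (by simp)
  have hg' : Differentiable ℝ g := hg.differentiable (by simp)
  have h1 : ∀ j, dzbar j (f + g) = dzbar j f + dzbar j g := by
    intro j; ext z
    simp only [dzbar, Pi.add_apply, fderiv_add (hf' z) (hg' z), add_apply]
    ring
  have h2 : ∀ j z, dz j (dzbar j f + dzbar j g) z = dz j (dzbar j f) z + dz j (dzbar j g) z := by
    intro j z
    simp only [dz, fderiv_add (differentiable_dzbar j hf z) (differentiable_dzbar j hg z),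
      add_apply]
    ring
  ext z
  simp only [diffOp, h1, h2, Pi.add_apply, mul_add, Finset.sum_add_distrib]
  ring

theorem diffOp_smul {n : ℕ} (c : ℂ) {f : (Fin n → ℂ) → ℂ} (hf : ContDiff ℝ ∞ f) :
    diffOp (c • f) = c • diffOp f := by
  have hf' : Differentiable ℝ f := hf.differentiable (by simp)
  have h1 : ∀ j, dzbar j (c • f) = c • dzbar j f := by
    intro j; ext z
    simp only [dzbar, Pi.smul_apply, fderiv_const_smul (hf' z), smul_apply,
      smul_eq_mul]
    ring
  have h2 : ∀ j z, dz j (c • dzbar j f) z = c * dz j (dzbar j f) z := by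
    intro j z
    simp only [dz, fderiv_const_smul (differentiable_dzbar j hf z),
      smul_apply, smul_eq_mul]
    ring
  ext z
  simp only [diffOp, h1, h2, Pi.smul_apply, smul_eq_mul, mul_add, Finset.mul_sum, mul_neg]
  congr 1
  exact Finset.sum_congr rfl fun j _ => by ring

/-- The graph in `L² × L²` of the differential expression on smooth compactly supported
functions. -/
def minimalGraph (n : ℕ) : Submodule ℂ (L2 n × L2 n) where
  carrier := {p | ∃ f : (Fin n → ℂ) → ℂ, ContDiff ℝ ∞ f ∧ HasCompactSupport f ∧
    p.1 =ᵐ[gaussian n] f ∧ p.2 =ᵐ[gaussian n] diffOp f}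
  zero_mem' := by
    refine ⟨0, contDiff_const, HasCompactSupport.zero, Lp.coeFn_zero _ _ _, ?_⟩
    have h : diffOp (0 : (Fin n → ℂ) → ℂ) = 0 := by
      have := diffOp_smul (0 : ℂ) (f := (0 : (Fin n → ℂ) → ℂ)) contDiff_const
      simpa using this
    rw [h]
    exact Lp.coeFn_zero _ _ _
  add_mem' := by
    rintro p q ⟨f, hf, hfc, hp1, hp2⟩ ⟨g, hg, hgc, hq1, hq2⟩
    refine ⟨f + g, hf.add hg, hfc.add hgc, (Lp.coeFn_add _ _).trans (hp1.add hq1), ?_⟩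
    rw [diffOp_add hf hg]
    exact (Lp.coeFn_add _ _).trans (hp2.add hq2)
  smul_mem' := by
    rintro c p ⟨f, hf, hfc, hp1, hp2⟩
    refine ⟨c • f, contDiff_const.smul hf, hfc.smul_left (f := fun _ => c),
      (Lp.coeFn_smul _ _).trans (hp1.const_smul c), ?_⟩
    rw [diffOp_smul c hf]
    exact (Lp.coeFn_smul _ _).trans (hp2.const_smul c)

/-- The magnetic Laplacian `Δ̃` as an operator in `L²(ℂⁿ, e^{-|w|²} dν)`: the closure of the
differential expression `diffOp` on its natural regular domain `C_c^∞(ℂⁿ)`. -/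
def magneticLaplacian (n : ℕ) : L2 n →ₗ.[ℂ] L2 n :=
  ((minimalGraph n).toLinearPMap).closure

/-! ### The phase-deformed magnetic Berezin transform -/

/-- The Laguerre polynomial
`L_m^{(α)}(x) = ∑_{i=0}^m (-1)^i \binom{m+α}{m-i} x^i / i!` for `α ∈ ℕ`. -/
def laguerre (m α : ℕ) (x : ℝ) : ℝ :=
  ∑ i ∈ Finset.range (m + 1),
    (-1 : ℝ) ^ i * ((m + α).choose (m - i) : ℝ) * x ^ i / (i.factorial : ℝ)

/-- The kernel `K_m(z,w) = π^{-n} e^{⟨z,w⟩} L_m^{(n-1)}(|z-w|²)` of the generalized Bargmann space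
of level `m`. -/
def bargmannKernel (n m : ℕ) (z w : Fin n → ℂ) : ℂ :=
  ((1 / Real.pi ^ n : ℝ) : ℂ) * Complex.exp (herm z w) *
    ((laguerre m (n - 1) (normSq (z - w)) : ℝ) : ℂ)

/-- The integral kernel
`e^{⟨z,w⟩} |K_m(z,w)|² / (K_m(z,z) K_m(w,w))` with respect to `e^{-|w|²} dν(w)`. -/
def deformedKernel (n m : ℕ) (z w : Fin n → ℂ) : ℂ :=
  Complex.exp (herm z w) *
    (((‖bargmannKernel n m z w‖ ^ 2 : ℝ) : ℂ) /
      (bargmannKernel n m z z * bargmannKernel n m w w))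

/-- The phase-deformed magnetic Berezin transform `𝔅_m[φ](z)`. -/
def deformedBerezin (n m : ℕ) (φ : (Fin n → ℂ) → ℂ) (z : Fin n → ℂ) : ℂ :=
  ∫ w, deformedKernel n m z w * φ w ∂(gaussian n)

/-- The coefficient of index `j` in the spectral function,
`(-1)^j 2^{-2j} / (2m-j)! · ₃F₂((j-2m)/2, (j-2m+1)/2, j+n; j-m+1, j-m+1; 1) / Γ(j-m+1)²`.
The quotient `₃F₂ / Γ(j-m+1)²` is the regularized hypergeometric function, which also makes sense
when `j < m`; the series terminates for `0 ≤ j ≤ 2m`. -/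
def spectralCoeff (n m j : ℕ) : ℂ :=
  (-1 : ℂ) ^ j * (2 : ℂ) ^ (-(2 * (j : ℤ))) / ((2 * m - j).factorial : ℂ) *
    Complex.regularizedHGFun
      {((j : ℂ) - 2 * m) / 2, ((j : ℂ) - 2 * m + 1) / 2, (j : ℂ) + n}
      {(j : ℂ) - m + 1, (j : ℂ) - m + 1} 1

/-- The spectral function `g`, extended by `0` to the negative half-line. -/
def spectralFunction (n m : ℕ) (t : ℝ) : ℂ :=
  if 0 ≤ t then
    (Real.pi : ℂ) ^ n * (2 : ℂ) ^ (2 * (m : ℤ) - n) *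
      ((m.factorial : ℂ) / (ascPochhammer ℂ m).eval (n : ℂ)) ^ 2 *
      ∑ j ∈ Finset.range (2 * m + 1), spectralCoeff n m j *
        ((Real.Gamma (j + n + t) / Real.Gamma (n + t) * Real.exp (-Real.log 2 * t) : ℝ) : ℂ)
  else 0

end Magnetic

end

/-!
The proof diagonalizes the magnetic Laplacian and the deformed Berezin transform simultaneously, by
means of the explicit functions
`eigenfunction u v k z = e ^ (u·z) (v·(z̄ - u)) ^ k`, `u, v ∈ ℂⁿ`, `k ∈ ℕ`.

*Magnetic Laplacian.* These functions satisfy `diffOp E = k E` (`diffOp_eigenfunction`). They have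
exponential growth, so that cutting them off shows that they belong to the domain of the closure
(`mem_topologicalClosure_minimalGraph`), and integration by parts shows that `diffOp` is symmetric
(`integral_conj_mul_diffOp`). Hence the closed spans of the eigenfunctions with different `k` are
orthogonal. They are total because the exponential series in `k` produces all characters of `ℂⁿ`
(`eq_zero_of_forall_inner_eigenvector`). So `L²` is the Hilbert sum of these eigenspaces, and the
closure of the minimal graph is the maximal operator that multiplies the `k`-th component by `k`
(`mem_graph_magneticLaplacian_iff`). Its resolution of the identity is the one attached to the
Hilbert sum, and functions of it are diagonal operators (`isFunctionOf_diagonal`).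

*Berezin transform.* The kernel equals `e ^ ⟨z, w⟩ F(|z - w|²)` with
`F(t) = e ^ (-t) (L_m(t) / L_m(0))²` (`deformedKernel_eq`). After the substitution `w = z + ζ`, the
transform of an eigenfunction is a combination of the radial moments
`∫ |ζ| ^ (2 p) (v·(a + ζ̄)) ^ k e ^ (-a·ζ) e ^ (-2|ζ|²)` with `a = z̄ - u`. They are derivatives of the
Gaussian integral `∫ e ^ (-c|ζ|² - a·ζ + b·ζ̄) = (π / c)ⁿ e ^ (-a·b / c)` and are multiples of
`(v·a) ^ k` (`integral_normSq_pow_mul`), so the eigenfunctions are eigenfunctions of the transform as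
well. The resulting eigenvalue is a double sum over the coefficients of `L_m`, and the generating
function of the Laguerre polynomials identifies it with the value at `k` of the spectral function
(`spectralFunction_natCast`).

The spectral function is bounded on `ℕ`, so it defines a bounded diagonal operator. That operator is
the integral transform on all of `L²`, because for fixed `z` the kernel is square integrable in `w`
and the span of the eigenfunctions is dense (`berezinOperator_ae_eq`).
-/

noncomputable section

/-! ### Diagonal operators and the functional calculus of a Hilbert sum -/

namespace SpectralCalculus

open Filter Topology

variable {H : Type*} [NormedAddCommGroup H] [InnerProductSpace ℂ H]
variable {G : ℕ → Type*} [∀ k, NormedAddCommGroup (G k)] [∀ k, InnerProductSpace ℂ (G k)]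

theorem hasSum_norm_sq_coord (U : H ≃ₗᵢ[ℂ] lp G 2) (x : H) :
    HasSum (fun k => ‖U x k‖ ^ 2) (‖x‖ ^ 2) := by
  have h := lp.hasSum_norm (p := 2) (by simp) (U x)
  simpa using h

theorem memℓp_smul {f : ℕ → ℂ} {x : ∀ k, G k} (h : Summable fun k => ‖f k‖ ^ 2 * ‖x k‖ ^ 2) :
    Memℓp (fun k => f k • x k) 2 := by
  refine memℓp_gen ?_
  simpa [norm_smul, mul_pow] using h

theorem summable_smul_coord (U : H ≃ₗᵢ[ℂ] lp G 2) {f : ℕ → ℂ} (hf : ∃ C, ∀ k, ‖f k‖ ≤ C) (x : H) :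
    Summable fun k => ‖f k‖ ^ 2 * ‖U x k‖ ^ 2 := by
  obtain ⟨C, hC⟩ := hf
  refine ((hasSum_norm_sq_coord U x).summable.mul_left (C ^ 2)).of_nonneg_of_le
    (fun k => by positivity) fun k => ?_
  have := hC k
  gcongr

/-- The bounded operator that multiplies the `k`-th coordinate by `f k`, where the coordinates are
those given by an isometry `U` with a Hilbert sum. -/
def diagonal (U : H ≃ₗᵢ[ℂ] lp G 2) (f : ℕ → ℂ) (hf : ∃ C, ∀ k, ‖f k‖ ≤ C) : H →L[ℂ] H :=
  LinearMap.mkContinuousOfExistsBound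
    { toFun := fun x => U.symm ⟨fun k => f k • U x k, memℓp_smul (summable_smul_coord U hf x)⟩
      map_add' := fun x y => by
        rw [← map_add]; congr 1; ext k; simp; rfl
      map_smul' := fun c x => by
        rw [RingHom.id_apply, ← map_smul]; congr 1; ext k; simp [smul_smul, mul_comm] }
    (by
      obtain ⟨C, hC⟩ := id hf
      refine ⟨|C|, fun x => ?_⟩
      refine abs_le_of_sq_le_sq' ?_ (by positivity) |>.2
      have h1 := hasSum_norm_sq_coord U
        (U.symm ⟨fun k => f k • U x k, memℓp_smul (summable_smul_coord U hf x)⟩)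
      refine hasSum_le (fun k => ?_) h1
        (by rw [mul_pow]; exact (hasSum_norm_sq_coord U x).mul_left (|C| ^ 2))
      have := (hC k).trans (le_abs_self C)
      simp only [LinearIsometryEquiv.apply_symm_apply, norm_smul, mul_pow]
      gcongr)

@[simp]
theorem coord_diagonal (U : H ≃ₗᵢ[ℂ] lp G 2) (f : ℕ → ℂ) (hf : ∃ C, ∀ k, ‖f k‖ ≤ C) (x : H)
    (k : ℕ) : U (diagonal U f hf x) k = f k • U x k := by
  simp [diagonal]

theorem ext_coord (U : H ≃ₗᵢ[ℂ] lp G 2) {x y : H} (h : ∀ k, U x k = U y k) : x = y :=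
  U.injective (lp.ext (funext h))

theorem hasSum_inner_coord (U : H ≃ₗᵢ[ℂ] lp G 2) (x y : H) :
    HasSum (fun k => inner ℂ (U x k) (U y k)) (inner ℂ x y) := by
  rw [← U.inner_map_map]
  exact lp.hasSum_inner _ _

/-- Dominated convergence for diagonal operators. -/
theorem tendsto_of_coord_smul (U : H ≃ₗᵢ[ℂ] lp G 2) {ι : Type*} {l : Filter ι}
    {F : ι → ℕ → ℂ} {f : ℕ → ℂ} {C : ℝ} (hF : ∀ i k, ‖F i k‖ ≤ C)
    (hlim : ∀ k, Tendsto (fun i => F i k) l (𝓝 (f k))) {x : H} {X : ι → H} {y : H}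
    (hX : ∀ i k, U (X i) k = F i k • U x k) (hy : ∀ k, U y k = f k • U x k) :
    Tendsto X l (𝓝 y) := by
  rcases l.eq_or_neBot with rfl | hl
  · exact tendsto_bot
  have hf : ∀ k, ‖f k‖ ≤ C := fun k =>
    le_of_tendsto (hlim k).norm (Eventually.of_forall fun i => hF i k)
  rw [tendsto_iff_norm_sub_tendsto_zero]
  have key : Tendsto (fun i => ‖X i - y‖ ^ 2) l (𝓝 0) := by
    have h1 : ∀ i, ‖X i - y‖ ^ 2 = ∑' k, ‖F i k - f k‖ ^ 2 * ‖U x k‖ ^ 2 := fun i => by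
      rw [← (hasSum_norm_sq_coord U (X i - y)).tsum_eq]
      refine tsum_congr fun k => ?_
      rw [map_sub, lp.coeFn_sub, Pi.sub_apply, hX, hy, ← sub_smul, norm_smul, mul_pow]
    simp_rw [h1]
    have h0 : (0 : ℝ) = ∑' k : ℕ, (fun _ => (0 : ℝ)) k := by simp
    rw [h0]
    refine tendsto_tsum_of_dominated_convergence
      (bound := fun k => (C + C) ^ 2 * ‖U x k‖ ^ 2)
      ((hasSum_norm_sq_coord U x).summable.mul_left _) (fun k => ?_)
      (Eventually.of_forall fun i k => ?_)
    · have h2 := (hlim k).sub_const (f k)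
      rw [sub_self] at h2
      have h3 := (h2.norm.pow 2).mul_const (‖U x k‖ ^ 2)
      simpa using h3
    · rw [Real.norm_of_nonneg (by positivity)]
      have := (norm_sub_le (F i k) (f k)).trans (add_le_add (hF i k) (hf k))
      gcongr
  have := key.sqrt
  simpa using this

theorem norm_indicator_one_le (S : Set ℝ) (t : ℝ) : ‖S.indicator (1 : ℝ → ℂ) t‖ ≤ 1 := by
  by_cases h : t ∈ S <;> simp [h]

variable [CompleteSpace H]

/-- The resolution of the identity of a Hilbert sum indexed by `ℕ`: the `k`-th summand is the
spectral subspace of `{k}`. -/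
def hilbertSumResolution (U : H ≃ₗᵢ[ℂ] lp G 2) : ResolutionOfIdentity H where
  proj S := diagonal U (fun k => S.indicator 1 (k : ℝ)) ⟨1, fun _ => norm_indicator_one_le S _⟩
  isStarProjection S _ := by
    refine ⟨?_, ?_⟩
    · ext x
      refine ext_coord U fun k => ?_
      by_cases h : (k : ℝ) ∈ S <;> simp [h]
    · rw [ContinuousLinearMap.isSelfAdjoint_iff_isSymmetric]
      intro x y
      refine (hasSum_inner_coord U _ _).unique ?_
      refine (hasSum_inner_coord U _ _).congr_fun fun k => ?_
      simp only [ContinuousLinearMap.coe_coe, coord_diagonal]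
      by_cases h : (k : ℝ) ∈ S <;> simp [h]
  proj_univ := by
    ext x
    exact ext_coord U fun k => by simp
  hasSum_iUnion S _ hd x := by
    refine tendsto_of_coord_smul U (C := 1) (x := x)
      (F := fun (s : Finset ℕ) k => (⋃ i ∈ s, S i).indicator 1 (k : ℝ))
      (f := fun k => (⋃ i, S i).indicator 1 (k : ℝ))
      (fun _ _ => norm_indicator_one_le _ _) (fun k => ?_) (fun s k => ?_) (fun k => by simp)
    · by_cases h : (k : ℝ) ∈ ⋃ i, S i
      · obtain ⟨i, hi⟩ := Set.mem_iUnion.1 h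
        refine tendsto_const_nhds.congr' ?_
        filter_upwards [eventually_ge_atTop ({i} : Finset ℕ)] with s hs
        have h2 : (k : ℝ) ∈ ⋃ i ∈ s, S i := by
          simp only [Set.mem_iUnion]
          exact ⟨i, hs (Finset.mem_singleton_self i), hi⟩
        rw [Set.indicator_of_mem h, Set.indicator_of_mem h2]
      · refine tendsto_const_nhds.congr fun s => ?_
        have h2 : (k : ℝ) ∉ ⋃ i ∈ s, S i := by
          simp only [Set.mem_iUnion, not_exists] at h ⊢
          exact fun i _ => h i
        rw [Set.indicator_of_notMem h, Set.indicator_of_notMem h2]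
    · rw [map_sum, lp.coeFn_sum, Finset.sum_apply]
      simp only [coord_diagonal, ← Finset.sum_smul]
      congr 1
      by_cases h : (k : ℝ) ∈ ⋃ i ∈ s, S i
      · rw [Set.indicator_of_mem h]
        simp only [Set.mem_iUnion] at h
        obtain ⟨i, hi, hk⟩ := h
        rw [Finset.sum_eq_single i, Set.indicator_of_mem hk]
        · intro j _ hj
          exact Set.indicator_of_notMem (fun hkj => Set.disjoint_left.1 (hd hj) hkj hk) _
        · exact fun h => absurd hi h
      · rw [Set.indicator_of_notMem h]
        simp only [Set.mem_iUnion, not_exists] at h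
        exact Finset.sum_eq_zero fun i hi => Set.indicator_of_notMem (h i hi) _

theorem scalarMeasure_hilbertSumResolution (U : H ≃ₗᵢ[ℂ] lp G 2) (x : H) :
    (hilbertSumResolution U).scalarMeasure x =
      Measure.sum fun k : ℕ => ENNReal.ofReal (‖U x k‖ ^ 2) • Measure.dirac (k : ℝ) := by
  ext S hS
  rw [ResolutionOfIdentity.scalarMeasure, Measure.ofMeasurable_apply _ hS,
    Measure.sum_apply _ hS]
  have h := hasSum_norm_sq_coord U ((hilbertSumResolution U).proj S x)
  rw [← h.tsum_eq, ENNReal.ofReal_tsum_of_nonneg (fun k => by positivity) h.summable]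
  refine tsum_congr fun k => ?_
  simp only [hilbertSumResolution, coord_diagonal, Measure.smul_apply, smul_eq_mul,
    Measure.dirac_apply' _ hS]
  by_cases h : (k : ℝ) ∈ S <;> simp [h]

theorem lintegral_scalarMeasure (U : H ≃ₗᵢ[ℂ] lp G 2) (x : H) (g : ℝ → ENNReal) :
    ∫⁻ t, g t ∂(hilbertSumResolution U).scalarMeasure x =
      ∑' k : ℕ, ENNReal.ofReal (‖U x k‖ ^ 2) * g k := by
  simp [scalarMeasure_hilbertSumResolution, lintegral_sum_measure]

theorem aestronglyMeasurable_scalarMeasure (U : H ≃ₗᵢ[ℂ] lp G 2) (x : H) (g : ℝ → ℂ) :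
    AEStronglyMeasurable g ((hilbertSumResolution U).scalarMeasure x) := by
  rw [scalarMeasure_hilbertSumResolution, aestronglyMeasurable_sum_measure_iff]
  intro k
  exact aestronglyMeasurable_dirac.smul_measure _

theorem memLp_two_scalarMeasure_iff (U : H ≃ₗᵢ[ℂ] lp G 2) (x : H) (g : ℝ → ℂ) :
    MemLp g 2 ((hilbertSumResolution U).scalarMeasure x) ↔
      Summable fun k : ℕ => ‖g k‖ ^ 2 * ‖U x k‖ ^ 2 := by
  rw [MemLp, and_iff_right (aestronglyMeasurable_scalarMeasure U x g),
    eLpNorm_lt_top_iff_lintegral_rpow_enorm_lt_top (by simp) (by simp), lintegral_scalarMeasure]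
  have : ∀ k : ℕ, ENNReal.ofReal (‖U x k‖ ^ 2) * ‖g k‖ₑ ^ (2 : ENNReal).toReal =
      ENNReal.ofReal (‖g k‖ ^ 2 * ‖U x k‖ ^ 2) := fun k => by
    rw [ENNReal.ofReal_mul (by positivity), mul_comm, ← ofReal_norm,
      ENNReal.ofReal_rpow_of_nonneg (norm_nonneg _) (by simp)]
    simp
  simp_rw [this]
  constructor
  · intro h
    have h2 := ENNReal.summable_toReal h.ne
    refine h2.congr fun k => ?_
    rw [ENNReal.toReal_ofReal (by positivity)]
  · intro h
    rw [← ENNReal.ofReal_tsum_of_nonneg (fun k => by positivity) h]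
    exact ENNReal.ofReal_lt_top

theorem hasSum_integral_scalarMeasure (U : H ≃ₗᵢ[ℂ] lp G 2) (x : H) {g : ℝ → ℂ}
    (hg : MemLp g 2 ((hilbertSumResolution U).scalarMeasure x)) :
    HasSum (fun k : ℕ => ((‖U x k‖ ^ 2 : ℝ) : ℂ) * g k)
      (∫ t, g t ∂(hilbertSumResolution U).scalarMeasure x) := by
  have hfin : IsFiniteMeasure ((hilbertSumResolution U).scalarMeasure x) := by
    refine ⟨?_⟩
    rw [← lintegral_one, lintegral_scalarMeasure]
    simp only [mul_one]
    rw [← ENNReal.ofReal_tsum_of_nonneg (fun k => by positivity)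
      (hasSum_norm_sq_coord U x).summable]
    exact ENNReal.ofReal_lt_top
  have hi : Integrable g ((hilbertSumResolution U).scalarMeasure x) :=
    hg.integrable (by norm_num)
  rw [scalarMeasure_hilbertSumResolution] at hi ⊢
  refine (hasSum_integral_measure hi).congr_fun fun k => ?_
  rw [integral_smul_measure, integral_dirac, ENNReal.toReal_ofReal (by positivity)]
  simp

/-- An operator that multiplies the `k`-th coordinate by `g k`, on its maximal domain, is the
integral of `g` against the resolution of the identity of the Hilbert sum. -/
theorem isIntegral_of_coord (U : H ≃ₗᵢ[ℂ] lp G 2) (g : ℝ → ℂ) (T : H →ₗ.[ℂ] H)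
    (hdom : ∀ x, x ∈ T.domain ↔ Summable fun k : ℕ => ‖g k‖ ^ 2 * ‖U x k‖ ^ 2)
    (hT : ∀ (x : T.domain) (k : ℕ), U (T x) k = g k • U (x : H) k) :
    (hilbertSumResolution U).IsIntegral g T := by
  refine ⟨fun x => (hdom x).trans (memLp_two_scalarMeasure_iff U x g).symm, fun x => ?_⟩
  have hx := (memLp_two_scalarMeasure_iff U (x : H) g).2 ((hdom x).1 x.2)
  refine (hasSum_inner_coord U _ _).unique ?_
  convert hasSum_integral_scalarMeasure U (x : H) hx using 2 with k
  rw [hT, inner_smul_right, inner_self_eq_norm_sq_to_K, mul_comm]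
  norm_cast

/-- The functional calculus of an unbounded diagonal operator, given through its graph. -/
theorem isFunctionOf_diagonal (U : H ≃ₗᵢ[ℂ] lp G 2) (A : H →ₗ.[ℂ] H)
    (hA : ∀ x y, (x, y) ∈ A.graph ↔ ∀ k : ℕ, U y k = (k : ℂ) • U x k)
    (g : ℝ → ℂ) {f : ℕ → ℂ} (hf : ∃ C, ∀ k, ‖f k‖ ≤ C) (hfg : ∀ k : ℕ, f k = g k) :
    IsFunctionOf A g ((diagonal U f hf : H →ₗ[ℂ] H).toPMap ⊤) := by
  refine ⟨hilbertSumResolution U, isIntegral_of_coord U _ A (fun x => ?_) (fun x k => ?_),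
    isIntegral_of_coord U g _ (fun x => ?_) fun x k => ?_⟩
  · rw [LinearPMap.mem_domain_iff]
    constructor
    · rintro ⟨y, hy⟩
      refine (hasSum_norm_sq_coord U y).summable.congr fun k => ?_
      rw [(hA x y).1 hy k, norm_smul, mul_pow]
      simp
    · intro h
      refine ⟨U.symm ⟨fun k : ℕ => (k : ℂ) • U x k, memℓp_smul (by simpa using h)⟩, ?_⟩
      rw [hA]
      intro k
      simp
  · rw [(hA _ _).1 (A.mem_graph x) k]
    simp
  · simp only [LinearMap.toPMap_domain, Submodule.mem_top, true_iff, ← hfg]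
    exact summable_smul_coord U hf x
  · rw [← hfg]
    exact coord_diagonal U f hf x k

end SpectralCalculus

/-! ### Linearization of the square of a Laguerre polynomial -/

namespace Magnetic

open PowerSeries Finset

/-- The negative binomial series truncated at order `N`, evaluated at an element of a ring. -/
theorem exists_one_sub_pow_mul_sum_choose {S : Type*} [CommRing S] (t : S) {d : ℕ} (hd : 0 < d)
    (N : ℕ) : ∃ Q : S, (1 - t) ^ d * ∑ q ∈ range N, ((d - 1 + q).choose (d - 1) : S) * t ^ q =
      1 + t ^ N * Q := by
  have h : (Polynomial.X : Polynomial ℤ) ^ N ∣ (1 - Polynomial.X) ^ d *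
      ∑ q ∈ range N, ((d - 1 + q).choose (d - 1) : Polynomial ℤ) * Polynomial.X ^ q - 1 := by
    rw [Polynomial.X_pow_dvd_iff]
    intro e he
    have h1 := (invOneSubPow ℤ d).inv_val
    rw [invOneSubPow_inv_eq_one_sub_pow, invOneSubPow_val_eq_mk_sub_one_add_choose_of_pos ℤ d hd]
      at h1
    have h2 := congrArg (coeff e) h1
    rw [← Polynomial.coeff_coe, Polynomial.coe_sub, map_sub, Polynomial.coe_one, ← h2, sub_eq_zero,
      Polynomial.coe_mul, Polynomial.coe_pow, Polynomial.coe_sub, Polynomial.coe_one,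
      Polynomial.coe_X, coeff_mul, coeff_mul]
    refine sum_congr rfl fun p hp => ?_
    congr 1
    rw [Polynomial.coeff_coe, coeff_mk, Polynomial.finsetSum_coeff]
    simp only [← Polynomial.C_eq_natCast, Polynomial.coeff_C_mul_X_pow]
    rw [HasAntidiagonal.mem_antidiagonal] at hp
    rw [sum_ite_eq, if_pos (mem_range.2 (by omega))]
  obtain ⟨Q, hQ⟩ := h
  refine ⟨Polynomial.aeval t Q, ?_⟩
  have := congrArg (Polynomial.aeval t) (sub_eq_iff_eq_add'.1 hQ)
  simpa using this

/-- The coefficient of `y ^ m * z ^ m` of a power series in `y` and `z`, where `y` is the variable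
of the coefficient ring and `z` the outer variable. -/
def diagCoeff (m : ℕ) : PowerSeries (PowerSeries ℂ) →ₗ[ℂ] ℂ :=
  (coeff (R := ℂ) m) ∘ₗ ((coeff (R := PowerSeries ℂ) m).restrictScalars ℂ)

theorem diagCoeff_apply (m : ℕ) (f : PowerSeries (PowerSeries ℂ)) :
    diagCoeff m f = coeff m (coeff m f) := rfl

theorem diagCoeff_C_mul_map (m : ℕ) (f g : PowerSeries ℂ) :
    diagCoeff m (C f * PowerSeries.map C g) = coeff m f * coeff m g := by
  rw [diagCoeff_apply, coeff_C_mul, coeff_map, coeff_mul_C]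

theorem diagCoeff_C_X_pow_mul {m i : ℕ} (h : m < i) (f : PowerSeries (PowerSeries ℂ)) :
    diagCoeff m (C X ^ i * f) = 0 := by
  rw [diagCoeff_apply, ← map_pow, coeff_C_mul, coeff_X_pow_mul', if_neg (by omega)]

theorem diagCoeff_X_pow_mul {m i : ℕ} (h : m < i) (f : PowerSeries (PowerSeries ℂ)) :
    diagCoeff m (X ^ i * f) = 0 := by
  rw [diagCoeff_apply, coeff_X_pow_mul', if_neg (by omega), map_zero]

/-- A power of order more than `2 m` of an element of the ideal generated by the two variables does
not contribute to the coefficient of `y ^ m * z ^ m`. -/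
theorem diagCoeff_pow_mul {m N : ℕ} (h : 2 * m < N) (s t f : PowerSeries (PowerSeries ℂ)) :
    diagCoeff m ((C X * s + X * t) ^ N * f) = 0 := by
  rw [add_pow, sum_mul, map_sum]
  refine sum_eq_zero fun i hi => ?_
  rw [mem_range] at hi
  generalize ((N.choose i : ℕ) : PowerSeries (PowerSeries ℂ)) = c
  by_cases h1 : m < i
  · rw [show (C X * s) ^ i * (X * t) ^ (N - i) * c * f
      = C X ^ i * (s ^ i * (X * t) ^ (N - i) * c * f) by ring]
    exact diagCoeff_C_X_pow_mul h1 _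
  · rw [show (C X * s) ^ i * (X * t) ^ (N - i) * c * f
      = X ^ (N - i) * (t ^ (N - i) * (C X * s) ^ i * c * f) by ring]
    exact diagCoeff_X_pow_mul (by omega) _

theorem natCast_mul_eq_smul (c : ℕ) (f : PowerSeries (PowerSeries ℂ)) :
    (c : PowerSeries (PowerSeries ℂ)) * f = (c : ℂ) • f := by
  rw [← nsmul_eq_mul, Nat.cast_smul_eq_nsmul]

theorem diagCoeff_monomial (m a b : ℕ) :
    diagCoeff m (C X ^ a * X ^ b) = if a = m ∧ b = m then 1 else 0 := by
  have h : (C X : PowerSeries (PowerSeries ℂ)) ^ a * X ^ b =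
      C (X ^ a) * PowerSeries.map C (X ^ b) := by simp
  rw [h, diagCoeff_C_mul_map, coeff_X_pow, coeff_X_pow]
  simp only [eq_comm (a := m), ite_and, mul_ite, mul_one, mul_zero]
  split_ifs <;> rfl

/-- The coefficient of the central monomial in `(y z) ^ k (y + z - 2 y z) ^ j`. -/
theorem diagCoeff_pow_mul_pow (m j k : ℕ) :
    diagCoeff m ((C X * X) ^ k * (C X + X + (-2 : ℂ) • (C X * X)) ^ j) =
      if m ≤ j + k ∧ 2 * k + j ≤ 2 * m then
        (-2 : ℂ) ^ (2 * m - 2 * k - j) * (j.factorial : ℂ) /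
          ((2 * m - 2 * k - j).factorial * ((j + k - m).factorial : ℂ) ^ 2) else 0 := by
  have h0 : diagCoeff m ((C X * X) ^ k * (C X + X + (-2 : ℂ) • (C X * X)) ^ j) =
      ∑ c ∈ range (j + 1), ∑ i ∈ range (c + 1), (j.choose c : ℂ) * (c.choose i * (-2 : ℂ) ^ (j - c)) *
        if k + (i + (j - c)) = m ∧ k + ((c - i) + (j - c)) = m then 1 else 0 := by
    rw [add_pow, mul_sum, map_sum]
    refine sum_congr rfl fun c _ => ?_
    rw [add_pow, sum_mul, sum_mul, mul_sum, map_sum]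
    refine sum_congr rfl fun i _ => ?_
    trans diagCoeff m (((j.choose c : ℂ) * (c.choose i * (-2 : ℂ) ^ (j - c))) •
      (C X ^ (k + (i + (j - c))) * X ^ (k + ((c - i) + (j - c)))))
    · rw [mul_smul, mul_smul, ← natCast_mul_eq_smul, ← natCast_mul_eq_smul, smul_pow,
        mul_smul_comm, smul_mul_assoc, mul_smul_comm, mul_smul_comm, mul_smul_comm]
      congr 2
      ring
    · rw [map_smul, smul_eq_mul, diagCoeff_monomial]
  rw [h0]
  split_ifs with h
  · obtain ⟨a, ha⟩ : ∃ a, j + k = m + a := ⟨j + k - m, by omega⟩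
    have ha2 : 2 * a ≤ j := by omega
    rw [sum_eq_single (2 * a), sum_eq_single a, if_pos (by omega)]
    · rw [show j + k - m = a by omega, show 2 * m - 2 * k - j = j - 2 * a by omega,
        Nat.cast_choose ℂ ha2, Nat.cast_choose ℂ (show a ≤ 2 * a by omega),
        show 2 * a - a = a by omega]
      have h1 := Nat.factorial_ne_zero a
      have h2 := Nat.factorial_ne_zero (2 * a)
      have h3 := Nat.factorial_ne_zero (j - 2 * a)
      field_simp
    · intro i hi hia
      rw [mem_range] at hi
      rw [if_neg (by omega), mul_zero]
    · intro h; exact absurd (mem_range.2 (by omega)) h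
    · intro c hc hca
      rw [mem_range] at hc
      refine sum_eq_zero fun i hi => ?_
      rw [mem_range] at hi
      rw [if_neg (by omega), mul_zero]
    · intro h; exact absurd (mem_range.2 (by omega)) h
  · refine sum_eq_zero fun c hc => sum_eq_zero fun i hi => ?_
    rw [mem_range] at hi hc
    rw [if_neg (by omega), mul_zero]

/-- The coefficients of the Laguerre polynomial of degree `m` and parameter `n - 1`. -/
def laguerreCoeff (n m i : ℕ) : ℂ := (-1) ^ i * ((m + (n - 1)).choose (m - i) : ℂ) / i.factorial

theorem coeff_X_pow_mul_mk_one_pow {n m i : ℕ} (hn : 1 ≤ n) :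
    coeff m ((X : PowerSeries ℂ) ^ i * (PowerSeries.mk 1) ^ (n + i)) =
      if i ≤ m then ((m + (n - 1)).choose (m - i) : ℂ) else 0 := by
  rw [coeff_X_pow_mul']
  split_ifs with h
  · rw [show n + i = n + i - 1 + 1 by omega, mk_one_pow_eq_mk_choose_add, coeff_mk,
      Nat.choose_symm_add, show n + i - 1 + (m - i) = m + (n - 1) by omega]
  · rfl

theorem ascFactorial_eq_factorial_mul_choose_sub_one {d : ℕ} (hd : 0 < d) (q : ℕ) :
    ((d.ascFactorial q : ℕ) : ℂ) = q.factorial * (d - 1 + q).choose (d - 1) := by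
  rw [Nat.ascFactorial_eq_factorial_mul_choose', Nat.choose_symm_of_eq_add (a := q) (b := d - 1)
    (by omega), show d + q - 1 = d - 1 + q by omega]
  push_cast
  rfl

/-- The linearization coefficient of `L_m ^ 2` as a coefficient of a rational function in two
variables. It comes from the generating function `∑ L_m y ^ m = (1 - y)⁻ⁿ e ^ (-t y / (1 - y))`:
with `T = y / (1 - y) + z / (1 - z)`, the product of two such functions produces
`(1 - y)⁻ⁿ (1 - z)⁻ⁿ T ^ j (1 + T) ^ (-n - j)`, which equals
`(y + z - 2 y z) ^ j (1 - y z) ^ (-n - j)`. The negative powers are truncated binomial series, so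
that only ring identities are needed. -/
theorem sum_laguerreCoeff_mul (n m j : ℕ) (hn : 1 ≤ n) (hj : j ≤ 2 * m) :
    ∑ i ∈ range (m + 1), ∑ l ∈ range (m + 1), laguerreCoeff n m i * laguerreCoeff n m l *
      ((i + l).choose j * (n + j).ascFactorial (i + l - j)) =
    (-1) ^ j / (j.factorial : ℂ) * ∑ k ∈ range (m + 1), ((n + j).ascFactorial k : ℂ) / k.factorial *
      diagCoeff m ((C X * X) ^ k * (C X + X + (-2 : ℂ) • (C X * X)) ^ j) := by
  have hW : (C X + X + (-2 : ℂ) • (C X * X) : PowerSeries (PowerSeries ℂ)) =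
      C X + X - 2 * (C X * X) := by
    rw [neg_smul, ofNat_smul_eq_nsmul, nsmul_eq_mul, ← sub_eq_add_neg]; rfl
  rw [hW]
  set Y : PowerSeries (PowerSeries ℂ) := C X with hY
  set Z : PowerSeries (PowerSeries ℂ) := X with hZ
  obtain ⟨a, ha⟩ : ∃ a : PowerSeries (PowerSeries ℂ), a = C (PowerSeries.mk 1) := ⟨_, rfl⟩
  obtain ⟨b, hb⟩ : ∃ b : PowerSeries (PowerSeries ℂ),
    b = PowerSeries.map C (PowerSeries.mk 1) := ⟨_, rfl⟩
  have ha1 : a * (1 - Y) = 1 := by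
    rw [ha, hY, ← map_one C, ← map_sub, ← map_mul, mk_one_mul_one_sub_eq_one]
  have hb1 : b * (1 - Z) = 1 := by
    rw [hb, hZ, ← PowerSeries.map_X (C (R := ℂ)), ← map_one (PowerSeries.map C), ← map_sub,
      ← map_mul, mk_one_mul_one_sub_eq_one]
  set T := Y * a + Z * b with hT
  have hT1 : 1 + T = (1 - Y * Z) * (a * b) := by
    linear_combination (-b) * ha1 - (1 + Y * a) * hb1
  set W := Y + Z - 2 * (Y * Z) with hWdef
  have hTW : T = W * (a * b) := by
    linear_combination (-(Z * b)) * ha1 - Y * a * hb1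
  have hWT : W = T * ((1 - Y) * (1 - Z)) := by
    linear_combination (-((1 - Y) * (1 - Z))) * hTW - W * ha1 - W * hb1 * (a * (1 - Y))
  have hd : 0 < n + j := by omega
  set s := ∑ q ∈ range (2 * m + 1 - j), ((n + j - 1 + q).choose (n + j - 1) :
    PowerSeries (PowerSeries ℂ)) * (-T) ^ q with hs
  set s' := ∑ k ∈ range (m + 1), ((n + j - 1 + k).choose (n + j - 1) :
    PowerSeries (PowerSeries ℂ)) * (Y * Z) ^ k with hs'
  have hcoef : ∀ i, coeff m ((X : PowerSeries ℂ) ^ i * (PowerSeries.mk 1) ^ (n + i)) =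
      if i ≤ m then ((m + (n - 1)).choose (m - i) : ℂ) else 0 := fun i =>
    coeff_X_pow_mul_mk_one_pow hn
  have hfac : ∀ i l, diagCoeff m (a ^ n * b ^ n * ((Y * a) ^ i * (Z * b) ^ l)) =
      (if i ≤ m then ((m + (n - 1)).choose (m - i) : ℂ) else 0) *
      (if l ≤ m then ((m + (n - 1)).choose (m - l) : ℂ) else 0) := by
    intro i l
    rw [← hcoef, ← hcoef, ← diagCoeff_C_mul_map]
    congr 1
    simp only [map_mul, map_pow, PowerSeries.map_X, ← ha, ← hb, ← hY, ← hZ]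
    ring
  -- collecting the terms with `i + l = p` turns the double sum into a power of `Y a + Z b`
  have step1 : ∑ i ∈ range (m + 1), ∑ l ∈ range (m + 1),
      laguerreCoeff n m i * laguerreCoeff n m l *
        ((i + l).choose j * (n + j).ascFactorial (i + l - j)) =
      ∑ p ∈ range (2 * m + 1), (-1 : ℂ) ^ p / p.factorial *
        (p.choose j * (n + j).ascFactorial (p - j)) * diagCoeff m (a ^ n * b ^ n * T ^ p) := by
    have h1 : ∀ p, diagCoeff m (a ^ n * b ^ n * T ^ p) = ∑ x ∈ antidiagonal p,
        (p.choose x.1 : ℂ) * diagCoeff m (a ^ n * b ^ n * ((Y * a) ^ x.1 * (Z * b) ^ x.2)) := by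
      intro p
      rw [hT, (Commute.all _ _).add_pow', mul_sum, map_sum]
      refine sum_congr rfl fun x _ => ?_
      rw [nsmul_eq_mul, mul_left_comm, natCast_mul_eq_smul, map_smul, smul_eq_mul]
    rw [← sum_product', ← sum_fiberwise_of_maps_to (t := range (2 * m + 1))
      (g := fun x : ℕ × ℕ => x.1 + x.2)
      (by intro x hx; simp only [mem_product, mem_range] at hx ⊢; omega)]
    refine sum_congr rfl fun p _ => ?_
    rw [h1, mul_sum]
    refine sum_subset_zero_on_sdiff (fun x hx => ?_) (fun x hx => ?_) (fun x hx => ?_)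
    · simpa using (mem_filter.1 hx).2
    · rw [hfac]
      simp only [mem_sdiff, HasAntidiagonal.mem_antidiagonal, mem_filter, mem_product,
        mem_range, not_and] at hx
      by_cases h2 : x.1 ≤ m
      · by_cases h3 : x.2 ≤ m
        · exact absurd hx.1 (hx.2 ⟨by omega, by omega⟩)
        · rw [if_neg h3]; simp
      · rw [if_neg h2]; simp
    · simp only [mem_filter, mem_product, mem_range] at hx
      obtain ⟨⟨h2, h3⟩, rfl⟩ := hx
      rw [hfac, if_pos (by omega), if_pos (by omega), laguerreCoeff, laguerreCoeff,
        Nat.cast_add_choose, pow_add]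
      have := Nat.factorial_ne_zero x.1
      have := Nat.factorial_ne_zero x.2
      have := Nat.factorial_ne_zero (x.1 + x.2)
      field_simp
  -- the powers of `T` sum up to a truncated binomial series
  have step2 : ∑ p ∈ range (2 * m + 1), (-1 : ℂ) ^ p / p.factorial *
        (p.choose j * (n + j).ascFactorial (p - j)) * diagCoeff m (a ^ n * b ^ n * T ^ p) =
      (-1) ^ j / (j.factorial : ℂ) * diagCoeff m (a ^ n * b ^ n * (T ^ j * s)) := by
    rw [show range (2 * m + 1) = range (j + (2 * m + 1 - j)) by congr 1; omega,
      sum_range_add, sum_eq_zero, zero_add, hs, mul_sum, mul_sum, map_sum, mul_sum]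
    · refine sum_congr rfl fun q _ => ?_
      rw [mul_left_comm (T ^ j), mul_left_comm (a ^ n * b ^ n), natCast_mul_eq_smul, map_smul,
        neg_pow T, mul_left_comm (T ^ j), mul_left_comm (a ^ n * b ^ n), ← pow_add]
      have h3 : ((-1 : PowerSeries (PowerSeries ℂ)) ^ q) * (a ^ n * b ^ n * T ^ (j + q)) =
          (-1 : ℂ) ^ q • (a ^ n * b ^ n * T ^ (j + q)) := by
        rcases neg_one_pow_eq_or (PowerSeries (PowerSeries ℂ)) q with h | h <;>
        rcases Nat.even_or_odd q with h2 | h2 <;> simp [h2]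
      rw [h3, map_smul, smul_eq_mul, smul_eq_mul, Nat.add_sub_cancel_left,
        ascFactorial_eq_factorial_mul_choose_sub_one hd, Nat.cast_add_choose, pow_add]
      have := Nat.factorial_ne_zero j
      have := Nat.factorial_ne_zero q
      have := Nat.factorial_ne_zero (j + q)
      field_simp
    · intro p hp
      rw [Nat.choose_eq_zero_of_lt (mem_range.1 hp)]
      simp
  -- `1 + T = (1 - Y Z) a b` exchanges the binomial series in `T` for one in `Y Z`
  have step3 : diagCoeff m (a ^ n * b ^ n * (T ^ j * s)) = diagCoeff m (W ^ j * s') := by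
    obtain ⟨Q, hQ⟩ := exists_one_sub_pow_mul_sum_choose (-T) hd (2 * m + 1 - j)
    obtain ⟨Q', hQ'⟩ := exists_one_sub_pow_mul_sum_choose (Y * Z) hd (m + 1)
    rw [← hs, sub_neg_eq_add, hT1, mul_pow] at hQ
    rw [← hs'] at hQ'
    have h1 : a ^ n * b ^ n * (T ^ j * s) = W ^ j * s' +
        (Y * a + Z * b) ^ (2 * m + 1) *
          (((1 - Y) * (1 - Z)) ^ j * s' * (-1) ^ (2 * m + 1 - j) * Q) -
        Y ^ (m + 1) * (Z ^ (m + 1) * (W ^ j * Q' * (a * b) ^ (n + j) * s)) := by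
      have h2 : a ^ n * b ^ n * (T ^ j * s) = W ^ j * (a * b) ^ (n + j) * s := by
        rw [hTW, mul_pow, pow_add, mul_pow, mul_pow]; ring
      have h3 : T ^ (2 * m + 1) = T ^ j * T ^ (2 * m + 1 - j) := by
        rw [← pow_add]; congr 1; omega
      have h4 : W ^ j = T ^ j * ((1 - Y) * (1 - Z)) ^ j := by
        rw [← mul_pow, ← hWT]
      rw [h2, ← hT, h3]
      rw [neg_pow T] at hQ
      linear_combination (-(W ^ j * (a * b) ^ (n + j) * s)) * hQ' + W ^ j * s' * hQ +
        s' * ((-1) ^ (2 * m + 1 - j) * T ^ (2 * m + 1 - j) * Q) * h4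
    rw [h1, map_sub, map_add, diagCoeff_pow_mul (by omega), diagCoeff_C_X_pow_mul (by omega)]
    simp
  rw [step1, step2, step3, hs', mul_sum, map_sum]
  congr 1
  refine sum_congr rfl fun k _ => ?_
  rw [mul_left_comm, natCast_mul_eq_smul, map_smul, smul_eq_mul, mul_comm (W ^ j),
    ascFactorial_eq_factorial_mul_choose_sub_one hd]
  have := Nat.factorial_ne_zero k
  field_simp

/-- The duplication formula `(-N/2)_k ((1-N)/2)_k 4 ^ k = N (N - 1) ⋯ (N - 2k + 1)`. -/
theorem ascPochhammer_half_mul (N k : ℕ) :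
    (ascPochhammer ℂ k).eval (-(N : ℂ) / 2) * (ascPochhammer ℂ k).eval ((-(N : ℂ) + 1) / 2) * 4 ^ k
      = (N.descFactorial (2 * k) : ℂ) := by
  induction k with
  | zero => simp
  | succ k ih =>
    rw [ascPochhammer_succ_eval, ascPochhammer_succ_eval, show 2 * (k + 1) = 2 * k + 1 + 1 by ring,
      Nat.descFactorial_succ, Nat.descFactorial_succ, Nat.cast_mul, Nat.cast_mul, ← ih]
    rcases lt_or_ge N (2 * k) with h | h
    · have h0 : (N.descFactorial (2 * k) : ℂ) = 0 := by
        rw [Nat.descFactorial_of_lt h, Nat.cast_zero]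
      linear_combination ((-(N : ℂ) / 2 + k) * ((-(N : ℂ) + 1) / 2 + k) * 4 -
        ((N - (2 * k + 1) : ℕ) : ℂ) * ((N - 2 * k : ℕ) : ℂ)) * (ih.trans h0)
    · rcases h.eq_or_lt with h | h
      · subst h
        simp only [Nat.sub_self]
        push_cast
        ring
      · rw [Nat.cast_sub h, Nat.cast_sub (by omega)]
        push_cast
        ring

/-- The terms of the terminating regularized hypergeometric series. -/
theorem regularizedHGFunCoeff_eq (n m j k : ℕ) (hj : j ≤ 2 * m) :
    (2 : ℂ) ^ (2 * m - j) / (2 * m - j).factorial * Complex.regularizedHGFunCoeff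
      {((j : ℂ) - 2 * m) / 2, ((j : ℂ) - 2 * m + 1) / 2, (j : ℂ) + n}
      {(j : ℂ) - m + 1, (j : ℂ) - m + 1} k =
    (-1) ^ j / (j.factorial : ℂ) * (((n + j).ascFactorial k : ℂ) / k.factorial *
      if m ≤ j + k ∧ 2 * k + j ≤ 2 * m then
        (-2 : ℂ) ^ (2 * m - 2 * k - j) * (j.factorial : ℂ) /
          ((2 * m - 2 * k - j).factorial * ((j + k - m).factorial : ℂ) ^ 2) else 0) := by
  obtain ⟨N, hN⟩ : ∃ N, 2 * m = j + N := ⟨2 * m - j, by omega⟩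
  have hNc : (j : ℂ) - 2 * m = -(N : ℂ) := by
    have := congrArg (Nat.cast (R := ℂ)) hN
    push_cast at this
    linear_combination -this
  have h4 := ascPochhammer_half_mul N k
  have hasc : (ascPochhammer ℂ k).eval ((j : ℂ) + n) = ((n + j).ascFactorial k : ℂ) := by
    rw [← ascPochhammer_nat_eq_ascFactorial, ascPochhammer_eval_cast]
    push_cast
    rw [add_comm]
  unfold Complex.regularizedHGFunCoeff
  simp only [Multiset.insert_eq_cons, Multiset.map_cons, Multiset.map_singleton,
    Multiset.prod_cons, Multiset.prod_singleton, hNc, hasc]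
  rw [show 2 * m - j = N by omega]
  by_cases h1 : m ≤ j + k
  · obtain ⟨a, ha⟩ : ∃ a, j + k = m + a := ⟨j + k - m, by omega⟩
    have hG : Complex.Gamma ((j : ℂ) - m + 1 + k) = (a.factorial : ℂ) := by
      rw [← Complex.Gamma_nat_eq_factorial]
      congr 1
      have := congrArg (Nat.cast (R := ℂ)) ha
      push_cast at this
      linear_combination this
    rw [hG]
    by_cases h2 : 2 * k ≤ N
    · obtain ⟨c, rfl⟩ : ∃ c, N = 2 * k + c := ⟨N - 2 * k, by omega⟩
      rw [if_pos (by omega), show 2 * m - 2 * k - j = c by omega, show j + k - m = a by omega]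
      have h5 := Nat.factorial_mul_descFactorial h2
      rw [show 2 * k + c - 2 * k = c by omega] at h5
      have h6 := congrArg (Nat.cast (R := ℂ)) h5
      push_cast [← h4] at h6 ⊢
      rw [← h6, neg_pow (2 : ℂ) c, pow_add, pow_mul]
      have hpar : (-1 : ℂ) ^ j * (-1) ^ c = 1 := by
        rw [← pow_add]
        exact Even.neg_one_pow ⟨m - k, by omega⟩
      have := Nat.factorial_ne_zero j
      have := Nat.factorial_ne_zero k
      have := Nat.factorial_ne_zero a
      have := Nat.factorial_ne_zero c
      have h7 := Nat.factorial_ne_zero (2 * k + c)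
      rw [← Nat.cast_ne_zero (R := ℂ), ← h6] at h7
      generalize (ascPochhammer ℂ k).eval (-(2 * (k : ℂ) + c) / 2) = A at *
      generalize (ascPochhammer ℂ k).eval ((-(2 * (k : ℂ) + c) + 1) / 2) = B at *
      have hA : A ≠ 0 := by rintro rfl; simp at h7
      have hB : B ≠ 0 := by rintro rfl; simp at h7
      norm_num only
      field_simp
      rw [mul_assoc, hpar, mul_one]
    · rw [if_neg (by omega), mul_zero, mul_zero]
      rw [Nat.descFactorial_of_lt (by omega), Nat.cast_zero] at h4
      have h5 : (ascPochhammer ℂ k).eval (-(N : ℂ) / 2) *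
          (ascPochhammer ℂ k).eval ((-(N : ℂ) + 1) / 2) = 0 := by
        simpa using h4
      rw [← mul_assoc, h5]
      simp
  · rw [if_neg (by omega), mul_zero, mul_zero]
    have hG : Complex.Gamma ((j : ℂ) - m + 1 + k) = 0 := by
      rw [Complex.Gamma_eq_zero_iff]
      refine ⟨m - (j + k + 1), ?_⟩
      rw [Nat.cast_sub (by omega)]
      push_cast
      ring
    simp [hG]

/-- The terminating regularized hypergeometric value is the linearization coefficient of
`L_m ^ 2`. -/
theorem sum_laguerreCoeff_mul_eq_regularizedHGFun (n m j : ℕ) (hn : 1 ≤ n) (hj : j ≤ 2 * m) :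
    ∑ i ∈ range (m + 1), ∑ l ∈ range (m + 1), laguerreCoeff n m i * laguerreCoeff n m l *
      ((i + l).choose j * (n + j).ascFactorial (i + l - j)) =
    (2 : ℂ) ^ (2 * m - j) / (2 * m - j).factorial * Complex.regularizedHGFun
      {((j : ℂ) - 2 * m) / 2, ((j : ℂ) - 2 * m + 1) / 2, (j : ℂ) + n}
      {(j : ℂ) - m + 1, (j : ℂ) - m + 1} 1 := by
  have h1 : Complex.regularizedHGFun
      {((j : ℂ) - 2 * m) / 2, ((j : ℂ) - 2 * m + 1) / 2, (j : ℂ) + n}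
      {(j : ℂ) - m + 1, (j : ℂ) - m + 1} 1 =
      ∑' k, Complex.regularizedHGFunCoeff
      {((j : ℂ) - 2 * m) / 2, ((j : ℂ) - 2 * m + 1) / 2, (j : ℂ) + n}
      {(j : ℂ) - m + 1, (j : ℂ) - m + 1} k := by
    refine (FormalMultilinearSeries.ofScalars_sum_eq _ _).trans (tsum_congr fun k => ?_)
    simp
  rw [h1, ← tsum_mul_left, sum_laguerreCoeff_mul n m j hn hj, mul_sum,
    tsum_eq_sum (s := range (m + 1))]
  · refine sum_congr rfl fun k _ => ?_
    rw [regularizedHGFunCoeff_eq n m j k hj, diagCoeff_pow_mul_pow]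
  · intro k hk
    rw [mem_range] at hk
    rw [regularizedHGFunCoeff_eq n m j k hj, if_neg (by omega), mul_zero, mul_zero]

/-- The eigenvalue at level `k`, divided by `π ^ n`, of the integral operator with kernel
`e ^ (⟨z, w⟩ - |z - w|²) |z - w| ^ (2 p)` in the Gaussian space. -/
def powerEigenvalue (n k p : ℕ) : ℂ :=
  ∑ j ∈ range (p + 1), (-1) ^ j * (p.choose j * (n + j).ascFactorial (p - j)) *
    (n + k).ascFactorial j * (1 / 2) ^ (n + k + j)

theorem Gamma_add_div_Gamma (d j : ℕ) (hd : 0 < d) :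
    Real.Gamma (j + d) / Real.Gamma d = (d.ascFactorial j : ℝ) := by
  obtain ⟨e, rfl⟩ : ∃ e, d = e + 1 := ⟨d - 1, by omega⟩
  have h := Nat.factorial_mul_ascFactorial e j
  rw [show (j : ℝ) + ((e + 1 : ℕ) : ℝ) = ((e + j : ℕ) : ℝ) + 1 by push_cast; ring, Nat.cast_succ e,
    Real.Gamma_nat_eq_factorial, Real.Gamma_nat_eq_factorial, ← h]
  have := Nat.factorial_ne_zero e
  push_cast
  field_simp

/-- On the spectrum `ℕ`, the spectral function is the expansion of the eigenvalue of the deformed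
Berezin transform given by the coefficients of `L_m ^ 2`. -/
theorem spectralFunction_natCast (n m k : ℕ) (hn : 1 ≤ n) :
    spectralFunction n m k = (Real.pi : ℂ) ^ n / ((m + (n - 1)).choose m : ℂ) ^ 2 *
      ∑ i ∈ range (m + 1), ∑ l ∈ range (m + 1),
        laguerreCoeff n m i * laguerreCoeff n m l * powerEigenvalue n k (i + l) := by
  have h1 : ∀ p ∈ range (2 * m + 1), powerEigenvalue n k p = ∑ j ∈ range (2 * m + 1), (-1 : ℂ) ^ j *
      (p.choose j * (n + j).ascFactorial (p - j)) * (n + k).ascFactorial j *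
        (1 / 2) ^ (n + k + j) := by
    intro p hp
    rw [mem_range] at hp
    refine sum_subset (range_subset_range.2 (by omega)) fun j _ hj => ?_
    rw [Nat.choose_eq_zero_of_lt (by simpa using hj)]
    simp
  have h2 : ∑ i ∈ range (m + 1), ∑ l ∈ range (m + 1),
        laguerreCoeff n m i * laguerreCoeff n m l * powerEigenvalue n k (i + l) =
      ∑ j ∈ range (2 * m + 1), (-1) ^ j * (n + k).ascFactorial j * (1 / 2) ^ (n + k + j) *
        ∑ i ∈ range (m + 1), ∑ l ∈ range (m + 1), laguerreCoeff n m i * laguerreCoeff n m l *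
          ((i + l).choose j * (n + j).ascFactorial (i + l - j)) := by
    simp_rw [mul_sum]
    symm
    rw [sum_comm]
    refine sum_congr rfl fun i hi => ?_
    rw [sum_comm]
    refine sum_congr rfl fun l hl => ?_
    rw [mem_range] at hi hl
    rw [h1 _ (mem_range.2 (by omega)), mul_sum]
    exact sum_congr rfl fun j _ => by ring
  rw [h2, spectralFunction, if_pos (Nat.cast_nonneg k)]
  have h3 : (m.factorial : ℂ) / (ascPochhammer ℂ m).eval (n : ℂ) =
      1 / ((m + (n - 1)).choose m : ℂ) := by
    rw [← ascPochhammer_eval_cast, ascPochhammer_nat_eq_ascFactorial,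
      Nat.ascFactorial_eq_factorial_mul_choose', show n + m - 1 = m + (n - 1) by omega]
    have := Nat.factorial_ne_zero m
    have : (m + (n - 1)).choose m ≠ 0 := (Nat.choose_pos (by omega)).ne'
    push_cast
    field_simp
  rw [h3, mul_sum, mul_sum]
  refine sum_congr rfl fun j hj => ?_
  rw [mem_range] at hj
  rw [sum_laguerreCoeff_mul_eq_regularizedHGFun n m j hn (by omega), spectralCoeff]
  have h4 : Real.Gamma (j + n + k) / Real.Gamma (n + k) * Real.exp (-Real.log 2 * k) =
      ((n + k).ascFactorial j : ℝ) * (1 / 2) ^ k := by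
    have h5 := Gamma_add_div_Gamma (n + k) j (by omega)
    push_cast at h5
    rw [add_assoc, h5, mul_comm _ (k : ℝ), Real.exp_nat_mul, Real.exp_neg,
      Real.exp_log two_pos]
    norm_num
  rw [h4]
  obtain ⟨N, hN⟩ : ∃ N, 2 * m = j + N := ⟨2 * m - j, by omega⟩
  have h6 : (2 : ℂ) ^ (2 * (m : ℤ) - n) * (2 : ℂ) ^ (-(2 * (j : ℤ))) * (1 / 2) ^ k =
      (1 / 2) ^ (n + k + j) * 2 ^ (2 * m - j) := by
    have h7 : (2 : ℤ) * m = j + N := by exact_mod_cast hN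
    rw [h7, show 2 * m - j = N by omega, one_div, inv_pow, inv_pow, ← zpow_natCast, ← zpow_natCast,
      ← zpow_natCast, ← zpow_neg, ← zpow_neg, ← zpow_add₀ two_ne_zero, ← zpow_add₀ two_ne_zero,
      ← zpow_add₀ two_ne_zero]
    congr 1
    push_cast
    ring
  push_cast
  linear_combination ((Real.pi : ℂ) ^ n * (1 / ((m + (n - 1)).choose m : ℂ)) ^ 2 * (-1) ^ j /
    (2 * m - j).factorial * (n + k).ascFactorial j * Complex.regularizedHGFun
      {((j : ℂ) - 2 * m) / 2, ((j : ℂ) - 2 * m + 1) / 2, (j : ℂ) + n}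
      {(j : ℂ) - m + 1, (j : ℂ) - m + 1} 1) * h6

end Magnetic

/-! ### Functions of exponential growth and Gaussian integrals -/

namespace Magnetic

variable {n : ℕ}

/-- Continuous functions on `ℂⁿ` of at most exponential growth. -/
def HasExpGrowth (f : (Fin n → ℂ) → ℂ) : Prop :=
  Continuous f ∧ ∃ M C : ℝ, ∀ z, ‖f z‖ ≤ M * Real.exp (C * ∑ j, ‖z j‖)

namespace HasExpGrowth

theorem exists_nonneg {f : (Fin n → ℂ) → ℂ} (hf : HasExpGrowth f) :
    ∃ M C : ℝ, 0 ≤ M ∧ 0 ≤ C ∧ ∀ z, ‖f z‖ ≤ M * Real.exp (C * ∑ j, ‖z j‖) := by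
  obtain ⟨-, M, C, h⟩ := hf
  refine ⟨|M|, |C|, abs_nonneg _, abs_nonneg _, fun z => (h z).trans ?_⟩
  have : 0 ≤ ∑ j, ‖z j‖ := Finset.sum_nonneg fun _ _ => norm_nonneg _
  have := le_abs_self M
  have := le_abs_self C
  gcongr

theorem const (c : ℂ) : HasExpGrowth (fun _ : Fin n → ℂ => c) :=
  ⟨continuous_const, ‖c‖, 0, fun z => by simp⟩

theorem mul {f g : (Fin n → ℂ) → ℂ} (hf : HasExpGrowth f) (hg : HasExpGrowth g) :
    HasExpGrowth (fun z => f z * g z) := by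
  obtain ⟨M, C, hM, hC, h⟩ := hf.exists_nonneg
  obtain ⟨M', C', hM', hC', h'⟩ := hg.exists_nonneg
  refine ⟨hf.1.mul hg.1, M * M', C + C', fun z => ?_⟩
  rw [norm_mul, add_mul, Real.exp_add]
  calc ‖f z‖ * ‖g z‖ ≤ (M * Real.exp (C * ∑ j, ‖z j‖)) * (M' * Real.exp (C' * ∑ j, ‖z j‖)) :=
        mul_le_mul (h z) (h' z) (norm_nonneg _) (by positivity)
    _ = _ := by ring

theorem add {f g : (Fin n → ℂ) → ℂ} (hf : HasExpGrowth f) (hg : HasExpGrowth g) :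
    HasExpGrowth (fun z => f z + g z) := by
  obtain ⟨M, C, hM, hC, h⟩ := hf.exists_nonneg
  obtain ⟨M', C', hM', hC', h'⟩ := hg.exists_nonneg
  refine ⟨hf.1.add hg.1, M + M', max C C', fun z => (norm_add_le _ _).trans ?_⟩
  have h0 : 0 ≤ ∑ j, ‖z j‖ := Finset.sum_nonneg fun _ _ => norm_nonneg _
  rw [add_mul]
  refine add_le_add ((h z).trans ?_) ((h' z).trans ?_)
  · have := le_max_left C C'
    gcongr
  · have := le_max_right C C'
    gcongr

theorem sum {ι : Type*} (s : Finset ι) {f : ι → (Fin n → ℂ) → ℂ} (hf : ∀ i, HasExpGrowth (f i)) :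
    HasExpGrowth (fun z => ∑ i ∈ s, f i z) := by
  classical
  induction s using Finset.induction_on with
  | empty => simpa using const (n := n) 0
  | insert i s hi ih =>
    simp only [Finset.sum_insert hi]
    exact (hf i).add ih

theorem pow {f : (Fin n → ℂ) → ℂ} (hf : HasExpGrowth f) (k : ℕ) :
    HasExpGrowth (fun z => f z ^ k) := by
  induction k with
  | zero => simpa using const (n := n) 1
  | succ k ih => simpa only [pow_succ] using ih.mul hf

theorem conj {f : (Fin n → ℂ) → ℂ} (hf : HasExpGrowth f) :
    HasExpGrowth (fun z => (starRingEnd ℂ) (f z)) := by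
  obtain ⟨hc, M, C, h⟩ := hf
  exact ⟨Complex.continuous_conj.comp hc, M, C, fun z => by simpa using h z⟩

theorem coord (j : Fin n) : HasExpGrowth (fun z : Fin n → ℂ => z j) := by
  refine ⟨continuous_apply j, 1, 1, fun z => ?_⟩
  have h1 : ‖z j‖ ≤ ∑ i, ‖z i‖ :=
    Finset.single_le_sum (f := fun i => ‖z i‖) (fun i _ => norm_nonneg _) (Finset.mem_univ j)
  have h2 := Real.add_one_le_exp (∑ i, ‖z i‖)
  rw [one_mul, one_mul]
  linarith

theorem cexp_linear (u : Fin n → ℂ) : HasExpGrowth (fun z => Complex.exp (∑ j, u j * z j)) := by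
  refine ⟨by fun_prop, 1, ‖u‖, fun z => ?_⟩
  rw [one_mul]
  refine (Complex.norm_exp_le_exp_norm _).trans (Real.exp_le_exp.2 ?_)
  refine (norm_sum_le _ _).trans ?_
  rw [Finset.mul_sum]
  refine Finset.sum_le_sum fun j _ => ?_
  rw [norm_mul]
  have := norm_le_pi_norm u j
  gcongr

theorem cexp_conj_linear (u : Fin n → ℂ) :
    HasExpGrowth (fun z => Complex.exp (∑ j, u j * (starRingEnd ℂ) (z j))) := by
  have h := (cexp_linear fun j => (starRingEnd ℂ) (u j)).conj
  convert h using 2 with z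
  rw [← Complex.exp_conj, map_sum]
  simp

theorem normSq : HasExpGrowth (fun z : Fin n → ℂ => ((Magnetic.normSq z : ℝ) : ℂ)) := by
  have h : (fun z : Fin n → ℂ => ((Magnetic.normSq z : ℝ) : ℂ)) =
      fun z => ∑ j, z j * (starRingEnd ℂ) (z j) := by
    ext z
    simp [Magnetic.normSq, Complex.mul_conj, Complex.normSq_eq_norm_sq]
  rw [h]
  exact sum _ fun j => (coord j).mul (coord j).conj

end HasExpGrowth

theorem continuous_normSq : Continuous (normSq : (Fin n → ℂ) → ℝ) := by
  unfold normSq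
  fun_prop

theorem integrable_exp_mul_norm_sub (C : ℝ) {c : ℝ} (hc : 0 < c) :
    Integrable (fun z : ℂ => Real.exp (C * ‖z‖ - c * ‖z‖ ^ 2)) := by
  have h := (GaussianFourier.integrable_cexp_neg_mul_sq_norm_add (V := ℂ) (b := ((c / 2 : ℝ) : ℂ))
    (by simpa using hc) 0 0).norm.const_mul (Real.exp (C ^ 2 / (2 * c)))
  refine h.mono' (by fun_prop) (ae_of_all _ fun z => ?_)
  rw [Real.norm_of_nonneg (Real.exp_pos _).le, Complex.norm_exp, ← Real.exp_add, Real.exp_le_exp]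
  have h1 : (-((c / 2 : ℝ) : ℂ) * (‖z‖ : ℂ) ^ 2 + 0 * ((inner ℝ (0 : ℂ) z : ℝ) : ℂ)).re =
      -(c / 2) * ‖z‖ ^ 2 := by
    rw [zero_mul, add_zero]
    norm_cast
  rw [h1]
  have h2 : 0 ≤ (C - c * ‖z‖) ^ 2 / (2 * c) := by positivity
  have h3 : (C - c * ‖z‖) ^ 2 / (2 * c) = C ^ 2 / (2 * c) - C * ‖z‖ + c / 2 * ‖z‖ ^ 2 := by
    field_simp
    ring
  linarith

theorem integrable_exp_mul_sum_norm_sub (C : ℝ) {c : ℝ} (hc : 0 < c) :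
    Integrable (fun z : Fin n → ℂ => Real.exp (C * ∑ j, ‖z j‖) * Real.exp (-(c * normSq z))) := by
  have h := Integrable.fintype_prod (ι := Fin n) (μ := fun _ => (volume : Measure ℂ))
    (f := fun _ (z : ℂ) => Real.exp (C * ‖z‖ - c * ‖z‖ ^ 2))
    fun _ => integrable_exp_mul_norm_sub C hc
  refine h.congr (ae_of_all _ fun z => ?_)
  simp only [← Real.exp_sum, ← Real.exp_add, normSq, Finset.sum_sub_distrib, Finset.mul_sum]
  ring_nf

theorem HasExpGrowth.integrable {f : (Fin n → ℂ) → ℂ} (hf : HasExpGrowth f) {c : ℝ} (hc : 0 < c) :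
    Integrable (fun z => f z * ((Real.exp (-(c * Magnetic.normSq z)) : ℝ) : ℂ)) := by
  obtain ⟨hcont, M, C, h⟩ := id hf
  have hm : Continuous (fun z => f z * ((Real.exp (-(c * Magnetic.normSq z)) : ℝ) : ℂ)) := by
    have := continuous_normSq (n := n)
    fun_prop
  refine ((integrable_exp_mul_sum_norm_sub C hc).const_mul M).mono' hm.aestronglyMeasurable
    (ae_of_all _ fun z => ?_)
  rw [norm_mul, Complex.norm_real, Real.norm_of_nonneg (Real.exp_pos _).le, ← mul_assoc]
  have := h z
  gcongr

theorem integral_gaussian (f : (Fin n → ℂ) → ℂ) :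
    ∫ z, f z ∂gaussian n = ∫ z, f z * ((Real.exp (-normSq z) : ℝ) : ℂ) := by
  have hm : Measurable (normSq : (Fin n → ℂ) → ℝ) := continuous_normSq.measurable
  rw [gaussian, integral_withDensity_eq_integral_toReal_smul (by fun_prop)
    (ae_of_all _ fun z => ENNReal.ofReal_lt_top)]
  refine integral_congr_ae (ae_of_all _ fun z => ?_)
  simp only [ENNReal.toReal_ofReal (Real.exp_pos _).le, Complex.real_smul]
  ring

theorem integrable_gaussian_iff {f : (Fin n → ℂ) → ℂ} :
    Integrable f (gaussian n) ↔
      Integrable (fun z => f z * ((Real.exp (-normSq z) : ℝ) : ℂ)) := by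
  have hm : Measurable (normSq : (Fin n → ℂ) → ℝ) := continuous_normSq.measurable
  rw [gaussian, integrable_withDensity_iff_integrable_smul' (by fun_prop)
    (ae_of_all _ fun z => ENNReal.ofReal_lt_top)]
  refine integrable_congr (ae_of_all _ fun z => ?_)
  simp only [ENNReal.toReal_ofReal (Real.exp_pos _).le, Complex.real_smul]
  ring

theorem HasExpGrowth.integrable_gaussian {f : (Fin n → ℂ) → ℂ} (hf : HasExpGrowth f) :
    Integrable f (gaussian n) := by
  rw [integrable_gaussian_iff]
  simpa using hf.integrable one_pos

theorem HasExpGrowth.memLp {f : (Fin n → ℂ) → ℂ} (hf : HasExpGrowth f) :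
    MemLp f 2 (gaussian n) := by
  rw [memLp_two_iff_integrable_sq_norm hf.1.aestronglyMeasurable]
  have h := (hf.pow 2).integrable_gaussian.norm
  simpa using h

theorem integral_gaussian_complex {c : ℝ} (hc : 0 < c) (a b : ℂ) :
    ∫ z : ℂ, Complex.exp (-(c * ((‖z‖ ^ 2 : ℝ) : ℂ)) - a * z + b * (starRingEnd ℂ) z) =
      Real.pi / c * Complex.exp (-(a * b / c)) := by
  rw [← Complex.volume_preserving_equiv_real_prod.symm.integral_comp']
  have h1 : ∀ p : ℝ × ℝ, Complex.exp (-(c * ((‖Complex.measurableEquivRealProd.symm p‖ ^ 2 : ℝ) : ℂ))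
      - a * Complex.measurableEquivRealProd.symm p +
        b * (starRingEnd ℂ) (Complex.measurableEquivRealProd.symm p)) =
      Complex.exp (-(c : ℂ) * (p.1 : ℂ) ^ 2 + (b - a) * p.1 + 0) *
        Complex.exp (-(c : ℂ) * (p.2 : ℂ) ^ 2 + (-Complex.I * (a + b)) * p.2 + 0) := by
    intro p
    rw [← Complex.exp_add, Complex.measurableEquivRealProd_symm_apply, Complex.sq_norm,
      Complex.normSq_mk, Complex.mk_eq_add_mul_I]
    congr 1
    simp only [map_add, map_mul, Complex.conj_ofReal, Complex.conj_I]
    push_cast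
    ring
  simp_rw [h1]
  have hre : (-(c : ℂ)).re < 0 := by simpa using hc
  have hc0 : (c : ℂ) ≠ 0 := by exact_mod_cast hc.ne'
  rw [Measure.volume_eq_prod, integral_prod_mul
    (fun x : ℝ => Complex.exp (-(c : ℂ) * (x : ℂ) ^ 2 + (b - a) * x + 0))
    (fun x : ℝ => Complex.exp (-(c : ℂ) * (x : ℂ) ^ 2 + (-Complex.I * (a + b)) * x + 0)),
    integral_cexp_quadratic hre, integral_cexp_quadratic hre, mul_mul_mul_comm, ← Complex.exp_add,
    neg_neg, ← Complex.cpow_add _ _ (by simp [Real.pi_ne_zero, hc0])]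
  norm_num
  left
  congr 1
  field_simp
  rw [Complex.I_sq]
  ring

/-- The Gaussian generating integral: `e ^ (-c|z|² - a·z + b·z̄)` integrates to
`(π / c)ⁿ e ^ (-a·b / c)`. -/
theorem integral_gaussian_pi {c : ℝ} (hc : 0 < c) (a b : Fin n → ℂ) :
    ∫ z : Fin n → ℂ, Complex.exp (∑ j, b j * (starRingEnd ℂ) (z j)) *
      (Complex.exp (-∑ j, a j * z j) * ((Real.exp (-(c * normSq z)) : ℝ) : ℂ)) =
      (Real.pi / c) ^ n * Complex.exp (-((∑ j, a j * b j) / c)) := by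
  have h := integral_fintype_prod_volume_eq_prod (𝕜 := ℂ) (ι := Fin n) (E := fun _ => ℂ)
    (fun j z => Complex.exp (-(c * ((‖z‖ ^ 2 : ℝ) : ℂ)) - a j * z + b j * (starRingEnd ℂ) z))
  simp_rw [integral_gaussian_complex hc] at h
  rw [Finset.prod_mul_distrib, Finset.prod_const, Finset.card_univ, Fintype.card_fin,
    ← Complex.exp_sum, Finset.sum_neg_distrib, ← Finset.sum_div] at h
  rw [← h]
  refine integral_congr_ae (ae_of_all _ fun z => ?_)
  simp only [normSq, ← Complex.exp_sum, Complex.ofReal_exp, ← Complex.exp_add]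
  congr 1
  push_cast
  rw [Finset.sum_add_distrib, Finset.sum_sub_distrib, Finset.sum_neg_distrib, Finset.mul_sum]
  ring

end Magnetic

/-! ### Moments as derivatives of exponential integrals -/

namespace Magnetic

variable {n : ℕ}

theorem hasDerivAt_integral_pow_mul_exp {α : Type*} [MeasurableSpace α] {μ : Measure α}
    {X w : α → ℂ} (hX : AEStronglyMeasurable X μ) (hw : AEStronglyMeasurable w μ) {r : ℝ}
    (hint : Integrable (fun x => ‖w x‖ * Real.exp (r * ‖X x‖)) μ) (k : ℕ) {s : ℝ} (hs : |s| < r) :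
    HasDerivAt (fun s : ℝ => ∫ x, X x ^ k * Complex.exp (s * X x) * w x ∂μ)
      (∫ x, X x ^ (k + 1) * Complex.exp (s * X x) * w x ∂μ) s := by
  -- the margin `ε` in the exponent absorbs the polynomial factor
  obtain ⟨ε, hε, hsε⟩ : ∃ ε > 0, |s| + 2 * ε = r := ⟨(r - |s|) / 2, by linarith, by ring⟩
  have hbound : ∀ k : ℕ, ∀ t : ℝ, |t| < r - ε → ∀ x,
      ‖X x ^ k * Complex.exp (t * X x) * w x‖ ≤
        k.factorial / ε ^ k * (‖w x‖ * Real.exp (r * ‖X x‖)) := by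
    intro k t ht x
    rw [norm_mul, norm_mul, norm_pow]
    have h1 : ‖Complex.exp (t * X x)‖ ≤ Real.exp ((r - ε) * ‖X x‖) := by
      refine (Complex.norm_exp_le_exp_norm _).trans (Real.exp_le_exp.2 ?_)
      rw [norm_mul, Complex.norm_real, Real.norm_eq_abs]
      gcongr
    have h2 := Real.pow_div_factorial_le_exp (x := ε * ‖X x‖) (by positivity) k
    have h3 : ‖X x‖ ^ k ≤ k.factorial / ε ^ k * Real.exp (ε * ‖X x‖) := by
      rw [div_le_iff₀ (by positivity), mul_pow] at h2
      rw [div_mul_eq_mul_div, le_div_iff₀ (by positivity)]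
      linarith
    calc ‖X x‖ ^ k * ‖Complex.exp (t * X x)‖ * ‖w x‖
        ≤ (k.factorial / ε ^ k * Real.exp (ε * ‖X x‖)) * Real.exp ((r - ε) * ‖X x‖) * ‖w x‖ := by
          gcongr
      _ = _ := by
          rw [mul_assoc (_ / _), ← Real.exp_add, ← add_mul, show ε + (r - ε) = r by ring]
          ring
  have hmeas : ∀ (k : ℕ) (t : ℝ),
      AEStronglyMeasurable (fun x => X x ^ k * Complex.exp (t * X x) * w x) μ := fun k t =>
    ((hX.pow k).mul (Complex.continuous_exp.comp_aestronglyMeasurable (hX.const_mul _))).mul hw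
  refine (hasDerivAt_integral_of_dominated_loc_of_deriv_le
    (bound := fun x => (k + 1).factorial / ε ^ (k + 1) * (‖w x‖ * Real.exp (r * ‖X x‖)))
    (Metric.ball_mem_nhds s hε) (Filter.Eventually.of_forall fun t => hmeas k t)
    ((hint.const_mul (k.factorial / ε ^ k)).mono' (hmeas k s)
      (ae_of_all _ fun x => hbound k s (by linarith) x)) (hmeas (k + 1) s)
    (ae_of_all _ fun x t ht => hbound (k + 1) t ?_ x) (hint.const_mul _)
    (ae_of_all _ fun x t _ => ?_)).2
  · rw [Metric.mem_ball, Real.dist_eq] at ht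
    have := abs_sub_abs_le_abs_sub t s
    linarith
  · have h1 : HasDerivAt (fun t : ℝ => (t : ℂ) * X x) (1 * X x) t :=
      (Complex.ofRealCLM.hasDerivAt (x := t)).mul_const (X x)
    have h2 := (h1.cexp.const_mul (X x ^ k)).mul_const (w x)
    exact h2.congr_deriv (by ring)

/-- The moments `∫ X ^ k e ^ (s X) w` are determined by the exponential integral `∫ e ^ (s X) w`
as its successive derivatives. -/
theorem integral_pow_mul_exp_eq {α : Type*} [MeasurableSpace α] {μ : Measure α}
    {X w : α → ℂ} (hX : AEStronglyMeasurable X μ) (hw : AEStronglyMeasurable w μ) {r : ℝ}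
    (hint : Integrable (fun x => ‖w x‖ * Real.exp (r * ‖X x‖)) μ) {Φ : ℕ → ℝ → ℂ}
    (hΦ : ∀ k s, |s| < r → HasDerivAt (Φ k) (Φ (k + 1) s) s)
    (h0 : ∀ s : ℝ, |s| < r → ∫ x, Complex.exp (s * X x) * w x ∂μ = Φ 0 s) (k : ℕ) :
    ∀ s : ℝ, |s| < r → ∫ x, X x ^ k * Complex.exp (s * X x) * w x ∂μ = Φ k s := by
  induction k with
  | zero => simpa using h0
  | succ k ih =>
    intro s hs
    refine (hasDerivAt_integral_pow_mul_exp hX hw hint k hs).unique ?_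
    refine (hΦ k s hs).congr_of_eventuallyEq ?_
    filter_upwards [(isOpen_lt continuous_abs continuous_const).mem_nhds hs] with t ht
    exact ih t ht

theorem hasExpGrowth_linear_add_conj (v a : Fin n → ℂ) :
    HasExpGrowth (fun z => ∑ j, v j * (a j + (starRingEnd ℂ) (z j))) :=
  HasExpGrowth.sum _ fun j =>
    (HasExpGrowth.const (v j)).mul ((HasExpGrowth.const (a j)).add (HasExpGrowth.coord j).conj)

theorem hasExpGrowth_cexp_neg (a : Fin n → ℂ) :
    HasExpGrowth (fun z => Complex.exp (-∑ j, a j * z j)) := by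
  have h := HasExpGrowth.cexp_linear (fun j => -a j)
  simpa [Finset.sum_neg_distrib] using h

/-- The `k`-th derivative at `τ = 0` of the generating integral with `b = τ v`. -/
theorem integral_pow_linear {c : ℝ} (hc : 0 < c) (v a : Fin n → ℂ) (k : ℕ) :
    ∫ z : Fin n → ℂ, (∑ j, v j * (a j + (starRingEnd ℂ) (z j))) ^ k *
      (Complex.exp (-∑ j, a j * z j) * ((Real.exp (-(c * normSq z)) : ℝ) : ℂ)) =
      (Real.pi / c) ^ n * ((1 - 1 / c) * ∑ j, v j * a j) ^ k := by
  have hX := hasExpGrowth_linear_add_conj v a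
  have hw : Continuous fun z : Fin n → ℂ =>
      Complex.exp (-∑ j, a j * z j) * ((Real.exp (-(c * normSq z)) : ℝ) : ℂ) := by
    have := continuous_normSq (n := n)
    fun_prop
  set β : ℂ := (1 - 1 / c) * ∑ j, v j * a j with hβ
  have hint : Integrable (fun z : Fin n → ℂ =>
      ‖Complex.exp (-∑ j, a j * z j) * ((Real.exp (-(c * normSq z)) : ℝ) : ℂ)‖ *
        Real.exp (1 * ‖∑ j, v j * (a j + (starRingEnd ℂ) (z j))‖)) := by
    have hA : ∃ A : ℝ, ∀ z : Fin n → ℂ, ‖∑ j, v j * (a j + (starRingEnd ℂ) (z j))‖ ≤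
        A + ‖v‖ * ∑ j, ‖z j‖ := by
      refine ⟨‖∑ j, v j * a j‖, fun z => ?_⟩
      simp only [mul_add, Finset.sum_add_distrib]
      refine (norm_add_le _ _).trans (add_le_add le_rfl ((norm_sum_le _ _).trans ?_))
      rw [Finset.mul_sum]
      refine Finset.sum_le_sum fun j _ => ?_
      rw [norm_mul, RCLike.norm_conj]
      have := norm_le_pi_norm v j
      gcongr
    obtain ⟨A, hA⟩ := hA
    obtain ⟨-, M, C, hM⟩ := hasExpGrowth_cexp_neg a
    refine ((integrable_exp_mul_sum_norm_sub (C + ‖v‖) hc).const_mul (M * Real.exp A)).mono'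
      ?_ (ae_of_all _ fun z => ?_)
    · have := hX.1
      exact (by fun_prop : Continuous _).aestronglyMeasurable
    · rw [Real.norm_of_nonneg (by positivity), norm_mul, Complex.norm_real,
        Real.norm_of_nonneg (Real.exp_pos _).le, one_mul]
      have h1 := hM z
      have h2 := hA z
      calc ‖Complex.exp (-∑ j, a j * z j)‖ * Real.exp (-(c * normSq z)) *
            Real.exp ‖∑ j, v j * (a j + (starRingEnd ℂ) (z j))‖
          ≤ (M * Real.exp (C * ∑ j, ‖z j‖)) * Real.exp (-(c * normSq z)) *
            Real.exp (A + ‖v‖ * ∑ j, ‖z j‖) := by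
              have := (norm_nonneg _).trans h1
              gcongr
        _ = _ := by rw [Real.exp_add, add_mul, Real.exp_add]; ring
  have h := integral_pow_mul_exp_eq (Φ := fun k s => (Real.pi / c) ^ n * (β ^ k * Complex.exp (s * β)))
    hX.1.aestronglyMeasurable hw.aestronglyMeasurable hint (fun k s _ => ?_) (fun s _ => ?_) k 0
    (by simp)
  · simpa using h
  · have h1 : HasDerivAt (fun t : ℝ => (t : ℂ) * β) (1 * β) s :=
      (Complex.ofRealCLM.hasDerivAt (x := s)).mul_const β
    exact ((h1.cexp.const_mul (β ^ k)).const_mul (((Real.pi : ℂ) / c) ^ n)).congr_deriv (by ring)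
  · have h2 : ∀ z : Fin n → ℂ, Complex.exp (s * ∑ j, v j * (a j + (starRingEnd ℂ) (z j))) *
        (Complex.exp (-∑ j, a j * z j) * ((Real.exp (-(c * normSq z)) : ℝ) : ℂ)) =
        Complex.exp (s * ∑ j, v j * a j) *
        (Complex.exp (∑ j, (s * v j) * (starRingEnd ℂ) (z j)) *
        (Complex.exp (-∑ j, a j * z j) * ((Real.exp (-(c * normSq z)) : ℝ) : ℂ))) := by
      intro z
      rw [← mul_assoc (Complex.exp (s * ∑ j, v j * a j)), ← Complex.exp_add]
      congr 2
      simp only [mul_add, Finset.sum_add_distrib, Finset.mul_sum, mul_assoc]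
    simp_rw [h2]
    rw [integral_const_mul, integral_gaussian_pi hc, mul_left_comm, ← Complex.exp_add, pow_zero,
      one_mul]
    congr 2
    have h3 : ∑ j, a j * (s * v j) = s * ∑ j, v j * a j := by
      rw [Finset.mul_sum]
      exact Finset.sum_congr rfl fun j _ => by ring
    rw [h3, hβ]
    ring

/-- The combinatorial factor, independent of `k`, in the `p`-th derivative of
`s ↦ u ^ n h ^ (n + k)`, where `u = 1 / (1 + s)` and `h = (1 + s) / (2 + s)`. -/
def derivCoeff (n p j : ℕ) : ℕ := p.choose j * (n + j).ascFactorial (p - j)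

theorem derivCoeff_succ_zero (n p : ℕ) : derivCoeff n (p + 1) 0 = derivCoeff n p 0 * (n + p) := by
  simp [derivCoeff, Nat.ascFactorial_succ, mul_comm]

theorem derivCoeff_succ_succ (n p j : ℕ) : derivCoeff n (p + 1) (j + 1) =
    derivCoeff n p (j + 1) * (n + p + (j + 1)) + derivCoeff n p j := by
  unfold derivCoeff
  rcases lt_trichotomy p j with h | h | h
  · rw [Nat.choose_eq_zero_of_lt (by omega), Nat.choose_eq_zero_of_lt (by omega),
      Nat.choose_eq_zero_of_lt h]
    simp
  · subst h
    simp
  · obtain ⟨q, rfl⟩ : ∃ q, p = j + 1 + q := ⟨p - (j + 1), by omega⟩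
    have h1 := Nat.choose_succ_right_eq (j + 1 + q) j
    rw [show j + 1 + q - j = q + 1 by omega] at h1
    rw [show j + 1 + q + 1 - (j + 1) = q + 1 by omega, show j + 1 + q - (j + 1) = q by omega,
      show j + 1 + q - j = 1 + q by omega, Nat.choose_succ_succ', Nat.ascFactorial_succ,
      ← Nat.ascFactorial_mul_ascFactorial (n + j) 1 q, Nat.ascFactorial_succ, Nat.ascFactorial_zero,
      add_zero, mul_one, ← add_assoc n j 1]
    linear_combination ((n + j + 1).ascFactorial q) * h1.symm

/-- The `p`-th derivative of `u ^ n h ^ (n + k)` with respect to `s`, where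
`u = 1 / (1 + s)` and `h = (1 + s) / (2 + s)`. -/
def radialDeriv (n k p : ℕ) (s : ℝ) : ℝ :=
  ∑ j ∈ Finset.range (p + 1), (-1) ^ (p + j) * derivCoeff n p j * (n + k).ascFactorial j *
    ((1 / (1 + s)) ^ (n + p + j) * ((1 + s) / (2 + s)) ^ (n + k + j))

theorem hasDerivAt_pow_mul_pow (a b : ℕ) {s : ℝ} (h1 : 1 + s ≠ 0) (h2 : 2 + s ≠ 0) :
    HasDerivAt (fun s : ℝ => (1 / (1 + s)) ^ a * ((1 + s) / (2 + s)) ^ b)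
      (-(a * ((1 / (1 + s)) ^ (a + 1) * ((1 + s) / (2 + s)) ^ b)) +
        b * ((1 / (1 + s)) ^ (a + 2) * ((1 + s) / (2 + s)) ^ (b + 1))) s := by
  have hu : HasDerivAt (fun s : ℝ => 1 / (1 + s)) (-(1 / (1 + s)) ^ 2) s := by
    simpa [neg_div] using ((hasDerivAt_id s).const_add 1).fun_inv h1
  have hh : HasDerivAt (fun s : ℝ => (1 + s) / (2 + s))
      ((1 / (1 + s)) ^ 2 * ((1 + s) / (2 + s)) ^ 2) s := by
    refine (((hasDerivAt_id s).const_add 1).div ((hasDerivAt_id s).const_add 2) h2).congr_deriv ?_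
    simp only [id]
    field_simp
    ring
  refine ((hu.fun_pow a).fun_mul (hh.fun_pow b)).congr_deriv ?_
  generalize 1 / (1 + s) = u
  generalize (1 + s) / (2 + s) = w
  rcases a with _ | a <;> rcases b with _ | b <;>
  · push_cast
    ring

theorem hasDerivAt_radialDeriv (n k p : ℕ) {s : ℝ} (h1 : 1 + s ≠ 0) (h2 : 2 + s ≠ 0) :
    HasDerivAt (radialDeriv n k p) (radialDeriv n k (p + 1) s) s := by
  have h := HasDerivAt.fun_sum (u := Finset.range (p + 1)) fun j _ =>
    (hasDerivAt_pow_mul_pow (n + p + j) (n + k + j) h1 h2).const_mul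
      ((-1 : ℝ) ^ (p + j) * derivCoeff n p j * (n + k).ascFactorial j)
  refine h.congr_deriv ?_
  unfold radialDeriv
  generalize 1 / (1 + s) = u
  generalize (1 + s) / (2 + s) = w
  have hA : ∑ j ∈ Finset.range (p + 2), (-1 : ℝ) ^ (p + 1 + j) * (derivCoeff n p j * (n + p + j)) *
      (n + k).ascFactorial j * (u ^ (n + (p + 1) + j) * w ^ (n + k + j)) =
      ∑ j ∈ Finset.range (p + 1), (-1 : ℝ) ^ (p + 1 + j) * (derivCoeff n p j * (n + p + j)) *
      (n + k).ascFactorial j * (u ^ (n + (p + 1) + j) * w ^ (n + k + j)) := by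
    rw [Finset.sum_range_succ]
    simp [derivCoeff]
  rw [Finset.sum_range_succ'] at hA
  rw [Finset.sum_range_succ' _ (p + 1)]
  simp only [derivCoeff_succ_succ, derivCoeff_succ_zero]
  have hB : ∀ j, (-1 : ℝ) ^ (p + 1 + (j + 1)) *
      ((derivCoeff n p (j + 1) * (n + p + (j + 1)) + derivCoeff n p j : ℕ) : ℝ) *
      ((n + k).ascFactorial (j + 1) : ℝ) *
        (u ^ (n + (p + 1) + (j + 1)) * w ^ (n + k + (j + 1))) =
      (-1 : ℝ) ^ (p + 1 + (j + 1)) * (derivCoeff n p (j + 1) * (n + p + ((j + 1 : ℕ) : ℝ))) *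
      ((n + k).ascFactorial (j + 1) : ℝ) *
        (u ^ (n + (p + 1) + (j + 1)) * w ^ (n + k + (j + 1))) +
      (-1 : ℝ) ^ (p + j) * derivCoeff n p j * ((n + k).ascFactorial j * (n + k + j)) *
        (u ^ (n + (p + 1) + (j + 1)) * w ^ (n + k + (j + 1))) := by
    intro j
    rw [Nat.ascFactorial_succ]
    push_cast
    ring
  rw [Finset.sum_congr rfl fun j _ => hB j, Finset.sum_add_distrib]
  push_cast at hA ⊢
  rw [add_right_comm]
  trans (∑ j ∈ Finset.range (p + 1), (-1 : ℝ) ^ (p + 1 + j) * (derivCoeff n p j * (n + p + j)) *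
      (n + k).ascFactorial j * (u ^ (n + (p + 1) + j) * w ^ (n + k + j))) +
      ∑ j ∈ Finset.range (p + 1), (-1 : ℝ) ^ (p + j) * derivCoeff n p j *
        ((n + k).ascFactorial j * (n + k + j)) *
        (u ^ (n + (p + 1) + (j + 1)) * w ^ (n + k + (j + 1)))
  · rw [← Finset.sum_add_distrib]
    refine Finset.sum_congr rfl fun j _ => ?_
    ring
  · rw [← hA]
    simp

/-- The moments of the eigenfunction integral against `|z| ^ (2 p) e ^ (-2|z|²)`. -/
theorem integral_normSq_pow_mul (v a : Fin n → ℂ) (k p : ℕ) :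
    ∫ z : Fin n → ℂ, ((normSq z : ℝ) : ℂ) ^ p * ((∑ j, v j * (a j + (starRingEnd ℂ) (z j))) ^ k *
      (Complex.exp (-∑ j, a j * z j) * ((Real.exp (-(2 * normSq z)) : ℝ) : ℂ))) =
      (Real.pi : ℂ) ^ n * powerEigenvalue n k p * (∑ j, v j * a j) ^ k := by
  have hN := continuous_normSq (n := n)
  have hg : HasExpGrowth fun z : Fin n → ℂ =>
      (∑ j, v j * (a j + (starRingEnd ℂ) (z j))) ^ k * Complex.exp (-∑ j, a j * z j) :=
    ((hasExpGrowth_linear_add_conj v a).pow k).mul (hasExpGrowth_cexp_neg a)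
  have hX : Continuous fun z : Fin n → ℂ => -((normSq z : ℝ) : ℂ) := by fun_prop
  have hw : Continuous fun z : Fin n → ℂ => (∑ j, v j * (a j + (starRingEnd ℂ) (z j))) ^ k *
      (Complex.exp (-∑ j, a j * z j) * ((Real.exp (-(2 * normSq z)) : ℝ) : ℂ)) := by
    fun_prop
  have hpos : ∀ z : Fin n → ℂ, 0 ≤ normSq z := fun z =>
    Finset.sum_nonneg fun _ _ => by positivity
  have hint : Integrable (fun z : Fin n → ℂ =>
      ‖(∑ j, v j * (a j + (starRingEnd ℂ) (z j))) ^ k *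
      (Complex.exp (-∑ j, a j * z j) * ((Real.exp (-(2 * normSq z)) : ℝ) : ℂ))‖ *
        Real.exp (1 / 2 * ‖-((normSq z : ℝ) : ℂ)‖)) := by
    refine (hg.integrable (c := 3 / 2) (by norm_num)).norm.congr (ae_of_all _ fun z => ?_)
    dsimp only
    rw [← mul_assoc, norm_mul _ ((_ : ℝ) : ℂ), norm_mul _ ((_ : ℝ) : ℂ), Complex.norm_real,
      Complex.norm_real, Real.norm_of_nonneg (Real.exp_pos _).le,
      Real.norm_of_nonneg (Real.exp_pos _).le, norm_neg, Complex.norm_real,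
      Real.norm_of_nonneg (hpos z), mul_assoc, ← Real.exp_add]
    congr 2
    ring
  -- with the Gaussian `e ^ (-(2 + s)|z|²)`, each derivative in `s` at `0` brings down `-|z|²`
  have h := integral_pow_mul_exp_eq
    (Φ := fun p s => (Real.pi : ℂ) ^ n * (∑ j, v j * a j) ^ k * ((radialDeriv n k p s : ℝ) : ℂ))
    hX.aestronglyMeasurable hw.aestronglyMeasurable hint (fun p s hs => ?_) (fun s hs => ?_) p 0
    (by norm_num)
  · have h1 : ((radialDeriv n k p 0 : ℝ) : ℂ) = (-1) ^ p * powerEigenvalue n k p := by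
      rw [radialDeriv, powerEigenvalue, Finset.mul_sum]
      push_cast
      refine Finset.sum_congr rfl fun j _ => ?_
      rw [derivCoeff]
      push_cast
      norm_num
      ring
    simp only [Complex.ofReal_zero, zero_mul, Complex.exp_zero, mul_one, h1] at h
    have h2 : ∀ z : Fin n → ℂ, ((normSq z : ℝ) : ℂ) ^ p = (-1) ^ p * (-((normSq z : ℝ) : ℂ)) ^ p := by
      intro z
      rw [← mul_pow]
      simp
    simp_rw [h2, mul_assoc ((-1 : ℂ) ^ p)]
    rw [integral_const_mul, h]
    have h3 : ((-1 : ℂ) ^ p) * (-1) ^ p = 1 := by rw [← mul_pow]; simp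
    linear_combination ((Real.pi : ℂ) ^ n * powerEigenvalue n k p * (∑ j, v j * a j) ^ k) * h3
  · have := abs_lt.1 hs
    exact ((hasDerivAt_radialDeriv n k p (by linarith) (by linarith)).ofReal_comp).const_mul _
  · have hs' := abs_lt.1 hs
    have h4 : ∀ z : Fin n → ℂ, Complex.exp (s * -((normSq z : ℝ) : ℂ)) *
        ((∑ j, v j * (a j + (starRingEnd ℂ) (z j))) ^ k *
        (Complex.exp (-∑ j, a j * z j) * ((Real.exp (-(2 * normSq z)) : ℝ) : ℂ))) =
        (∑ j, v j * (a j + (starRingEnd ℂ) (z j))) ^ k *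
        (Complex.exp (-∑ j, a j * z j) * ((Real.exp (-((2 + s) * normSq z)) : ℝ) : ℂ)) := by
      intro z
      have h5 : Real.exp (-((2 + s) * normSq z)) =
          Real.exp (s * -normSq z) * Real.exp (-(2 * normSq z)) := by
        rw [← Real.exp_add]
        congr 1
        ring
      rw [h5]
      push_cast
      ring
    simp_rw [h4]
    rw [integral_pow_linear (by linarith), radialDeriv]
    have h6 : (2 + s : ℂ) ≠ 0 := by
      have : (2 + s : ℝ) ≠ 0 := by linarith
      exact_mod_cast this
    have h7 : (1 + s : ℂ) ≠ 0 := by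
      have : (1 + s : ℝ) ≠ 0 := by linarith
      exact_mod_cast this
    have h8 : (1 - 1 / (2 + s) : ℂ) = (1 + s) / (2 + s) := by
      field_simp
      ring
    simp only [zero_add, Finset.sum_range_one, derivCoeff, Nat.choose_self, Nat.ascFactorial_zero,
      add_zero, pow_zero, tsub_self, mul_one, one_mul, Nat.cast_one]
    push_cast
    rw [h8, mul_pow, pow_add ((1 + s : ℂ) / (2 + s)),
      ← mul_assoc ((1 / (1 + s : ℂ)) ^ n), ← mul_pow (1 / (1 + s : ℂ)),
      div_mul_div_cancel₀ h7, div_pow _ _ n, div_pow _ _ n, one_pow]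
    ring

/-! ### The deformed kernel and its eigenfunctions -/

theorem herm_self (z : Fin n → ℂ) : herm z z = ((normSq z : ℝ) : ℂ) := by
  simp [herm, normSq, Complex.mul_conj, Complex.normSq_eq_norm_sq]

theorem normSq_sub (z w : Fin n → ℂ) :
    normSq (z - w) = normSq z + normSq w - 2 * (herm z w).re := by
  simp only [normSq, herm, Complex.re_sum, Finset.mul_sum, ← Finset.sum_add_distrib,
    ← Finset.sum_sub_distrib, Pi.sub_apply, ← Complex.normSq_eq_norm_sq]
  exact Finset.sum_congr rfl fun j _ => Complex.normSq_sub _ _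

theorem laguerre_zero (m α : ℕ) : laguerre m α 0 = (m + α).choose m := by
  rw [laguerre, Finset.sum_eq_single 0]
  · simp
  · intro i _ hi
    simp [hi]
  · simp

/-- The deformed kernel is `e ^ ⟨z, w⟩` times a function of `|z - w|²`. -/
theorem deformedKernel_eq (n m : ℕ) (z w : Fin n → ℂ) :
    deformedKernel n m z w = Complex.exp (herm z w) *
      ((Real.exp (-normSq (z - w)) * (laguerre m (n - 1) (normSq (z - w)) /
        ((m + (n - 1)).choose m)) ^ 2 : ℝ) : ℂ) := by
  have hpi : (Real.pi : ℂ) ^ n ≠ 0 := pow_ne_zero _ (by exact_mod_cast Real.pi_ne_zero)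
  have hch : (((m + (n - 1)).choose m : ℕ) : ℂ) ≠ 0 := by
    exact_mod_cast (Nat.choose_pos (Nat.le_add_right m (n - 1))).ne'
  have h0 : ∀ z : Fin n → ℂ, normSq (z - z) = 0 := fun z => by simp [normSq]
  rw [deformedKernel, bargmannKernel, bargmannKernel, bargmannKernel, h0, h0, laguerre_zero,
    herm_self, herm_self, norm_mul, norm_mul, Complex.norm_real, Complex.norm_real,
    Complex.norm_exp]
  congr 1
  rw [mul_pow, mul_pow, Real.norm_eq_abs, Real.norm_eq_abs, sq_abs, sq_abs, ← Real.exp_nat_mul]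
  have h1 : Real.exp (-normSq (z - w)) =
      Real.exp ((2 : ℕ) * (herm z w).re) / (Real.exp (normSq z) * Real.exp (normSq w)) := by
    rw [← Real.exp_add, ← Real.exp_sub, normSq_sub]
    congr 1
    push_cast
    ring
  rw [h1]
  have h2 := Complex.exp_ne_zero ((normSq z : ℝ) : ℂ)
  have h3 := Complex.exp_ne_zero ((normSq w : ℝ) : ℂ)
  push_cast
  field_simp

/-- The functions `e ^ (u·z) (v·(z̄ - u)) ^ k`, which span a dense subspace of the eigenspace of
level `k` of the magnetic Laplacian. They are, up to the factor `k!`, the components of degree `k` in `v` of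
the generating functions `e ^ (u·z + v·z̄ - u·v)` of the complex Hermite polynomials. -/
def eigenfunction (u v : Fin n → ℂ) (k : ℕ) (z : Fin n → ℂ) : ℂ :=
  Complex.exp (∑ j, u j * z j) * (∑ j, v j * ((starRingEnd ℂ) (z j) - u j)) ^ k

theorem hasExpGrowth_eigenfunction (u v : Fin n → ℂ) (k : ℕ) :
    HasExpGrowth (eigenfunction u v k) := by
  refine (HasExpGrowth.cexp_linear u).mul (HasExpGrowth.pow ?_ k)
  convert hasExpGrowth_linear_add_conj v (-u) using 5
  simp [neg_add_eq_sub]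

theorem laguerre_sq (m : ℕ) (t : ℝ) : (((laguerre m (n - 1) t) ^ 2 : ℝ) : ℂ) =
    ∑ i ∈ Finset.range (m + 1), ∑ l ∈ Finset.range (m + 1),
      laguerreCoeff n m i * laguerreCoeff n m l * (t : ℂ) ^ (i + l) := by
  have h : ((laguerre m (n - 1) t : ℝ) : ℂ) =
      ∑ i ∈ Finset.range (m + 1), laguerreCoeff n m i * (t : ℂ) ^ i := by
    rw [laguerre]
    push_cast
    refine Finset.sum_congr rfl fun i _ => ?_
    rw [laguerreCoeff]
    ring
  rw [Complex.ofReal_pow, h, sq, Finset.sum_mul_sum]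
  refine Finset.sum_congr rfl fun i _ => Finset.sum_congr rfl fun l _ => ?_
  rw [pow_add]
  ring

/-- The eigenfunctions diagonalize the deformed Berezin transform. The substitution `w = z + ζ`
turns the integral into radial moments of `e ^ (-a·ζ) (v·(a + ζ̄)) ^ k` with `a = z̄ - u`. -/
theorem deformedBerezin_eigenfunction (m : ℕ) (hn : 1 ≤ n) (u v : Fin n → ℂ) (k : ℕ)
    (z : Fin n → ℂ) : deformedBerezin n m (eigenfunction u v k) z =
      spectralFunction n m k * eigenfunction u v k z := by
  set a : Fin n → ℂ := fun j => (starRingEnd ℂ) (z j) - u j with ha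
  set N : ℂ := ((m + (n - 1)).choose m : ℂ) with hNdef
  have key : ∀ w : Fin n → ℂ, deformedKernel n m z (z + w) * eigenfunction u v k (z + w) *
      ((Real.exp (-normSq (z + w)) : ℝ) : ℂ) =
      ∑ i ∈ Finset.range (m + 1), ∑ l ∈ Finset.range (m + 1),
        (Complex.exp (∑ j, u j * z j) / N ^ 2 * (laguerreCoeff n m i * laguerreCoeff n m l)) *
        (((normSq w : ℝ) : ℂ) ^ (i + l) * ((∑ j, v j * (a j + (starRingEnd ℂ) (w j))) ^ k *
        (Complex.exp (-∑ j, a j * w j) * ((Real.exp (-(2 * normSq w)) : ℝ) : ℂ)))) := by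
    intro w
    have h1 : normSq (z - (z + w)) = normSq w := by simp [normSq]
    have h2 : Complex.exp (herm z (z + w)) * Complex.exp (-((normSq w : ℝ) : ℂ)) *
        Complex.exp (∑ j, u j * (z + w) j) * Complex.exp (-((normSq (z + w) : ℝ) : ℂ)) =
        Complex.exp (∑ j, u j * z j) * (Complex.exp (-∑ j, a j * w j) *
          Complex.exp (-(2 * ((normSq w : ℝ) : ℂ)))) := by
      simp only [← Complex.exp_add, ← herm_self, herm]
      congr 1
      simp only [Finset.mul_sum, ← Finset.sum_neg_distrib, ← Finset.sum_add_distrib, ha,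
        Pi.add_apply, map_add]
      exact Finset.sum_congr rfl fun j _ => by ring
    have h3 : ∑ j, v j * ((starRingEnd ℂ) ((z + w) j) - u j) =
        ∑ j, v j * (a j + (starRingEnd ℂ) (w j)) := by
      refine Finset.sum_congr rfl fun j _ => ?_
      simp only [ha, Pi.add_apply, map_add]
      ring
    have h4 := laguerre_sq (n := n) m (normSq w)
    rw [deformedKernel_eq, h1, eigenfunction, h3]
    trans Complex.exp (∑ j, u j * z j) / N ^ 2 * (((laguerre m (n - 1) (normSq w)) ^ 2 : ℝ) : ℂ) *
      ((∑ j, v j * (a j + (starRingEnd ℂ) (w j))) ^ k *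
        (Complex.exp (-∑ j, a j * w j) * ((Real.exp (-(2 * normSq w)) : ℝ) : ℂ)))
    swap
    · rw [h4]
      simp only [Finset.mul_sum, Finset.sum_mul]
      exact Finset.sum_congr rfl fun i _ => Finset.sum_congr rfl fun l _ => by ring
    push_cast
    linear_combination (((laguerre m (n - 1) (normSq w) : ℝ) : ℂ) / N) ^ 2 *
      (∑ j, v j * (a j + (starRingEnd ℂ) (w j))) ^ k * h2
  have hint : ∀ p : ℕ, Integrable fun w : Fin n → ℂ =>
      (((normSq w : ℝ) : ℂ) ^ p * ((∑ j, v j * (a j + (starRingEnd ℂ) (w j))) ^ k *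
        (Complex.exp (-∑ j, a j * w j) * ((Real.exp (-(2 * normSq w)) : ℝ) : ℂ)))) := by
    intro p
    have h := ((HasExpGrowth.normSq.pow p).mul
      (((hasExpGrowth_linear_add_conj v a).pow k).mul (hasExpGrowth_cexp_neg a))).integrable two_pos
    refine h.congr (ae_of_all _ fun w => ?_)
    dsimp only
    ring
  rw [deformedBerezin, integral_gaussian, ← integral_add_left_eq_self _ z]
  simp_rw [key]
  rw [integral_finsetSum _ fun i _ => integrable_finsetSum _ fun l _ => (hint _).const_mul _]
  simp_rw [integral_finsetSum _ fun l _ => (hint _).const_mul _, integral_const_mul,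
    integral_normSq_pow_mul]
  rw [spectralFunction_natCast n m k hn, eigenfunction, Finset.mul_sum, Finset.sum_mul]
  refine Finset.sum_congr rfl fun i _ => ?_
  rw [Finset.mul_sum, Finset.sum_mul]
  refine Finset.sum_congr rfl fun l _ => ?_
  ring

end Magnetic

/-! ### Wirtinger calculus and symmetry of the differential expression -/

namespace Magnetic

variable {n : ℕ}

theorem dz_add (j : Fin n) {f g : (Fin n → ℂ) → ℂ} {z : Fin n → ℂ} (hf : DifferentiableAt ℝ f z)
    (hg : DifferentiableAt ℝ g z) :
    dz j (fun w => f w + g w) z = dz j f z + dz j g z := by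
  simp only [dz, fderiv_fun_add hf hg, add_apply]
  ring

theorem dz_mul (j : Fin n) {f g : (Fin n → ℂ) → ℂ} {z : Fin n → ℂ} (hf : DifferentiableAt ℝ f z)
    (hg : DifferentiableAt ℝ g z) :
    dz j (fun w => f w * g w) z = f z * dz j g z + dz j f z * g z := by
  simp only [dz, fderiv_fun_mul hf hg, add_apply, smul_apply, smul_eq_mul]
  ring

theorem dzbar_mul (j : Fin n) {f g : (Fin n → ℂ) → ℂ} {z : Fin n → ℂ} (hf : DifferentiableAt ℝ f z)
    (hg : DifferentiableAt ℝ g z) :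
    dzbar j (fun w => f w * g w) z = f z * dzbar j g z + dzbar j f z * g z := by
  simp only [dzbar, fderiv_fun_mul hf hg, add_apply, smul_apply, smul_eq_mul]
  ring

theorem dz_const_mul (j : Fin n) (c : ℂ) {f : (Fin n → ℂ) → ℂ} {z : Fin n → ℂ}
    (hf : DifferentiableAt ℝ f z) : dz j (fun w => c * f w) z = c * dz j f z := by
  rw [dz_mul j (differentiableAt_const c) hf]
  simp [dz]

theorem dz_conj (j : Fin n) {f : (Fin n → ℂ) → ℂ} {z : Fin n → ℂ} (hf : DifferentiableAt ℝ f z) :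
    dz j (fun w => (starRingEnd ℂ) (f w)) z = (starRingEnd ℂ) (dzbar j f z) := by
  have h : HasFDerivAt (fun w => (starRingEnd ℂ) (f w))
      ((Complex.conjCLE : ℂ →L[ℝ] ℂ).comp (fderiv ℝ f z)) z :=
    Complex.conjCLE.hasFDerivAt.comp z hf.hasFDerivAt
  simp [dz, dzbar, h.fderiv, sub_eq_add_neg, map_ofNat]

theorem dzbar_conj (j : Fin n) {f : (Fin n → ℂ) → ℂ} {z : Fin n → ℂ}
    (hf : DifferentiableAt ℝ f z) :
    dzbar j (fun w => (starRingEnd ℂ) (f w)) z = (starRingEnd ℂ) (dz j f z) := by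
  have h : HasFDerivAt (fun w => (starRingEnd ℂ) (f w))
      ((Complex.conjCLE : ℂ →L[ℝ] ℂ).comp (fderiv ℝ f z)) z :=
    Complex.conjCLE.hasFDerivAt.comp z hf.hasFDerivAt
  simp [dz, dzbar, h.fderiv, sub_eq_add_neg, map_ofNat]

theorem dz_comp_smul (j : Fin n) (f : (Fin n → ℂ) → ℂ) (r : ℝ) (z : Fin n → ℂ) :
    dz j (fun w => f (r • w)) z = r * dz j f (r • z) := by
  simp only [dz, fderiv_comp_smul, smul_apply, Complex.real_smul]
  ring

theorem dzbar_comp_smul (j : Fin n) (f : (Fin n → ℂ) → ℂ) (r : ℝ) (z : Fin n → ℂ) :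
    dzbar j (fun w => f (r • w)) z = r * dzbar j f (r • z) := by
  simp only [dzbar, fderiv_comp_smul, smul_apply, Complex.real_smul]
  ring

theorem contDiff_dz (j : Fin n) {f : (Fin n → ℂ) → ℂ} (hf : ContDiff ℝ ∞ f) :
    ContDiff ℝ ∞ (dz j f) := by
  have h : ContDiff ℝ ∞ (fderiv ℝ f) := hf.fderiv_right (m := ∞) (by simp)
  unfold dz
  fun_prop

theorem contDiff_dzbar (j : Fin n) {f : (Fin n → ℂ) → ℂ} (hf : ContDiff ℝ ∞ f) :
    ContDiff ℝ ∞ (dzbar j f) := by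
  have h : ContDiff ℝ ∞ (fderiv ℝ f) := hf.fderiv_right (m := ∞) (by simp)
  unfold dzbar
  fun_prop

theorem hasCompactSupport_dz (j : Fin n) {f : (Fin n → ℂ) → ℂ} (hf : HasCompactSupport f) :
    HasCompactSupport (dz j f) := by
  have h := hf.fderiv (𝕜 := ℝ)
  refine h.mono' (fun z hz => ?_)
  by_contra h0
  exact hz (by simp [dz, image_eq_zero_of_notMem_tsupport h0])

theorem hasCompactSupport_dzbar (j : Fin n) {f : (Fin n → ℂ) → ℂ} (hf : HasCompactSupport f) :
    HasCompactSupport (dzbar j f) := by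
  have h := hf.fderiv (𝕜 := ℝ)
  refine h.mono' (fun z hz => ?_)
  by_contra h0
  exact hz (by simp [dzbar, image_eq_zero_of_notMem_tsupport h0])

theorem continuous_diffOp {f : (Fin n → ℂ) → ℂ} (hf : ContDiff ℝ ∞ f) :
    Continuous (diffOp f) := by
  have h1 : ∀ j, Continuous (dzbar j f) := fun j => (contDiff_dzbar j hf).continuous
  have h2 : ∀ j, Continuous (dz j (dzbar j f)) := fun j =>
    (contDiff_dz j (contDiff_dzbar j hf)).continuous
  unfold diffOp
  fun_prop

theorem hasCompactSupport_diffOp {f : (Fin n → ℂ) → ℂ} (hf : HasCompactSupport f) :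
    HasCompactSupport (diffOp f) := by
  refine hf.mono' (fun z hz => ?_)
  by_contra h0
  refine hz ?_
  have h1 : ∀ j, dzbar j f z = 0 := fun j => by
    have h := fderiv_of_notMem_tsupport (𝕜 := ℝ) h0
    simp [dzbar, h]
  have h2 : ∀ j, dz j (dzbar j f) z = 0 := fun j => by
    have h3 : z ∉ tsupport (dzbar j f) := fun h => h0 (by
      refine closure_minimal (fun w hw => ?_) (isClosed_tsupport f) h
      by_contra h4
      exact hw (by simp [dzbar, fderiv_of_notMem_tsupport (𝕜 := ℝ) h4]))
    simp [dz, fderiv_of_notMem_tsupport (𝕜 := ℝ) h3]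
  simp [diffOp, h1, h2]

theorem integral_mul_fderiv (w : Fin n → ℂ) {f g : (Fin n → ℂ) → ℂ} (hf : ContDiff ℝ ∞ f)
    (hg : ContDiff ℝ ∞ g) (hgc : HasCompactSupport g) :
    Integrable (fun z => f z * fderiv ℝ g z w) ∧ Integrable (fun z => fderiv ℝ f z w * g z) ∧
    ∫ z, f z * fderiv ℝ g z w = -∫ z, fderiv ℝ f z w * g z := by
  have hf' : Continuous (fun z => fderiv ℝ f z w) :=
    (hf.continuous_fderiv (by simp)).clm_apply continuous_const
  have hg' : Continuous (fun z => fderiv ℝ g z w) :=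
    (hg.continuous_fderiv (by simp)).clm_apply continuous_const
  have h1 : Integrable (fun z => f z * fderiv ℝ g z w) :=
    (hf.continuous.mul hg').integrable_of_hasCompactSupport
      ((hgc.fderiv_apply (𝕜 := ℝ) w).mul_left)
  have h2 : Integrable (fun z => fderiv ℝ f z w * g z) :=
    (hf'.mul hg.continuous).integrable_of_hasCompactSupport hgc.mul_left
  refine ⟨h1, h2, integral_mul_fderiv_eq_neg_fderiv_mul_of_integrable h2 h1
    ((hf.continuous.mul hg.continuous).integrable_of_hasCompactSupport hgc.mul_left)
    (fun z _ => hf.differentiable (by simp) z) (fun z _ => hg.differentiable (by simp) z)⟩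

theorem integral_mul_dz (j : Fin n) {f g : (Fin n → ℂ) → ℂ} (hf : ContDiff ℝ ∞ f)
    (hg : ContDiff ℝ ∞ g) (hgc : HasCompactSupport g) :
    ∫ z, f z * dz j g z = -∫ z, dz j f z * g z := by
  obtain ⟨a1, a2, a3⟩ := integral_mul_fderiv (Pi.single j 1) hf hg hgc
  obtain ⟨b1, b2, b3⟩ := integral_mul_fderiv (Pi.single j Complex.I) hf hg hgc
  have h1 : ∀ z, f z * dz j g z = 1 / 2 * (f z * fderiv ℝ g z (Pi.single j 1)) -
      Complex.I / 2 * (f z * fderiv ℝ g z (Pi.single j Complex.I)) := fun z => by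
    rw [dz]; ring
  have h2 : ∀ z, dz j f z * g z = 1 / 2 * (fderiv ℝ f z (Pi.single j 1) * g z) -
      Complex.I / 2 * (fderiv ℝ f z (Pi.single j Complex.I) * g z) := fun z => by
    rw [dz]; ring
  simp_rw [h1, h2]
  rw [integral_sub (a1.const_mul _) (b1.const_mul _), integral_sub (a2.const_mul _)
    (b2.const_mul _), integral_const_mul, integral_const_mul, integral_const_mul,
    integral_const_mul, a3, b3]
  ring

theorem integral_mul_dzbar (j : Fin n) {f g : (Fin n → ℂ) → ℂ} (hf : ContDiff ℝ ∞ f)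
    (hg : ContDiff ℝ ∞ g) (hgc : HasCompactSupport g) :
    ∫ z, f z * dzbar j g z = -∫ z, dzbar j f z * g z := by
  obtain ⟨a1, a2, a3⟩ := integral_mul_fderiv (Pi.single j 1) hf hg hgc
  obtain ⟨b1, b2, b3⟩ := integral_mul_fderiv (Pi.single j Complex.I) hf hg hgc
  have h1 : ∀ z, f z * dzbar j g z = 1 / 2 * (f z * fderiv ℝ g z (Pi.single j 1)) +
      Complex.I / 2 * (f z * fderiv ℝ g z (Pi.single j Complex.I)) := fun z => by
    rw [dzbar]; ring
  have h2 : ∀ z, dzbar j f z * g z = 1 / 2 * (fderiv ℝ f z (Pi.single j 1) * g z) +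
      Complex.I / 2 * (fderiv ℝ f z (Pi.single j Complex.I) * g z) := fun z => by
    rw [dzbar]; ring
  simp_rw [h1, h2]
  rw [integral_add (a1.const_mul _) (b1.const_mul _), integral_add (a2.const_mul _)
    (b2.const_mul _), integral_const_mul, integral_const_mul, integral_const_mul,
    integral_const_mul, a3, b3]
  ring

/-- The Gaussian weight `e ^ (-|z|²)`, as a complex-valued function. -/
def weight (z : Fin n → ℂ) : ℂ := ((Real.exp (-normSq z) : ℝ) : ℂ)

theorem weight_eq : (weight : (Fin n → ℂ) → ℂ) =
    fun z => Complex.exp (-∑ j, z j * (starRingEnd ℂ) (z j)) := by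
  ext z
  rw [weight, ← herm, herm_self]
  push_cast
  rfl

theorem contDiff_conj {f : (Fin n → ℂ) → ℂ} (hf : ContDiff ℝ ∞ f) :
    ContDiff ℝ ∞ (fun z => (starRingEnd ℂ) (f z)) :=
  Complex.conjCLE.contDiff.comp hf

theorem contDiff_weight : ContDiff ℝ ∞ (weight : (Fin n → ℂ) → ℂ) := by
  rw [weight_eq]
  have h : ∀ j : Fin n, ContDiff ℝ ∞ (fun z : Fin n → ℂ => (starRingEnd ℂ) (z j)) := fun j =>
    contDiff_conj (by fun_prop)
  fun_prop

theorem hasFDerivAt_weight (z : Fin n → ℂ) :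
    HasFDerivAt (𝕜 := ℝ) weight (Complex.exp (-∑ j, z j * (starRingEnd ℂ) (z j)) •
      -∑ j, (z j • (Complex.conjCLE : ℂ →L[ℝ] ℂ).comp (ContinuousLinearMap.proj j) +
        (starRingEnd ℂ) (z j) • ContinuousLinearMap.proj j)) z := by
  rw [weight_eq]
  refine HasFDerivAt.cexp (HasFDerivAt.neg (HasFDerivAt.fun_sum fun j _ => ?_))
  exact (ContinuousLinearMap.proj (R := ℝ) (φ := fun _ : Fin n => ℂ) j).hasFDerivAt.mul
    (Complex.conjCLE.hasFDerivAt.comp z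
      (ContinuousLinearMap.proj (R := ℝ) (φ := fun _ : Fin n => ℂ) j).hasFDerivAt)

theorem fderiv_weight_single (j : Fin n) (z : Fin n → ℂ) (c : ℂ) :
    fderiv ℝ weight z (Pi.single j c) =
      -(z j * (starRingEnd ℂ) c + (starRingEnd ℂ) (z j) * c) * weight z := by
  have hw : Complex.exp (-∑ j, z j * (starRingEnd ℂ) (z j)) = weight z := by rw [weight_eq]
  rw [(hasFDerivAt_weight z).fderiv, hw]
  simp only [smul_apply, neg_apply, sum_apply,
    add_apply, ContinuousLinearMap.comp_apply, ContinuousLinearMap.proj_apply,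
    ContinuousLinearEquiv.coe_coe, Complex.conjCLE_apply, smul_eq_mul]
  rw [Finset.sum_eq_single j]
  · rw [Pi.single_eq_same]
    ring
  · intro i _ hi
    simp [Pi.single_eq_of_ne hi]
  · simp

theorem dz_weight (j : Fin n) (z : Fin n → ℂ) :
    dz j weight z = -((starRingEnd ℂ) (z j) * weight z) := by
  rw [dz, fderiv_weight_single, fderiv_weight_single, map_one, Complex.conj_I]
  linear_combination ((starRingEnd ℂ) (z j) * weight z - z j * weight z) / 2 * Complex.I_sq

theorem dzbar_weight (j : Fin n) (z : Fin n → ℂ) :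
    dzbar j weight z = -(z j * weight z) := by
  rw [dzbar, fderiv_weight_single, fderiv_weight_single, map_one, Complex.conj_I]
  linear_combination (-(starRingEnd ℂ) (z j) * weight z + z j * weight z) / 2 * Complex.I_sq

/-- The differential expression is formally symmetric in the Gaussian space: both sides are the
Dirichlet form `∑ ∫ conj (∂g/∂z̄_j) ∂f/∂z̄_j e ^ (-|z|²)`. -/
theorem integral_conj_mul_diffOp {f g : (Fin n → ℂ) → ℂ} (hf : ContDiff ℝ ∞ f)
    (hfc : HasCompactSupport f) (hg : ContDiff ℝ ∞ g) :
    ∫ z, (starRingEnd ℂ) (g z) * diffOp f z ∂gaussian n =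
      ∫ z, (starRingEnd ℂ) (diffOp g z) * f z ∂gaussian n := by
  rw [integral_gaussian, integral_gaussian]
  have hdf : ∀ j, ContDiff ℝ ∞ (dzbar j f) := fun j => contDiff_dzbar j hf
  have hdg : ∀ j, ContDiff ℝ ∞ (dzbar j g) := fun j => contDiff_dzbar j hg
  have hw := contDiff_weight (n := n)
  have hdiff : ∀ {h : (Fin n → ℂ) → ℂ}, ContDiff ℝ ∞ h → Differentiable ℝ h :=
    fun h => h.differentiable (by simp)
  have hc : ∀ {h : (Fin n → ℂ) → ℂ} (g : (Fin n → ℂ) → ℂ), Continuous g → Continuous h →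
      HasCompactSupport h → Integrable (fun z => g z * h z) := fun g hg hh hc =>
    (hg.mul hh).integrable_of_hasCompactSupport hc.mul_left
  have h0 : ContDiff ℝ ∞ (fun z => (starRingEnd ℂ) (g z) * weight z) := (contDiff_conj hg).mul hw
  have h1 : ∀ j, ContDiff ℝ ∞ (fun z => (starRingEnd ℂ) (dzbar j g z) * weight z) := fun j =>
    (contDiff_conj (hdg j)).mul hw
  have eq1 : ∀ j, ∫ z, (starRingEnd ℂ) (g z) * weight z * dz j (dzbar j f) z =
      ∫ z, (starRingEnd ℂ) (g z) * weight z * ((starRingEnd ℂ) (z j) * dzbar j f z) -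
        (starRingEnd ℂ) (dzbar j g z) * weight z * dzbar j f z := by
    intro j
    rw [integral_mul_dz j h0 (hdf j) (hasCompactSupport_dzbar j hfc), ← integral_neg]
    refine integral_congr_ae (ae_of_all _ fun z => ?_)
    dsimp only
    rw [dz_mul j (hdiff (contDiff_conj hg) z) (hdiff hw z), dz_conj j (hdiff hg z), dz_weight]
    ring
  have eq2 : ∀ j, ∫ z, (starRingEnd ℂ) (dzbar j g z) * weight z * dzbar j f z =
      ∫ z, ((starRingEnd ℂ) (-dz j (dzbar j g) z + (starRingEnd ℂ) (z j) * dzbar j g z)) *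
        weight z * f z := by
    intro j
    rw [integral_mul_dzbar j (h1 j) hf hfc, ← integral_neg]
    refine integral_congr_ae (ae_of_all _ fun z => ?_)
    dsimp only
    rw [dzbar_mul j (hdiff (contDiff_conj (hdg j)) z) (hdiff hw z), dzbar_conj j (hdiff (hdg j) z),
      dzbar_weight]
    simp only [map_add, map_neg, map_mul, Complex.conj_conj]
    ring
  have hcoord : ∀ j : Fin n, Continuous fun z : Fin n → ℂ => (starRingEnd ℂ) (z j) := fun j =>
    Complex.continuous_conj.comp (continuous_apply j)
  have int1 : ∀ j, Integrable fun z => (starRingEnd ℂ) (g z) * weight z * dz j (dzbar j f) z :=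
    fun j => hc _ h0.continuous (contDiff_dz j (hdf j)).continuous
      (hasCompactSupport_dz j (hasCompactSupport_dzbar j hfc))
  have int2 : ∀ j, Integrable fun z => (starRingEnd ℂ) (g z) * weight z *
      ((starRingEnd ℂ) (z j) * dzbar j f z) := fun j =>
    hc _ h0.continuous ((hcoord j).mul (hdf j).continuous)
      (hasCompactSupport_dzbar j hfc).mul_left
  have int3 : ∀ j, Integrable fun z => (starRingEnd ℂ) (dzbar j g z) * weight z * dzbar j f z :=
    fun j => hc _ (h1 j).continuous (hdf j).continuous (hasCompactSupport_dzbar j hfc)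
  have int4 : ∀ j, Integrable fun z => ((starRingEnd ℂ) (-dz j (dzbar j g) z +
      (starRingEnd ℂ) (z j) * dzbar j g z)) * weight z * f z := fun j =>
    hc _ ((Complex.continuous_conj.comp (((contDiff_dz j (hdg j)).continuous.neg).add
      ((hcoord j).mul (hdg j).continuous))).mul hw.continuous) hf.continuous hfc
  have int5 : ∀ j, Integrable fun z => (starRingEnd ℂ) (g z) * weight z *
      ((starRingEnd ℂ) (z j) * dzbar j f z) -
        (starRingEnd ℂ) (g z) * weight z * dz j (dzbar j f) z := fun j => (int2 j).sub (int1 j)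
  have e1 : ∀ z, (starRingEnd ℂ) (g z) * diffOp f z * ((Real.exp (-normSq z) : ℝ) : ℂ) =
      ∑ j, ((starRingEnd ℂ) (g z) * weight z * ((starRingEnd ℂ) (z j) * dzbar j f z) -
        (starRingEnd ℂ) (g z) * weight z * dz j (dzbar j f) z) := fun z => by
    rw [Finset.sum_sub_distrib, ← Finset.mul_sum, ← Finset.mul_sum, diffOp, weight]
    ring
  have e2 : ∀ z, (starRingEnd ℂ) (diffOp g z) * f z * ((Real.exp (-normSq z) : ℝ) : ℂ) =
      ∑ j, ((starRingEnd ℂ) (-dz j (dzbar j g) z +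
      (starRingEnd ℂ) (z j) * dzbar j g z)) * weight z * f z := fun z => by
    rw [← Finset.sum_mul, ← Finset.sum_mul, ← map_sum, Finset.sum_add_distrib,
      Finset.sum_neg_distrib, ← diffOp, weight]
    ring
  simp_rw [e1, e2]
  rw [integral_finsetSum _ fun j _ => int5 j, integral_finsetSum _ fun j _ => int4 j]
  refine Finset.sum_congr rfl fun j _ => ?_
  rw [← eq2, integral_sub (int2 j) (int1 j), eq1, integral_sub (int2 j) (int3 j)]
  ring

theorem fderiv_eigenfunction_single (u v : Fin n → ℂ) (k : ℕ) (j : Fin n) (z : Fin n → ℂ) (c : ℂ) :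
    fderiv ℝ (eigenfunction u v k) z (Pi.single j c) =
      u j * c * eigenfunction u v k z +
        k * (v j * (starRingEnd ℂ) c) * eigenfunction u v (k - 1) z := by
  have hp : ∀ i : Fin n, HasFDerivAt (𝕜 := ℝ) (fun z : Fin n → ℂ => z i)
    (ContinuousLinearMap.proj (R := ℝ) (φ := fun _ : Fin n => ℂ) i) z := fun i =>
    (ContinuousLinearMap.proj (R := ℝ) (φ := fun _ : Fin n => ℂ) i).hasFDerivAt
  have h1 : HasFDerivAt (𝕜 := ℝ) (fun z : Fin n → ℂ => ∑ i, u i * z i)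
      (∑ i, u i • ContinuousLinearMap.proj i) z :=
    HasFDerivAt.fun_sum fun i _ => (hp i).const_mul (u i)
  have h2 : HasFDerivAt (𝕜 := ℝ) (fun z : Fin n → ℂ => ∑ i, v i * ((starRingEnd ℂ) (z i) - u i))
      (∑ i, v i • (Complex.conjCLE : ℂ →L[ℝ] ℂ).comp (ContinuousLinearMap.proj i)) z :=
    HasFDerivAt.fun_sum fun i _ =>
      ((Complex.conjCLE.hasFDerivAt.comp z (hp i)).sub_const (u i)).const_mul (v i)
  have h3 : HasFDerivAt (𝕜 := ℝ) (eigenfunction u v k) _ z := h1.cexp.mul (h2.pow k)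
  have s1 : (∑ i, u i • ContinuousLinearMap.proj (R := ℝ) (φ := fun _ : Fin n => ℂ) i)
      (Pi.single j c) = u j * c := by
    simp only [sum_apply, smul_apply, ContinuousLinearMap.proj_apply, smul_eq_mul]
    rw [Finset.sum_eq_single j]
    · rw [Pi.single_eq_same]
    · intro i _ hi
      simp [Pi.single_eq_of_ne hi]
    · simp
  have s2 : (∑ i, v i • (Complex.conjCLE : ℂ →L[ℝ] ℂ).comp
      (ContinuousLinearMap.proj (R := ℝ) (φ := fun _ : Fin n => ℂ) i))
      (Pi.single j c) = v j * (starRingEnd ℂ) c := by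
    simp only [sum_apply, smul_apply, ContinuousLinearMap.comp_apply,
      ContinuousLinearMap.proj_apply, ContinuousLinearEquiv.coe_coe, Complex.conjCLE_apply,
      smul_eq_mul]
    rw [Finset.sum_eq_single j]
    · rw [Pi.single_eq_same]
    · intro i _ hi
      simp [Pi.single_eq_of_ne hi]
    · simp
  rw [h3.fderiv]
  simp only [add_apply, smul_apply, s1, s2, smul_eq_mul, nsmul_eq_mul, eigenfunction]
  ring

theorem contDiff_eigenfunction (u v : Fin n → ℂ) (k : ℕ) :
    ContDiff ℝ ∞ (eigenfunction u v k) := by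
  have h : ∀ j : Fin n, ContDiff ℝ ∞ (fun z : Fin n → ℂ => (starRingEnd ℂ) (z j)) := fun j =>
    contDiff_conj (by fun_prop)
  unfold eigenfunction
  fun_prop

theorem dz_eigenfunction (u v : Fin n → ℂ) (k : ℕ) (j : Fin n) (z : Fin n → ℂ) :
    dz j (eigenfunction u v k) z = u j * eigenfunction u v k z := by
  rw [dz, fderiv_eigenfunction_single, fderiv_eigenfunction_single, map_one, Complex.conj_I]
  linear_combination (-u j * eigenfunction u v k z + k * v j * eigenfunction u v (k - 1) z) / 2 *
    Complex.I_sq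

theorem dzbar_eigenfunction (u v : Fin n → ℂ) (k : ℕ) (j : Fin n) (z : Fin n → ℂ) :
    dzbar j (eigenfunction u v k) z = k * v j * eigenfunction u v (k - 1) z := by
  rw [dzbar, fderiv_eigenfunction_single, fderiv_eigenfunction_single, map_one, Complex.conj_I]
  linear_combination (u j * eigenfunction u v k z - k * v j * eigenfunction u v (k - 1) z) / 2 *
    Complex.I_sq

/-- The term with `∂²/∂z_j∂z̄_j` of `diffOp` cancels the shift `z̄ ↦ z̄ - u` and leaves the Euler
operator `∑ (z̄_j - u_j) ∂/∂z̄_j`. -/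
theorem diffOp_eigenfunction (u v : Fin n → ℂ) (k : ℕ) (z : Fin n → ℂ) :
    diffOp (eigenfunction u v k) z = k * eigenfunction u v k z := by
  have h1 : ∀ j, dzbar j (eigenfunction u v k) =
      fun z => k * v j * eigenfunction u v (k - 1) z := fun j =>
    funext fun z => dzbar_eigenfunction u v k j z
  have h2 : ∀ j, dz j (dzbar j (eigenfunction u v k)) z =
      k * v j * (u j * eigenfunction u v (k - 1) z) := fun j => by
    rw [h1, dz_const_mul j _ ((contDiff_eigenfunction u v (k - 1)).differentiable (by simp) z),
      dz_eigenfunction]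
  rcases k with _ | k
  · simp [diffOp, h1, dz]
  · simp only [diffOp, h2]
    simp only [h1, ← Finset.sum_neg_distrib, ← Finset.sum_add_distrib,
      Nat.add_sub_cancel]
    have h3 : eigenfunction u v (k + 1) z =
        eigenfunction u v k z * ∑ j, v j * ((starRingEnd ℂ) (z j) - u j) := by
      rw [eigenfunction, eigenfunction, pow_succ, mul_assoc]
    rw [h3, Finset.mul_sum, Finset.mul_sum]
    exact Finset.sum_congr rfl fun j _ => by ring

end Magnetic

/-! ### Approximation of eigenfunctions by test functions -/

namespace Magnetic

open Filter Topology

variable {n : ℕ}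

/-- Dominated convergence in `L²`. -/
theorem tendsto_toLp_of_dominated {α : Type*} [MeasurableSpace α] {μ : Measure α}
    {F : ℕ → α → ℂ} {f : α → ℂ} {b : α → ℝ} (hb : MemLp b 2 μ) (hF : ∀ N, MemLp (F N) 2 μ)
    (hf : MemLp f 2 μ) (hFb : ∀ N x, ‖F N x‖ ≤ b x)
    (hlim : ∀ x, Tendsto (fun N => F N x) atTop (𝓝 (f x))) :
    Tendsto (fun N => (hF N).toLp (F N)) atTop (𝓝 (hf.toLp f)) := by
  rw [Lp.tendsto_Lp_iff_tendsto_eLpNorm'']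
  have hfb : ∀ x, ‖f x‖ ≤ b x := fun x =>
    le_of_tendsto (hlim x).norm (Eventually.of_forall fun N => hFb N x)
  have h2 : MemLp (fun x => 2 * b x) 2 μ := hb.const_mul 2
  have key : Tendsto (fun N => ∫⁻ x, ‖(F N - f) x‖ₑ ^ (2 : ENNReal).toReal ∂μ) atTop
      (𝓝 (∫⁻ _, 0 ∂μ)) := by
    refine tendsto_lintegral_of_dominated_convergence'
      (fun x => ‖2 * b x‖ₑ ^ (2 : ENNReal).toReal)
      (fun N => (((hF N).sub hf).1.enorm.pow_const _)) (fun N => ae_of_all _ fun x => ?_)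
      (lintegral_rpow_enorm_lt_top_of_eLpNorm_lt_top (by simp) (by simp) h2.2).ne
      (ae_of_all _ fun x => ?_)
    · have h3 : ‖(F N - f) x‖ₑ ≤ ‖2 * b x‖ₑ := by
        rw [enorm_le_iff_norm_le, Pi.sub_apply]
        refine (norm_sub_le _ _).trans (le_trans ?_ (le_abs_self _))
        linarith [hFb N x, hfb x]
      dsimp only
      gcongr
    · have h3 : Tendsto (fun N => ‖(F N - f) x‖ₑ) atTop (𝓝 0) := by
        have h4 := ((hlim x).sub_const (f x)).enorm
        simpa using h4
      have h5 := (ENNReal.continuous_rpow_const (y := (2 : ENNReal).toReal)).tendsto 0 |>.comp h3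
      simpa [Function.comp_def] using h5
  rw [lintegral_zero] at key
  have h6 := (ENNReal.continuous_rpow_const (y := 1 / (2 : ENNReal).toReal)).tendsto 0 |>.comp key
  refine (h6.congr fun N => ?_).trans (by simp)
  rw [eLpNorm_eq_lintegral_rpow_enorm_toReal (by simp) (by simp)]
  rfl

theorem diffOp_mul {f g : (Fin n → ℂ) → ℂ} (hf : ContDiff ℝ ∞ f) (hg : ContDiff ℝ ∞ g)
    (z : Fin n → ℂ) : diffOp (fun w => f w * g w) z = f z * diffOp g z +
      ∑ j, (-dz j (dzbar j f) z * g z + dzbar j f z * ((starRingEnd ℂ) (z j) * g z) -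
        dz j f z * dzbar j g z - dzbar j f z * dz j g z) := by
  have hdiff : ∀ {h : (Fin n → ℂ) → ℂ}, ContDiff ℝ ∞ h → Differentiable ℝ h :=
    fun h => h.differentiable (by simp)
  have h1 : ∀ j, dzbar j (fun w => f w * g w) = fun z => f z * dzbar j g z + dzbar j f z * g z :=
    fun j => funext fun z => dzbar_mul j (hdiff hf z) (hdiff hg z)
  have h2 : ∀ j, dz j (dzbar j (fun w => f w * g w)) z =
      f z * dz j (dzbar j g) z + dz j f z * dzbar j g z +
        (dzbar j f z * dz j g z + dz j (dzbar j f) z * g z) := fun j => by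
    have hbf := hdiff (contDiff_dzbar j hf)
    have hbg := hdiff (contDiff_dzbar j hg)
    rw [h1, dz_add j ((hdiff hf z).fun_mul (hbg z)) ((hbf z).fun_mul (hdiff hg z)),
      dz_mul j (hdiff hf z) (hbg z), dz_mul j (hbf z) (hdiff hg z)]
  simp only [diffOp, h2]
  simp only [h1]
  rw [← Finset.sum_neg_distrib, ← Finset.sum_neg_distrib, mul_add, Finset.mul_sum, Finset.mul_sum,
    ← Finset.sum_add_distrib, ← Finset.sum_add_distrib, ← Finset.sum_add_distrib]
  exact Finset.sum_congr rfl fun j _ => by ring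

theorem diffOp_congr {f g : (Fin n → ℂ) → ℂ} {z : Fin n → ℂ} (h : f =ᶠ[𝓝 z] g) :
    diffOp f z = diffOp g z := by
  have h1 : ∀ j, dzbar j f =ᶠ[𝓝 z] dzbar j g := fun j => by
    filter_upwards [h.fderiv (𝕜 := ℝ)] with w hw
    simp only [dzbar, hw]
  have h2 : ∀ j, dz j (dzbar j f) z = dz j (dzbar j g) z := fun j => by
    simp only [dz, (h1 j).fderiv_eq]
  simp only [diffOp, h2, (h1 _).eq_of_nhds]

/-- A smooth cutoff function, equal to `1` on the unit ball. -/
def cutoff (z : Fin n → ℂ) : ℂ :=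
  (((⟨1, 2, one_pos, one_lt_two⟩ : ContDiffBump (0 : Fin n → ℂ)) z : ℝ) : ℂ)

theorem contDiff_cutoff : ContDiff ℝ ∞ (cutoff : (Fin n → ℂ) → ℂ) :=
  Complex.ofRealCLM.contDiff.comp (ContDiffBump.contDiff _)

theorem hasCompactSupport_cutoff : HasCompactSupport (cutoff : (Fin n → ℂ) → ℂ) :=
  (ContDiffBump.hasCompactSupport _).comp_left (g := Complex.ofReal) Complex.ofReal_zero

theorem cutoff_eventuallyEq_one {z : Fin n → ℂ} (hz : ‖z‖ < 1) : cutoff =ᶠ[𝓝 z] 1 := by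
  filter_upwards [ContDiffBump.eventuallyEq_one_of_mem_ball
    (⟨1, 2, one_pos, one_lt_two⟩ : ContDiffBump (0 : Fin n → ℂ)) (x := z) (by simpa using hz)]
    with w hw
  rw [cutoff, hw]
  simp

/-- A common bound for the derivatives of the cutoff function that occur in `diffOp_mul`. -/
theorem exists_bound_cutoff : ∃ A : ℝ, 0 ≤ A ∧ ∀ z : Fin n → ℂ, ‖cutoff z‖ ≤ A ∧
    ∀ j, ‖dz j cutoff z‖ ≤ A ∧ ‖dzbar j cutoff z‖ ≤ A ∧ ‖dz j (dzbar j cutoff) z‖ ≤ A := by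
  have hs := contDiff_cutoff (n := n)
  have hc := hasCompactSupport_cutoff (n := n)
  have hb : ∀ {f : (Fin n → ℂ) → ℂ}, ContDiff ℝ ∞ f → HasCompactSupport f →
      ∃ A, ∀ z, ‖f z‖ ≤ A := fun hf hfc => hfc.exists_bound_of_continuous hf.continuous
  obtain ⟨A, hA⟩ := hb hs hc
  choose B hB using fun j => hb (contDiff_dz j hs) (hasCompactSupport_dz j hc)
  choose C hC using fun j => hb (contDiff_dzbar j hs) (hasCompactSupport_dzbar j hc)
  choose D hD using fun j => hb (contDiff_dz j (contDiff_dzbar j hs))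
    (hasCompactSupport_dz j (hasCompactSupport_dzbar j hc))
  have hsum : ∀ (F : Fin n → ℝ) (j : Fin n), F j ≤ ∑ i, |F i| := fun F j =>
    (le_abs_self _).trans (Finset.single_le_sum (f := fun i => |F i|) (fun i _ => abs_nonneg _)
      (Finset.mem_univ j))
  have hpos : ∀ F : Fin n → ℝ, 0 ≤ ∑ i, |F i| := fun F => Finset.sum_nonneg fun i _ => abs_nonneg _
  have h1 := hpos B
  have h2 := hpos C
  have h3 := hpos D
  have h4 := abs_nonneg A
  have h5 := le_abs_self A
  refine ⟨|A| + ∑ i, |B i| + ∑ i, |C i| + ∑ i, |D i|, by positivity, fun z => ⟨?_, fun j =>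
    ⟨?_, ?_, ?_⟩⟩⟩
  · linarith [hA z]
  · linarith [hB j z, hsum B j]
  · linarith [hC j z, hsum C j]
  · linarith [hD j z, hsum D j]

/-- A smooth function that has exponential growth together with its first derivatives and its image
under the differential expression belongs to the domain of the closure: multiply it by cutoff
functions `z ↦ χ (z / (N + 1))`. -/
theorem mem_topologicalClosure_minimalGraph {f : (Fin n → ℂ) → ℂ} (hf : ContDiff ℝ ∞ f)
    (h0 : HasExpGrowth f) (h1 : ∀ j, HasExpGrowth (dz j f)) (h2 : ∀ j, HasExpGrowth (dzbar j f))
    (h3 : HasExpGrowth (diffOp f)) :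
    (h0.memLp.toLp f, h3.memLp.toLp (diffOp f)) ∈ (minimalGraph n).topologicalClosure := by
  set r : ℕ → ℝ := fun N => 1 / ((N : ℝ) + 1) with hr
  have hr0 : ∀ N, 0 < r N := fun N => by positivity
  have hr1 : ∀ N, r N ≤ 1 := fun N => by
    rw [hr]
    dsimp only
    rw [div_le_one (by positivity)]
    linarith [Nat.cast_nonneg (α := ℝ) N]
  have hrlim : Tendsto r atTop (𝓝 0) := tendsto_one_div_add_atTop_nhds_zero_nat
  set ψ : ℕ → (Fin n → ℂ) → ℂ := fun N z => cutoff (r N • z) with hψ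
  have hψs : ∀ N, ContDiff ℝ ∞ (ψ N) := fun N =>
    contDiff_cutoff.comp (contDiff_const_smul (r N))
  have hψc : ∀ N, HasCompactSupport (ψ N) := fun N =>
    hasCompactSupport_cutoff.comp_smul (hr0 N).ne'
  set F : ℕ → (Fin n → ℂ) → ℂ := fun N z => ψ N z * f z with hF
  have hFs : ∀ N, ContDiff ℝ ∞ (F N) := fun N => (hψs N).mul hf
  have hFc : ∀ N, HasCompactSupport (F N) := fun N => (hψc N).mul_right
  have hcs : ∀ {g : (Fin n → ℂ) → ℂ}, Continuous g → HasCompactSupport g →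
      MemLp g 2 (gaussian n) := fun {g} hg hgc => by
    obtain ⟨C, hC⟩ := hgc.exists_bound_of_continuous hg
    exact HasExpGrowth.memLp ⟨hg, C, 0, fun z => by simpa using hC z⟩
  have hFm : ∀ N, MemLp (F N) 2 (gaussian n) := fun N => hcs (hFs N).continuous (hFc N)
  have hDm : ∀ N, MemLp (diffOp (F N)) 2 (gaussian n) := fun N =>
    hcs (continuous_diffOp (hFs N)) (hasCompactSupport_diffOp (hFc N))
  have hev : ∀ z, ∀ᶠ N in atTop, F N =ᶠ[𝓝 z] f := fun z => by
    have h5 : Tendsto (fun N => ‖r N • z‖) atTop (𝓝 0) := by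
      have := (hrlim.smul_const z).norm
      simpa using this
    filter_upwards [h5.eventually (gt_mem_nhds one_pos)] with N hN
    have h6 : Tendsto (fun w : Fin n → ℂ => r N • w) (𝓝 z) (𝓝 (r N • z)) :=
      (continuous_const_smul (r N)).tendsto z
    filter_upwards [h6.eventually (cutoff_eventuallyEq_one hN)] with w hw
    simp only [hF, hψ, hw, Pi.one_apply, one_mul]
  -- since `r N ≤ 1`, the derivatives of the cutoff functions are bounded by a constant `A` which
  -- does not depend on `N`
  obtain ⟨A, hA0, hA⟩ := exists_bound_cutoff (n := n)
  have lim1 : Tendsto (fun N => (hFm N).toLp (F N)) atTop (𝓝 (h0.memLp.toLp f)) := by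
    refine tendsto_toLp_of_dominated (b := fun z => A * ‖f z‖) (h0.memLp.norm.const_mul A) hFm _
      (fun N z => ?_) fun z => ?_
    · rw [norm_mul]
      exact mul_le_mul_of_nonneg_right (hA _).1 (norm_nonneg _)
    · refine tendsto_const_nhds.congr' ?_
      filter_upwards [hev z] with N hN
      exact hN.eq_of_nhds.symm
  have lim2 : Tendsto (fun N => (hDm N).toLp (diffOp (F N))) atTop
      (𝓝 (h3.memLp.toLp (diffOp f))) := by
    have hb : MemLp (fun z => A * ‖diffOp f z‖ + ∑ j, A * (‖f z‖ +
        ‖(starRingEnd ℂ) (z j) * f z‖ + ‖dzbar j f z‖ + ‖dz j f z‖)) 2 (gaussian n) :=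
      (h3.memLp.norm.const_mul A).add <| memLp_finsetSum _ fun j _ =>
        ((((h0.memLp.norm).add (((HasExpGrowth.coord j).conj.mul h0).memLp.norm)).add
          (h2 j).memLp.norm).add (h1 j).memLp.norm).const_mul A
    refine tendsto_toLp_of_dominated hb hDm _ (fun N z => ?_) fun z => ?_
    · have e1 : ∀ j, dz j (ψ N) z = r N * dz j cutoff (r N • z) := fun j =>
        dz_comp_smul j _ _ _
      have e2 : ∀ j, dzbar j (ψ N) = fun z => r N * dzbar j cutoff (r N • z) := fun j =>
        funext fun z => dzbar_comp_smul j _ _ _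
      have e3 : ∀ j, dz j (dzbar j (ψ N)) z =
          r N * (r N * dz j (dzbar j cutoff) (r N • z)) := fun j => by
        have hd : DifferentiableAt ℝ (fun z => dzbar j cutoff (r N • z)) z :=
          ((contDiff_dzbar j contDiff_cutoff).comp
            (contDiff_const_smul (r N))).differentiable (by simp) z
        rw [e2, dz_const_mul j _ hd, dz_comp_smul]
      have hrb : ∀ c : ℂ, ‖c‖ ≤ A → ‖(r N : ℂ) * c‖ ≤ A := fun c hc => by
        rw [norm_mul, Complex.norm_real, Real.norm_of_nonneg (hr0 N).le]
        exact (mul_le_of_le_one_left (norm_nonneg _) (hr1 N)).trans hc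
      rw [diffOp_mul (hψs N) hf]
      refine (norm_add_le _ _).trans (add_le_add ?_ ((norm_sum_le _ _).trans
        (Finset.sum_le_sum fun j _ => ?_)))
      · rw [norm_mul]
        exact mul_le_mul_of_nonneg_right (hA _).1 (norm_nonneg _)
      · obtain ⟨b1, b2, b3⟩ := (hA (r N • z)).2 j
        have c1 := hrb _ b1
        have c2 := hrb _ b2
        have c3 := hrb _ (hrb _ b3)
        rw [← e1] at c1
        rw [← e3] at c3
        have c2' : ‖dzbar j (ψ N) z‖ ≤ A := by rw [e2]; exact c2
        refine (norm_sub_le _ _).trans ((add_le_add ((norm_sub_le _ _).trans (add_le_add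
          (norm_add_le _ _) le_rfl)) le_rfl).trans ?_)
        rw [norm_mul, norm_mul, norm_mul (dz j (ψ N) z), norm_mul _ (dz j f z), norm_neg,
          mul_add, mul_add, mul_add]
        gcongr
    · refine tendsto_const_nhds.congr' ?_
      filter_upwards [hev z] with N hN
      exact (diffOp_congr hN).symm
  refine mem_closure_of_tendsto (lim1.prodMk_nhds lim2) (Eventually.of_forall fun N => ?_)
  exact ⟨F N, hFs N, hFc N, (hFm N).coeFn_toLp, (hDm N).coeFn_toLp⟩

/-- The class of `eigenfunction u v k` in the Gaussian space. -/
def eigenvector (u v : Fin n → ℂ) (k : ℕ) : L2 n :=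
  (hasExpGrowth_eigenfunction u v k).memLp.toLp (eigenfunction u v k)

theorem coeFn_eigenvector (u v : Fin n → ℂ) (k : ℕ) :
    eigenvector u v k =ᵐ[gaussian n] eigenfunction u v k :=
  MemLp.coeFn_toLp _

theorem eigenvector_mem_closure (u v : Fin n → ℂ) (k : ℕ) :
    (eigenvector u v k, (k : ℂ) • eigenvector u v k) ∈ (minimalGraph n).topologicalClosure := by
  have hE := hasExpGrowth_eigenfunction u v k
  have h3 : diffOp (eigenfunction u v k) = fun z => k * eigenfunction u v k z :=
    funext fun z => diffOp_eigenfunction u v k z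
  have h3' : HasExpGrowth (diffOp (eigenfunction u v k)) := by
    rw [h3]
    exact (HasExpGrowth.const _).mul hE
  have h1 : ∀ j, HasExpGrowth (dz j (eigenfunction u v k)) := fun j => by
    have e : dz j (eigenfunction u v k) = fun z => u j * eigenfunction u v k z :=
      funext fun z => dz_eigenfunction u v k j z
    rw [e]
    exact (HasExpGrowth.const _).mul hE
  have h2 : ∀ j, HasExpGrowth (dzbar j (eigenfunction u v k)) := fun j => by
    have e : dzbar j (eigenfunction u v k) = fun z => k * v j * eigenfunction u v (k - 1) z :=
      funext fun z => dzbar_eigenfunction u v k j z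
    rw [e]
    exact (HasExpGrowth.const _).mul (hasExpGrowth_eigenfunction u v _)
  have hs : (k : ℂ) • eigenvector u v k = h3'.memLp.toLp (diffOp (eigenfunction u v k)) := by
    ext1
    refine (Lp.coeFn_smul (k : ℂ) (eigenvector u v k)).trans
      (EventuallyEq.trans ?_ (MemLp.coeFn_toLp _).symm)
    filter_upwards [coeFn_eigenvector u v k] with z hz
    rw [Pi.smul_apply, hz, h3, smul_eq_mul]
  rw [hs]
  exact mem_topologicalClosure_minimalGraph (contDiff_eigenfunction u v k) hE h1 h2 h3'

/-- Weak form of the eigenvalue equation, valid on the closure of the minimal graph. -/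
theorem inner_eigenvector_snd (u v : Fin n → ℂ) (k : ℕ) {p : L2 n × L2 n}
    (hp : p ∈ (minimalGraph n).topologicalClosure) :
    inner ℂ (eigenvector u v k) p.2 = k * inner ℂ (eigenvector u v k) p.1 := by
  have hcl : IsClosed {p : L2 n × L2 n |
      inner ℂ (eigenvector u v k) p.2 = k * inner ℂ (eigenvector u v k) p.1} :=
    isClosed_eq (by fun_prop) (by fun_prop)
  refine closure_minimal ?_ hcl hp
  rintro ⟨x, y⟩ ⟨f, hf, hfc, hx, hy⟩
  dsimp only at hx hy
  simp only [Set.mem_ofPred_eq, L2.inner_def]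
  have e1 : ∫ z, inner ℂ (eigenvector u v k z) (y z) ∂gaussian n =
      ∫ z, (starRingEnd ℂ) (eigenfunction u v k z) * diffOp f z ∂gaussian n := by
    refine integral_congr_ae ?_
    filter_upwards [coeFn_eigenvector u v k, hy] with z h1 h2
    rw [h1, h2, RCLike.inner_apply, mul_comm]
  have e2 : ∫ z, inner ℂ (eigenvector u v k z) (x z) ∂gaussian n =
      ∫ z, (starRingEnd ℂ) (eigenfunction u v k z) * f z ∂gaussian n := by
    refine integral_congr_ae ?_
    filter_upwards [coeFn_eigenvector u v k, hx] with z h1 h2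
    rw [h1, h2, RCLike.inner_apply, mul_comm]
  rw [e1, e2, integral_conj_mul_diffOp hf hfc (contDiff_eigenfunction u v k),
    ← integral_const_mul]
  refine integral_congr_ae (ae_of_all _ fun z => ?_)
  dsimp only
  rw [diffOp_eigenfunction, map_mul, Complex.conj_natCast, mul_assoc]

end Magnetic

/-! ### Completeness of the eigenfunctions -/

namespace Magnetic

open Filter Topology

section Characters

variable {E : Type*} [NormedAddCommGroup E] [NormedSpace ℝ E] [MeasurableSpace E] [BorelSpace E]
  [SecondCountableTopology E] [CompleteSpace E] {μ : Measure E}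

/-- The positive and the negative part of `g` are densities of finite measures with the same
characteristic function. -/
theorem ae_eq_zero_of_forall_integral_char_real {g : E → ℝ} (hg : Integrable g μ)
    (h : ∀ L : StrongDual ℝ E, ∫ x, (g x : ℂ) * Complex.exp (L x * Complex.I) ∂μ = 0) :
    g =ᵐ[μ] 0 := by
  have f1 : IsFiniteMeasure (μ.withDensity fun x => ENNReal.ofReal (g x)) :=
    isFiniteMeasure_withDensity_ofReal hg.2
  have f2 : IsFiniteMeasure (μ.withDensity fun x => ENNReal.ofReal (-g x)) :=
    isFiniteMeasure_withDensity_ofReal hg.neg.2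
  have m1 : AEMeasurable (fun x => ENNReal.ofReal (g x)) μ := hg.1.aemeasurable.ennreal_ofReal
  have m2 : AEMeasurable (fun x => ENNReal.ofReal (-g x)) μ := hg.1.aemeasurable.neg.ennreal_ofReal
  have hE : ∀ (L : StrongDual ℝ E) {k : E → ℝ}, Integrable k μ →
      Integrable (fun x => (k x : ℂ) * Complex.exp (L x * Complex.I)) μ := fun L k hk => by
    refine hk.ofReal.mul_bdd (c := 1) (by fun_prop) (ae_of_all _ fun x => ?_)
    rw [Complex.norm_exp_ofReal_mul_I]
  have hc : (μ.withDensity fun x => ENNReal.ofReal (g x)) =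
      μ.withDensity fun x => ENNReal.ofReal (-g x) := by
    refine Measure.ext_of_charFunDual (funext fun L => ?_)
    rw [charFunDual_apply, charFunDual_apply,
      integral_withDensity_eq_integral_toReal_smul₀ m1 (ae_of_all _ fun _ => ENNReal.ofReal_lt_top),
      integral_withDensity_eq_integral_toReal_smul₀ m2 (ae_of_all _ fun _ => ENNReal.ofReal_lt_top)]
    simp only [ENNReal.toReal_ofReal', Complex.real_smul]
    rw [← sub_eq_zero, ← integral_sub (hE L hg.pos_part) (hE L hg.neg_part), ← h L]
    refine integral_congr_ae (ae_of_all _ fun x => ?_)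
    dsimp only
    rw [← sub_mul, ← Complex.ofReal_sub, max_zero_sub_max_neg_zero_eq_self]
  have hae := (withDensity_eq_iff m1 m2 (by
    have := measure_lt_top (μ.withDensity fun x => ENNReal.ofReal (g x)) Set.univ
    rw [withDensity_apply _ MeasurableSet.univ, setLIntegral_univ] at this
    exact this.ne)).1 hc
  filter_upwards [hae] with x hx
  have hx2 := congrArg ENNReal.toReal hx
  rw [ENNReal.toReal_ofReal', ENNReal.toReal_ofReal', ← sub_eq_zero,
    max_zero_sub_max_neg_zero_eq_self] at hx2
  exact hx2

/-- An integrable function whose integral against every character vanishes is zero. -/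
theorem ae_eq_zero_of_forall_integral_char {f : E → ℂ} (hf : Integrable f μ)
    (h : ∀ L : StrongDual ℝ E, ∫ x, f x * Complex.exp (L x * Complex.I) ∂μ = 0) :
    f =ᵐ[μ] 0 := by
  have key : ∀ c : ℂ, (fun x => (c * f x).re) =ᵐ[μ] 0 := fun c => by
    refine ae_eq_zero_of_forall_integral_char_real (hf.const_mul c).re fun L => ?_
    have hi : ∀ L : StrongDual ℝ E,
        Integrable (fun x => f x * Complex.exp (L x * Complex.I)) μ := fun L => by
      refine hf.mul_bdd (c := 1) (by fun_prop) (ae_of_all _ fun x => ?_)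
      rw [Complex.norm_exp_ofReal_mul_I]
    have e : ∀ x, (((c * f x).re : ℝ) : ℂ) * Complex.exp (L x * Complex.I) =
        c / 2 * (f x * Complex.exp (L x * Complex.I)) + (starRingEnd ℂ) c / 2 *
          (starRingEnd ℂ) (f x * Complex.exp ((-L) x * Complex.I)) := fun x => by
      rw [Complex.re_eq_add_conj, map_mul, map_mul, ← Complex.exp_conj, map_mul,
        Complex.conj_I, Complex.conj_ofReal, neg_apply, Complex.ofReal_neg, neg_mul_neg]
      ring
    have hi' : Integrable (fun x => (starRingEnd ℂ)
        (f x * Complex.exp ((-L) x * Complex.I))) μ :=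
      Complex.conjCLE.toContinuousLinearMap.integrable_comp (hi (-L))
    simp_rw [e]
    rw [integral_add ((hi L).const_mul _) (hi'.const_mul _),
      integral_const_mul, integral_const_mul, h L, integral_conj, h (-L)]
    simp
  filter_upwards [key 1, key (-Complex.I)] with x h1 h2
  exact Complex.ext (by simpa using h1) (by simpa using h2)

end Characters

variable {n : ℕ}

instance isFiniteMeasure_gaussian : IsFiniteMeasure (gaussian n) := by
  have h := (HasExpGrowth.const (n := n) 1).integrable_gaussian
  rw [integrable_const_iff_isFiniteMeasure one_ne_zero] at h
  exact h

/-- The exponential series `∑ eigenfunction u v k / k!` converges in the Gaussian space. -/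
theorem tendsto_sum_eigenvector (u v : Fin n → ℂ) :
    ∃ F : L2 n, (F =ᵐ[gaussian n] fun z => Complex.exp (∑ j, u j * z j) *
      Complex.exp (∑ j, v j * ((starRingEnd ℂ) (z j) - u j))) ∧
    Tendsto (fun N => ∑ k ∈ Finset.range N, (1 / (k.factorial : ℂ)) • eigenvector u v k) atTop
      (𝓝 F) := by
  set X : (Fin n → ℂ) → ℂ := fun z => ∑ j, v j * ((starRingEnd ℂ) (z j) - u j) with hX
  set A : (Fin n → ℂ) → ℂ := fun z => ∑ j, u j * z j with hA
  set S : ℕ → (Fin n → ℂ) → ℂ := fun N z =>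
    ∑ k ∈ Finset.range N, 1 / (k.factorial : ℂ) * eigenfunction u v k z with hS
  set f : (Fin n → ℂ) → ℂ := fun z => Complex.exp (A z) * Complex.exp (X z) with hf
  have hSm : ∀ N, MemLp (S N) 2 (gaussian n) := fun N =>
    (HasExpGrowth.sum _ fun k => (HasExpGrowth.const _).mul
      (hasExpGrowth_eigenfunction u v k)).memLp
  have hfe : ∀ z, f z = Complex.exp (-∑ j, v j * u j) * (Complex.exp (∑ j, u j * z j) *
      Complex.exp (∑ j, v j * (starRingEnd ℂ) (z j))) := fun z => by
    simp only [hf, hA, hX, mul_sub, Finset.sum_sub_distrib, Complex.exp_sub, Complex.exp_neg]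
    ring
  have hfm : MemLp f 2 (gaussian n) := by
    rw [funext hfe]
    exact ((HasExpGrowth.const _).mul
      ((HasExpGrowth.cexp_linear u).mul (HasExpGrowth.cexp_conj_linear v))).memLp
  set b : (Fin n → ℂ) → ℂ := fun z =>
    ((Real.exp (‖v‖ * n * ‖u‖ + (‖u‖ + ‖v‖) * ∑ j, ‖z j‖) : ℝ) : ℂ) with hb
  have hbm : MemLp b 2 (gaussian n) := by
    refine HasExpGrowth.memLp ⟨by fun_prop, Real.exp (‖v‖ * n * ‖u‖), ‖u‖ + ‖v‖, fun z => ?_⟩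
    rw [hb, Complex.norm_real, Real.norm_of_nonneg (Real.exp_pos _).le, Real.exp_add]
  have hAb : ∀ z, ‖A z‖ ≤ ‖u‖ * ∑ j, ‖z j‖ := fun z => by
    rw [Finset.mul_sum]
    refine (norm_sum_le _ _).trans (Finset.sum_le_sum fun j _ => ?_)
    rw [norm_mul]
    have := norm_le_pi_norm u j
    gcongr
  have hXb : ∀ z, ‖X z‖ ≤ ‖v‖ * n * ‖u‖ + ‖v‖ * ∑ j, ‖z j‖ := fun z => by
    have h1 : ‖v‖ * n * ‖u‖ + ‖v‖ * ∑ j, ‖z j‖ = ∑ j, ‖v‖ * (‖z j‖ + ‖u‖) := by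
      rw [← Finset.mul_sum, Finset.sum_add_distrib]
      simp
      ring
    rw [h1]
    refine (norm_sum_le _ _).trans (Finset.sum_le_sum fun j _ => ?_)
    rw [norm_mul]
    have h2 := norm_le_pi_norm v j
    have h3 := norm_le_pi_norm u j
    have h4 := norm_sub_le ((starRingEnd ℂ) (z j)) (u j)
    rw [RCLike.norm_conj] at h4
    gcongr
    exact h4.trans (by gcongr)
  have hSX : ∀ N z, S N z = Complex.exp (A z) *
      ∑ k ∈ Finset.range N, X z ^ k / (k.factorial : ℂ) := fun N z => by
    rw [Finset.mul_sum]
    exact Finset.sum_congr rfl fun k _ => by rw [eigenfunction]; ring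
  have lim := tendsto_toLp_of_dominated hbm.norm hSm hfm (fun N z => ?_) fun z => ?_
  · refine ⟨hfm.toLp f, hfm.coeFn_toLp, lim.congr fun N => ?_⟩
    ext1
    refine (hSm N).coeFn_toLp.trans (EventuallyEq.trans ?_ (Lp.coeFn_finsetSum _ _).symm)
    have h1 : ∀ᵐ z ∂gaussian n, ∀ k, ((1 / (k.factorial : ℂ)) • eigenvector u v k : L2 n) z =
        1 / (k.factorial : ℂ) * eigenfunction u v k z := by
      rw [ae_all_iff]
      intro k
      filter_upwards [Lp.coeFn_smul (1 / (k.factorial : ℂ)) (eigenvector u v k),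
        coeFn_eigenvector u v k] with z h1 h2
      rw [h1, Pi.smul_apply, h2, smul_eq_mul]
    filter_upwards [h1] with z hz
    rw [Finset.sum_apply]
    exact Finset.sum_congr rfl fun k _ => (hz k).symm
  · rw [hSX, norm_mul, hb, Complex.norm_real, Real.norm_of_nonneg (Real.exp_pos _).le]
    have h1 : ‖∑ k ∈ Finset.range N, X z ^ k / (k.factorial : ℂ)‖ ≤ Real.exp ‖X z‖ := by
      refine (norm_sum_le _ _).trans (le_trans (le_of_eq ?_)
        (Real.sum_le_exp_of_nonneg (norm_nonneg (X z)) N))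
      exact Finset.sum_congr rfl fun k _ => by simp
    have h2 : Real.exp (‖v‖ * n * ‖u‖ + (‖u‖ + ‖v‖) * ∑ j, ‖z j‖) =
        Real.exp (‖u‖ * ∑ j, ‖z j‖) * Real.exp (‖v‖ * n * ‖u‖ + ‖v‖ * ∑ j, ‖z j‖) := by
      rw [← Real.exp_add]
      ring_nf
    rw [h2]
    have h3 := (Complex.norm_exp_le_exp_norm (A z)).trans (Real.exp_le_exp.2 (hAb z))
    have h4 := h1.trans (Real.exp_le_exp.2 (hXb z))
    gcongr
  · simp only [hSX]
    refine Tendsto.const_mul _ ?_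
    have := (NormedSpace.expSeries_div_hasSum_exp (X z)).tendsto_sum_nat
    rwa [← Complex.exp_eq_exp_ℂ] at this

/-- The Wirtinger form of a real linear functional on `ℂⁿ`. -/
theorem exists_strongDual_apply_eq (L : StrongDual ℝ (Fin n → ℂ)) : ∃ a : Fin n → ℂ, ∀ z : Fin n → ℂ,
    (L z : ℂ) = ∑ j, (a j * z j + (starRingEnd ℂ) (a j) * (starRingEnd ℂ) (z j)) := by
  refine ⟨fun j => (L (Pi.single j 1) - Complex.I * L (Pi.single j Complex.I)) / 2, fun z => ?_⟩
  have h1 : z = ∑ j, ((z j).re • (Pi.single j 1 : Fin n → ℂ) +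
      (z j).im • (Pi.single j Complex.I : Fin n → ℂ)) := by
    ext i
    rw [Finset.sum_apply, Finset.sum_eq_single i]
    · simp [Complex.re_add_im]
    · intro j _ hj
      simp [Pi.single_eq_of_ne hj.symm]
    · simp
  conv_lhs => rw [h1]
  rw [map_sum, Complex.ofReal_sum]
  refine Finset.sum_congr rfl fun j _ => ?_
  simp only [map_add, map_smul, smul_eq_mul, map_div₀, map_sub, map_mul, Complex.conj_ofReal,
    Complex.conj_I, map_ofNat]
  conv_rhs => rw [← Complex.re_add_im (z j)]
  simp only [map_add, map_mul, Complex.conj_ofReal, Complex.conj_I]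
  push_cast
  linear_combination (((z j).im : ℂ) * L (Pi.single j Complex.I)) * Complex.I_sq

/-- The eigenfunctions are total: their exponential series produce, with `v = -conj u`, all
characters of `ℂⁿ`. -/
theorem eq_zero_of_forall_inner_eigenvector {x : L2 n}
    (hx : ∀ u v k, inner ℂ (eigenvector u v k) x = 0) : x = 0 := by
  have hxi : Integrable x (gaussian n) := (Lp.memLp x).integrable (by norm_num)
  rw [Lp.eq_zero_iff_ae_eq_zero]
  refine ae_eq_zero_of_forall_integral_char hxi fun L => ?_
  obtain ⟨a, ha⟩ := exists_strongDual_apply_eq L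
  -- this choice makes `u·z + v·z̄` equal to `-i L z`
  set u : Fin n → ℂ := fun j => -Complex.I * a j with hu
  set v : Fin n → ℂ := fun j => -Complex.I * (starRingEnd ℂ) (a j) with hv
  obtain ⟨F, hF, hlim⟩ := tendsto_sum_eigenvector u v
  have h0 : inner ℂ F x = 0 := by
    refine tendsto_nhds_unique (hlim.inner tendsto_const_nhds) ?_
    refine tendsto_const_nhds.congr fun N => ?_
    simp [sum_inner, inner_smul_left, hx]
  set c : ℂ := Complex.exp (-∑ j, v j * u j) with hc
  have e : ∀ z : Fin n → ℂ, (starRingEnd ℂ) (Complex.exp (∑ j, u j * z j) *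
      Complex.exp (∑ j, v j * ((starRingEnd ℂ) (z j) - u j))) =
      (starRingEnd ℂ) c * Complex.exp (L z * Complex.I) := fun z => by
    have h1 : (L z * Complex.I : ℂ) = (starRingEnd ℂ) (L z * -Complex.I) := by simp
    rw [h1, Complex.exp_conj, ← map_mul, hc, ← Complex.exp_add, ← Complex.exp_add, ha]
    congr 2
    rw [Finset.sum_mul, ← Finset.sum_neg_distrib, ← Finset.sum_add_distrib,
      ← Finset.sum_add_distrib]
    exact Finset.sum_congr rfl fun j _ => by simp only [hu, hv]; ring
  rw [L2.inner_def] at h0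
  have h2 : ∫ z, inner ℂ (F z) (x z) ∂gaussian n =
      (starRingEnd ℂ) c * ∫ z, x z * Complex.exp (L z * Complex.I) ∂gaussian n := by
    rw [← integral_const_mul]
    refine integral_congr_ae ?_
    filter_upwards [hF] with z hz
    rw [hz, RCLike.inner_apply, e]
    ring
  rw [h2] at h0
  exact (mul_eq_zero.1 h0).resolve_left (by simp [hc])

/-! ### Diagonalization of the magnetic Laplacian -/

/-- The closed span of the eigenfunctions with eigenvalue `k`. -/
def eigenspace (n k : ℕ) : Submodule ℂ (L2 n) :=
  (Submodule.span ℂ (Set.range fun p : (Fin n → ℂ) × (Fin n → ℂ) =>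
    eigenvector p.1 p.2 k)).topologicalClosure

theorem eigenvector_mem_eigenspace (u v : Fin n → ℂ) (k : ℕ) :
    eigenvector u v k ∈ eigenspace n k :=
  Submodule.le_topologicalClosure _ (Submodule.subset_span ⟨(u, v), rfl⟩)

instance completeSpace_eigenspace (k : ℕ) : CompleteSpace (eigenspace n k) :=
  (Submodule.isClosed_topologicalClosure _).completeSpace_coe

theorem eigenspace_le {k : ℕ} {S : Submodule ℂ (L2 n)} (hS : IsClosed (S : Set (L2 n)))
    (h : ∀ u v, eigenvector u v k ∈ S) : eigenspace n k ≤ S := by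
  refine Submodule.topologicalClosure_minimal _ (Submodule.span_le.2 ?_) hS
  rintro - ⟨q, rfl⟩
  exact h _ _

theorem mk_smul_mem_closure {k : ℕ} {x : L2 n} (hx : x ∈ eigenspace n k) :
    (x, (k : ℂ) • x) ∈ (minimalGraph n).topologicalClosure := by
  have hc : Continuous fun x : L2 n => (x, (k : ℂ) • x) := by fun_prop
  have hS : IsClosed (((minimalGraph n).topologicalClosure.comap
      (LinearMap.id.prod ((k : ℂ) • LinearMap.id)) : Submodule ℂ (L2 n)) : Set (L2 n)) :=
    (Submodule.isClosed_topologicalClosure (minimalGraph n)).preimage hc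
  exact eigenspace_le hS (fun u v => eigenvector_mem_closure u v k) hx

/-- The weak eigenvalue equation, extended from the eigenfunctions to their closed span. -/
theorem inner_snd_eq {k : ℕ} {x : L2 n} (hx : x ∈ eigenspace n k) {p : L2 n × L2 n}
    (hp : p ∈ (minimalGraph n).topologicalClosure) :
    inner ℂ x p.2 = k * inner ℂ x p.1 := by
  have h : ∀ x : L2 n, inner ℂ x p.2 = k * inner ℂ x p.1 ↔
      x ∈ (Submodule.span ℂ {p.2 - (k : ℂ) • p.1})ᗮ := fun x => by
    rw [Submodule.mem_orthogonal_singleton_iff_inner_left, inner_sub_right, inner_smul_right,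
      sub_eq_zero]
  exact (h x).2 (eigenspace_le (Submodule.isClosed_orthogonal _)
    (fun u v => (h _).1 (inner_eigenvector_snd u v k hp)) hx)

/-- The eigenspaces are orthogonal by the symmetry of the operator, and total because the
eigenfunctions are. -/
theorem isHilbertSum_eigenspace (n : ℕ) :
    IsHilbertSum ℂ (fun k => eigenspace n k) fun k => (eigenspace n k).subtypeₗᵢ := by
  refine IsHilbertSum.mkInternal _ (fun k l hkl x y => ?_) (top_le_iff.2 ?_)
  · have h := inner_snd_eq x.2 (mk_smul_mem_closure y.2)
    dsimp only at h
    rw [inner_smul_right, ← sub_eq_zero, ← sub_mul, mul_eq_zero, sub_eq_zero] at h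
    exact h.resolve_left fun h => hkl (Nat.cast_injective h).symm
  · rw [Submodule.topologicalClosure_eq_top_iff, Submodule.eq_bot_iff]
    intro x hx
    refine eq_zero_of_forall_inner_eigenvector fun u v k => ?_
    exact Submodule.inner_right_of_mem_orthogonal
      (Submodule.mem_iSup_of_mem k (eigenvector_mem_eigenspace u v k)) hx

/-- The decomposition of the Gaussian space along the eigenspaces. -/
def eigenEquiv (n : ℕ) : L2 n ≃ₗᵢ[ℂ] lp (fun k => eigenspace n k) 2 :=
  (isHilbertSum_eigenspace n).linearIsometryEquiv

theorem eigenEquiv_coe {k : ℕ} (x : eigenspace n k) :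
    eigenEquiv n (x : L2 n) = lp.single 2 k x := by
  rw [← LinearIsometryEquiv.eq_symm_apply]
  exact ((isHilbertSum_eigenspace n).linearIsometryEquiv_symm_apply_single x).symm

theorem inner_coord {k : ℕ} (x : eigenspace n k) (y : L2 n) :
    inner ℂ x (eigenEquiv n y k) = inner ℂ (x : L2 n) y := by
  rw [← (eigenEquiv n).inner_map_map, eigenEquiv_coe, lp.inner_single_left]

theorem hasSum_coord (x : L2 n) :
    HasSum (fun k => ((eigenEquiv n x k : eigenspace n k) : L2 n)) x := by
  have h := (lp.hasSum_single (p := 2) (by simp) (eigenEquiv n x)).mapL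
    ((eigenEquiv n).symm.toContinuousLinearEquiv : _ →L[ℂ] L2 n)
  simp only [← eigenEquiv_coe] at h
  simpa using h

/-- The closure of the minimal graph is the maximal diagonal operator. -/
theorem mem_closure_minimalGraph_iff (x y : L2 n) :
    (x, y) ∈ (minimalGraph n).topologicalClosure ↔
      ∀ k : ℕ, eigenEquiv n y k = (k : ℂ) • eigenEquiv n x k := by
  constructor
  · intro h k
    refine ext_inner_left ℂ fun v => ?_
    have h1 := inner_smul_right (𝕜 := ℂ) v (eigenEquiv n x k : eigenspace n k) (k : ℂ)
    rw [inner_coord] at h1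
    exact ((inner_coord v y).trans (inner_snd_eq v.2 h)).trans h1.symm
  · intro h
    refine (Submodule.isClosed_topologicalClosure _).mem_of_tendsto
      ((hasSum_coord x).prodMk (hasSum_coord y)) (Eventually.of_forall fun s => ?_)
    refine Submodule.sum_mem _ fun k _ => ?_
    rw [h k]
    exact mk_smul_mem_closure (eigenEquiv n x k).2

theorem mem_graph_magneticLaplacian_iff (x y : L2 n) :
    (x, y) ∈ (magneticLaplacian n).graph ↔
      ∀ k : ℕ, eigenEquiv n y k = (k : ℂ) • eigenEquiv n x k := by
  have h0 : ∀ p ∈ (minimalGraph n).topologicalClosure, p.1 = 0 → p.2 = 0 := by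
    rintro ⟨x, y⟩ h (rfl : x = 0)
    refine SpectralCalculus.ext_coord (eigenEquiv n) fun k => ?_
    rw [(mem_closure_minimalGraph_iff _ _).1 h k]
    simp
  -- `Submodule.toLinearPMap` and `LinearPMap.closure` have junk values unless `minimalGraph n` and
  -- its closure are graphs
  have h1 : (minimalGraph n).toLinearPMap.graph = minimalGraph n :=
    Submodule.toLinearPMap_graph_eq _ fun p hp => h0 p (Submodule.le_topologicalClosure _ hp)
  have h2 : (minimalGraph n).toLinearPMap.IsClosable :=
    ⟨(minimalGraph n).topologicalClosure.toLinearPMap, by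
      rw [h1, Submodule.toLinearPMap_graph_eq _ h0]⟩
  rw [magneticLaplacian, ← h2.graph_closure_eq_closure_graph, h1, mem_closure_minimalGraph_iff]

end Magnetic

/-! ### The deformed Berezin transform as a diagonal operator -/

namespace Magnetic

open Filter Topology

variable {n : ℕ}

/-- In the second variable the kernel grows at most like `e ^ ⟨z, w⟩`, because `L_m ^ 2` is a
polynomial and the Gaussian factor is bounded. -/
theorem hasExpGrowth_deformedKernel (n m : ℕ) (z : Fin n → ℂ) :
    HasExpGrowth (deformedKernel n m z) := by
  have h1 : HasExpGrowth fun w : Fin n → ℂ => Complex.exp (herm z w) :=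
    HasExpGrowth.cexp_conj_linear z
  have hsub : ∀ j, HasExpGrowth fun w : Fin n → ℂ => z j + -1 * w j := fun j =>
    (HasExpGrowth.const _).add ((HasExpGrowth.const _).mul (HasExpGrowth.coord j))
  have h2 : HasExpGrowth fun w : Fin n → ℂ => ((normSq (z - w) : ℝ) : ℂ) := by
    have e : (fun w : Fin n → ℂ => ((normSq (z - w) : ℝ) : ℂ)) = fun w =>
        ∑ j, (z j + -1 * w j) * (starRingEnd ℂ) (z j + -1 * w j) := by
      ext w
      rw [← herm_self, herm]
      exact Finset.sum_congr rfl fun j _ => by rw [neg_one_mul, ← sub_eq_add_neg]; rfl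
    rw [e]
    exact HasExpGrowth.sum _ fun j => (hsub j).mul (hsub j).conj
  have h3 : HasExpGrowth fun w : Fin n → ℂ =>
      (((laguerre m (n - 1) (normSq (z - w))) ^ 2 : ℝ) : ℂ) := by
    simp_rw [laguerre_sq]
    exact HasExpGrowth.sum _ fun i => HasExpGrowth.sum _ fun l =>
      (HasExpGrowth.const _).mul (h2.pow _)
  have h4 : HasExpGrowth fun w : Fin n → ℂ => ((Real.exp (-normSq (z - w)) : ℝ) : ℂ) := by
    have hc := continuous_normSq (n := n)
    refine ⟨by fun_prop, 1, 0, fun w => ?_⟩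
    rw [Complex.norm_real, Real.norm_of_nonneg (Real.exp_pos _).le, zero_mul, Real.exp_zero,
      mul_one, Real.exp_le_one_iff, neg_nonpos]
    exact Finset.sum_nonneg fun j _ => sq_nonneg _
  have h := h1.mul ((h4.mul h3).mul
    (HasExpGrowth.const ((1 / ((m + (n - 1)).choose m : ℝ) ^ 2 : ℝ) : ℂ)))
  have e : deformedKernel n m z = fun w => Complex.exp (herm z w) *
      (((Real.exp (-normSq (z - w)) : ℝ) : ℂ) *
        (((laguerre m (n - 1) (normSq (z - w))) ^ 2 : ℝ) : ℂ) *
        ((1 / ((m + (n - 1)).choose m : ℝ) ^ 2 : ℝ) : ℂ)) := funext fun w => by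
    rw [deformedKernel_eq, ← Complex.ofReal_mul, ← Complex.ofReal_mul, div_pow, mul_one_div,
      mul_div_assoc]
  rw [e]
  exact h

/-- The complex conjugate of the section `deformedKernel n m z` as a vector, so that the transform
at the point `z` is an inner product. -/
def kernelVector (n m : ℕ) (z : Fin n → ℂ) : L2 n :=
  (hasExpGrowth_deformedKernel n m z).conj.memLp.toLp _

theorem inner_kernelVector_ae (n m : ℕ) (z : Fin n → ℂ) (φ : L2 n) :
    (fun w => inner ℂ (kernelVector n m z w) (φ w)) =ᵐ[gaussian n]
      fun w => deformedKernel n m z w * φ w := by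
  filter_upwards [(hasExpGrowth_deformedKernel n m z).conj.memLp.coeFn_toLp] with w hw
  rw [kernelVector, hw, RCLike.inner_apply, Complex.conj_conj, mul_comm]

theorem integrable_deformedKernel_mul (n m : ℕ) (z : Fin n → ℂ) (φ : L2 n) :
    Integrable (fun w => deformedKernel n m z w * φ w) (gaussian n) :=
  (L2.integrable_inner (kernelVector n m z) φ).congr (inner_kernelVector_ae n m z φ)

theorem deformedBerezin_eq_inner (n m : ℕ) (z : Fin n → ℂ) (φ : L2 n) :
    deformedBerezin n m φ z = inner ℂ (kernelVector n m z) φ := by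
  rw [L2.inner_def, integral_congr_ae (inner_kernelVector_ae n m z φ), deformedBerezin]

theorem tendsto_ascFactorial_mul_pow (n j : ℕ) :
    Tendsto (fun k : ℕ => ((n + k).ascFactorial j : ℝ) * (1 / 2) ^ (n + k + j)) atTop (𝓝 0) := by
  have h := (tendsto_pow_const_mul_const_pow_of_abs_lt_one j
    (show |(1 / 2 : ℝ)| < 1 by norm_num [abs_of_pos])).comp
      (tendsto_atTop_mono (fun k => by omega : ∀ k : ℕ, k ≤ n + k + j) tendsto_id)
  refine squeeze_zero (fun k => by positivity) (fun k => ?_) h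
  have h1 : ((n + k).ascFactorial j : ℝ) ≤ ((n + k + j : ℕ) : ℝ) ^ j := by
    exact_mod_cast (Nat.ascFactorial_le j (Nat.le_succ (n + k))).trans
      (Nat.ascFactorial_le_pow_add (n + k) j)
  dsimp only [Function.comp]
  gcongr

/-- On `ℕ` the spectral function is a polynomial times `2 ^ (-k)`. -/
theorem tendsto_spectralFunction_natCast (m : ℕ) (hn : 1 ≤ n) :
    Tendsto (fun k : ℕ => spectralFunction n m k) atTop (𝓝 0) := by
  have h1 : ∀ p, Tendsto (fun k => powerEigenvalue n k p) atTop (𝓝 0) := fun p => by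
    have h := tendsto_finsetSum (Finset.range (p + 1)) fun j _ =>
      ((Complex.continuous_ofReal.tendsto 0).comp (tendsto_ascFactorial_mul_pow n j)).const_mul
        ((-1 : ℂ) ^ j * (p.choose j * (n + j).ascFactorial (p - j)))
    simp only [Complex.ofReal_zero, mul_zero, Finset.sum_const_zero] at h
    refine h.congr fun k => Finset.sum_congr rfl fun j _ => ?_
    simp only [Function.comp]
    push_cast
    ring
  simp_rw [spectralFunction_natCast n m _ hn]
  rw [← mul_zero ((Real.pi : ℂ) ^ n / ((m + (n - 1)).choose m : ℂ) ^ 2)]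
  refine Tendsto.const_mul _ ?_
  have h2 := tendsto_finsetSum (Finset.range (m + 1)) fun i _ =>
    tendsto_finsetSum (Finset.range (m + 1)) fun l _ =>
      (h1 (i + l)).const_mul (laguerreCoeff n m i * laguerreCoeff n m l)
  simpa using h2

theorem exists_bound_spectralFunction_natCast (m : ℕ) (hn : 1 ≤ n) :
    ∃ C, ∀ k : ℕ, ‖spectralFunction n m k‖ ≤ C := by
  obtain ⟨C, hC⟩ := (tendsto_spectralFunction_natCast m hn).norm.bddAbove_range
  exact ⟨C, fun k => hC ⟨k, rfl⟩⟩

/-- The functions `φ` on which a bounded operator `B` of `L²` agrees almost everywhere with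
`z ↦ ⟨κ z, φ⟩` form a closed set, since `L²`-convergent sequences have almost everywhere convergent
subsequences. -/
theorem isClosed_setOf_ae_eq_inner {α : Type*} [MeasurableSpace α] {μ : Measure α}
    (B : Lp ℂ 2 μ →L[ℂ] Lp ℂ 2 μ) (κ : α → Lp ℂ 2 μ) :
    IsClosed {φ : Lp ℂ 2 μ | B φ =ᵐ[μ] fun z => inner ℂ (κ z) φ} := by
  refine isSeqClosed_iff_isClosed.1 fun φ ψ hφ hlim => ?_
  have h1 : Tendsto (fun N => B (φ N)) atTop (𝓝 (B ψ)) := (B.continuous.tendsto ψ).comp hlim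
  obtain ⟨ns, hns, hae⟩ := (tendstoInMeasure_of_tendsto_Lp h1).exists_seq_tendsto_ae
  filter_upwards [hae, ae_all_iff.2 hφ] with z hz hzφ
  have h2 : Tendsto (fun N => inner ℂ (κ z) (φ (ns N))) atTop (𝓝 (inner ℂ (κ z) ψ)) :=
    tendsto_const_nhds.inner (hlim.comp hns.tendsto_atTop)
  refine tendsto_nhds_unique hz (h2.congr fun N => (hzφ (ns N)).symm)

/-- The operator that acts on the `k`-th eigenspace as the scalar `spectralFunction n m k`. -/
def berezinOperator (m : ℕ) (hn : 1 ≤ n) : L2 n →L[ℂ] L2 n :=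
  SpectralCalculus.diagonal (eigenEquiv n) (fun k => spectralFunction n m k)
    (exists_bound_spectralFunction_natCast m hn)

theorem berezinOperator_eigenvector (m : ℕ) (hn : 1 ≤ n) (u v : Fin n → ℂ) (k : ℕ) :
    berezinOperator m hn (eigenvector u v k) = spectralFunction n m k • eigenvector u v k := by
  refine SpectralCalculus.ext_coord (eigenEquiv n) fun l => ?_
  have h := eigenEquiv_coe ⟨_, eigenvector_mem_eigenspace u v k⟩
  dsimp only at h
  rw [berezinOperator, SpectralCalculus.coord_diagonal, map_smul, lp.coeFn_smul, Pi.smul_apply, h]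
  rcases eq_or_ne l k with rfl | hl
  · rfl
  · simp [Pi.single_eq_of_ne hl]

/-- Both sides agree on the eigenfunctions, and the set of functions on which they agree is a closed
subspace. -/
theorem berezinOperator_ae_eq (m : ℕ) (hn : 1 ≤ n) (φ : L2 n) :
    berezinOperator m hn φ =ᵐ[gaussian n] deformedBerezin n m φ := by
  let S : Submodule ℂ (L2 n) :=
    { carrier := {φ | berezinOperator m hn φ =ᵐ[gaussian n]
        fun z => inner ℂ (kernelVector n m z) φ}
      zero_mem' := by
        simp only [Set.mem_ofPred_eq, map_zero, inner_zero_right]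
        exact Lp.coeFn_zero _ _ _
      add_mem' := fun {x y} hx hy => by
        simp only [Set.mem_ofPred_eq, map_add, inner_add_right] at hx hy ⊢
        exact (Lp.coeFn_add _ _).trans (hx.add hy)
      smul_mem' := fun c x hx => by
        simp only [Set.mem_ofPred_eq, map_smul, inner_smul_right] at hx ⊢
        exact (Lp.coeFn_smul _ _).trans (hx.const_smul c) }
  have hS : IsClosed (S : Set (L2 n)) := isClosed_setOf_ae_eq_inner _ _
  have hE : ∀ k u v, eigenvector u v k ∈ S := fun k u v => by
    change berezinOperator m hn (eigenvector u v k) =ᵐ[gaussian n] _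
    rw [berezinOperator_eigenvector]
    filter_upwards [Lp.coeFn_smul (spectralFunction n m k) (eigenvector u v k),
      coeFn_eigenvector u v k] with z h1 h2
    rw [h1, Pi.smul_apply, h2, ← deformedBerezin_eq_inner, smul_eq_mul,
      ← deformedBerezin_eigenfunction m hn]
    refine integral_congr_ae ?_
    filter_upwards [coeFn_eigenvector u v k] with w hw
    rw [hw]
  have hmem : φ ∈ S := hS.mem_of_tendsto (hasSum_coord φ) (Eventually.of_forall fun s =>
    Submodule.sum_mem _ fun k _ => eigenspace_le hS (hE k) (eigenEquiv n φ k).2)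
  have h : berezinOperator m hn φ =ᵐ[gaussian n] fun z => inner ℂ (kernelVector n m z) φ := hmem
  simp_rw [← deformedBerezin_eq_inner] at h
  exact h

end Magnetic
end

theorem theorem3p2 (n m : ℕ) (hn : 1 ≤ n) :
    ∃ B : Magnetic.L2 n →L[ℂ] Magnetic.L2 n,
      (∀ φ : Magnetic.L2 n,
        (∀ z : Fin n → ℂ,
          Integrable (fun w => Magnetic.deformedKernel n m z w * φ w) (Magnetic.gaussian n)) ∧
        B φ =ᵐ[Magnetic.gaussian n] Magnetic.deformedBerezin n m φ) ∧
      SpectralCalculus.IsFunctionOf (Magnetic.magneticLaplacian n)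
        (Magnetic.spectralFunction n m)
        ((B : Magnetic.L2 n →ₗ[ℂ] Magnetic.L2 n).toPMap ⊤) :=
  ⟨Magnetic.berezinOperator m hn,
    fun φ => ⟨fun z => Magnetic.integrable_deformedKernel_mul n m z φ,
      Magnetic.berezinOperator_ae_eq m hn φ⟩,
    SpectralCalculus.isFunctionOf_diagonal (Magnetic.eigenEquiv n) _
      Magnetic.mem_graph_magneticLaplacian_iff _ _ fun _ => rfl⟩
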